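/- **Setting.** Let $\mathfrak X$ be a connected, second countable differentiable manifold (of class $C^1$) of dimension $n$ with a continuous Riemannian metric, $\mathrm{dist}$ its geodesic distance, and $\omega$ its Riemannian volume measure ($d\omega=\sqrt{\det g}\,dx_1\cdots dx_n$ in local coordinates). Let $\mathscr M(\mathfrak X)$ be the set of Borel probability measures on $\mathfrak X$ with the topology of weak convergence. Let $\mathrm g:\mathfrak X\times\mathfrak X\to(-\infty,+\infty]$, $V:\mathfrak X\to(-\infty,+\infty]$ and $\vartheta:\mathfrak X\to[0,+\infty)$ satisfy: 1. $\mathrm g$ is symmetric and lower semicontinuous, and for every $\epsilon>0$ there is $\delta>0$ such that $|\mathrm g(u,x)|\le\epsilon\,\mathrm{dist}(u,x)^{-n}$ for all $u\ne x$ with $\mathrm{dist}(u,x)\le\delta$. 2. There is a sequence of real numbers $\mathrm c_k\to0$ such that for every integer $k\ge1$ one can write $\mathrm g=\mathrm g_k+\mathrm g^k$ with $\mathrm g_k\le k$ real valued and continuous on $\mathfrak X\times\mathfrak X$, $\mathrm g^k:\mathfrak X\times\mathfrak X\to[0,+\infty]$, and, for some $p>1$, $\int\mathrm g^k(u,x)^p\,\omega(dx)\le\mathrm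 c_k$ for all $u\in\mathfrak X$. 3. $\vartheta$ is continuous and $-\mathrm g(u,x)\le\vartheta(u)+\vartheta(x)$ for all $u,x\in\mathfrak X$. 4. For every $\kappa\ge0$ the function $\widetilde V_\kappa=V-\kappa\vartheta$ is bounded from below, the set $\{\widetilde V_\kappa<+\infty\}$ is open and nonempty, $\widetilde V_\kappa$ is continuous on this set, and $\int e^{-\widetilde V_\kappa}d\omega<+\infty$ (with $e^{-\infty}=0$). (The kernel $\mathrm g$ is thus allowed to be unbounded from below.) For $\beta>0$ and $N\in\mathbb N$ consider on $\mathfrak X^N$ the Gibbs measure $$\mathbb P_N[d\mathbf x]=\frac{e^{-\mathscr H_N(\mathbf x)}}{\mathrm Z_N}\prod_{j=1}^N\omega(dx_j),\qquad \mathscr H_N(\mathbf x)=\beta\sum_{1\le i<j\le N}\mathrm g(x_i,x_j)+\sum_{j=1}^NV(x_j),\qquad \mathrm Z_N=\int e^{-\mathscr H_N(\mathbf x)}\prod_{j=1}^N\omega(dx_j),$$ and the empirical measure $\widehat\mu_N=N^{-1}\sum_{j=1}^N\delta_{x_j}$. For $\gamma>0$ let $\nu_\gamma$ be the probability measure proportional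 to $e^{-\widetilde V_\gamma}\omega$ and define the free energy $$\mathscr F_\gamma(\mu)=\frac\gamma2\iint\big(\mathrm g(x,z)+\vartheta(x)+\vartheta(z)\big)\mu(dz)\mu(dx)+\mathrm H(\mu|\nu_\gamma)\in[0,+\infty],\qquad\mu\in\mathscr M(\mathfrak X),$$ where $\mathrm H(\mu|\nu_\gamma)=\int\log\frac{d\mu}{d\nu_\gamma}d\mu$ if $\mu\ll\nu_\gamma$ and $+\infty$ otherwise. **Proposition.** Let $\gamma>0$ and let $\beta=\beta_N>0$ be a sequence with $N\beta_N\to\gamma$ as $N\to+\infty$. Then $0<\mathrm Z_N<+\infty$ for all $N$, $\mathscr F_\gamma$ is not identically $+\infty$, and under $\mathbb P_N$ the sequence of empirical measures $\widehat\mu_N$ satisfies a large deviation principle in $\mathscr M(\mathfrak X)$ with speed $\beta_NN^2\to+\infty$ and good rate function $$I=\gamma^{-1}\Big(\mathscr F_\gamma-\inf_{\mathscr M(\mathfrak X)}\mathscr F_\gamma\Big).$$ That is, $I$ is lower semicontinuous with compact sublevel sets $\{I\le r\}$, $r\ge0$, and for every closed $C\subset\mathscr M(\mathfrak X)$ and every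 open $O\subset\mathscr M(\mathfrak X)$, $$\limsup_{N\to\infty}\frac{1}{\beta_NN^2}\log\mathbb P_N[\widehat\mu_N\in C]\le-\inf_CI,\qquad\liminf_{N\to\infty}\frac{1}{\beta_NN^2}\log\mathbb P_N[\widehat\mu_N\in O]\ge-\inf_OI.$$ -/

import Mathlib

open scoped Manifold Topology ENNReal NNReal
open MeasureTheory Bundle Filter

noncomputable section RiemannianVolume

/-- Charts map measurable sets to measurable sets. -/
theorem measurableSet_chart_image {n : ℕ} {X : Type*} [TopologicalSpace X] [MeasurableSpace X]
    [BorelSpace X] (e : OpenPartialHomeomorph X (EuclideanSpace ℝ (Fin n)))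
    {s : Set X} (hs : MeasurableSet s) (hse : s ⊆ e.source) : MeasurableSet (e '' s) := by
  have h1 : Measurable (e.target.domRestrict e.symm) := e.continuousOn_symm.domRestrict.measurable
  have h2 := e.open_target.measurableSet.subtype_image (h1 hs)
  convert! h2 using 1
  rw [e.image_eq_target_inter_inv_preimage hse]
  ext y
  simp [Set.domRestrict, and_comm]

variable {n : ℕ} {X : Type*} [TopologicalSpace X] [ChartedSpace (EuclideanSpace ℝ (Fin n)) X]

/-- The coordinate vector field `∂ᵢ` of the chart `e`, at the point with coordinates `y`. -/
def coordVector (e : OpenPartialHomeomorph X (EuclideanSpace ℝ (Fin n)))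
    (y : EuclideanSpace ℝ (Fin n)) (i : Fin n) : TangentSpace (𝓡 n) (e.symm y) :=
  mfderiv (𝓡 n) (𝓡 n) e.symm y (EuclideanSpace.basisFun (Fin n) ℝ i)

/-- Countably many charts cover the manifold. -/
theorem exists_countable_charts (n : ℕ) (X : Type*) [TopologicalSpace X]
    [ChartedSpace (EuclideanSpace ℝ (Fin n)) X] [SecondCountableTopology X] [Nonempty X] :
    ∃ c : ℕ → X, ⋃ i, (chartAt (EuclideanSpace ℝ (Fin n)) (c i)).source = Set.univ := by
  obtain ⟨s, hs, hcov⟩ := TopologicalSpace.countable_cover_nhds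
    (f := fun x : X => (chartAt (EuclideanSpace ℝ (Fin n)) x).source)
    (fun x => (chartAt (EuclideanSpace ℝ (Fin n)) x).open_source.mem_nhds (mem_chart_source _ x))
  have hne : s.Nonempty := by
    by_contra h
    rw [Set.not_nonempty_iff_eq_empty] at h
    subst h
    simp at hcov
    exact (Set.univ_nonempty (α := X)).ne_empty hcov.symm
  obtain ⟨c, rfl⟩ := hs.exists_eq_range hne
  exact ⟨c, by simpa [Set.biUnion_range] using hcov⟩

variable [RiemannianBundle (fun x : X => TangentSpace (𝓡 n) x)]

/-- The matrix `(gᵢⱼ)` of the Riemannian metric in the chart `e`, as a function of the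
coordinates. -/
def metricMatrix (e : OpenPartialHomeomorph X (EuclideanSpace ℝ (Fin n)))
    (y : EuclideanSpace ℝ (Fin n)) : Matrix (Fin n) (Fin n) ℝ :=
  Matrix.of fun i j => inner ℝ (coordVector e y i) (coordVector e y j)

/-- The density `√det g` of the Riemannian volume in the chart `e`. -/
def volumeDensity (e : OpenPartialHomeomorph X (EuclideanSpace ℝ (Fin n)))
    (y : EuclideanSpace ℝ (Fin n)) : ℝ≥0∞ :=
  ENNReal.ofReal (Real.sqrt (metricMatrix e y).det)

/-- Transport of inner products of tangent vectors along an equality of base points. -/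
theorem inner_tangent_congr {x x' : X} (h : x = x') (v w : EuclideanSpace ℝ (Fin n)) :
    inner ℝ (show TangentSpace (𝓡 n) x from v) (show TangentSpace (𝓡 n) x from w) =
    inner ℝ (show TangentSpace (𝓡 n) x' from v) (show TangentSpace (𝓡 n) x' from w) := by
  subst h; rfl

/-- Change of charts: `det g` is multiplied by the square of the Jacobian determinant. -/
theorem det_metricMatrix_change [IsManifold (𝓡 n) 1 X]
    {e e' : OpenPartialHomeomorph X (EuclideanSpace ℝ (Fin n))}
    (he : e ∈ atlas (EuclideanSpace ℝ (Fin n)) X) (he' : e' ∈ atlas (EuclideanSpace ℝ (Fin n)) X)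
    {y : EuclideanSpace ℝ (Fin n)} (hy : y ∈ e.target) (hy' : e.symm y ∈ e'.source) :
    (metricMatrix e y).det =
      (fderiv ℝ (e' ∘ e.symm) y).det ^ 2 * (metricMatrix e' ((e' ∘ e.symm) y)).det := by
  set φ := e' ∘ e.symm with hφ
  have hpt : e'.symm (φ y) = e.symm y := e'.left_inv hy'
  have hed := mdifferentiable_of_mem_atlas (I := 𝓡 n) he
  have hed' := mdifferentiable_of_mem_atlas (I := 𝓡 n) he'
  have h1 : MDifferentiableAt (𝓡 n) (𝓡 n) e.symm y := hed.mdifferentiableAt_symm hy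
  have h2 : MDifferentiableAt (𝓡 n) (𝓡 n) e' (e.symm y) := hed'.mdifferentiableAt hy'
  have h3 : MDifferentiableAt (𝓡 n) (𝓡 n) φ y := h2.comp y h1
  have h4 : MDifferentiableAt (𝓡 n) (𝓡 n) e'.symm (φ y) :=
    hed'.mdifferentiableAt_symm (e'.map_source hy')
  have hev : (e.symm : EuclideanSpace ℝ (Fin n) → X) =ᶠ[𝓝 y] e'.symm ∘ φ := by
    have : ∀ᶠ z in 𝓝 y, e.symm z ∈ e'.source :=
      (e.continuousAt_symm hy).eventually (e'.open_source.mem_nhds hy')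
    filter_upwards [this] with z hz
    exact (e'.left_inv hz).symm
  have hd := hev.mfderiv_eq (I := 𝓡 n) (I' := 𝓡 n)
  have hd2 := mfderiv_comp (I := 𝓡 n) (I' := 𝓡 n) (I'' := 𝓡 n) y h4 h3
  have hvec : ∀ v : EuclideanSpace ℝ (Fin n),
      (show EuclideanSpace ℝ (Fin n) from mfderiv (𝓡 n) (𝓡 n) e.symm y v) =
      (show EuclideanSpace ℝ (Fin n) from mfderiv (𝓡 n) (𝓡 n) e'.symm (φ y) (fderiv ℝ φ y v)) := by
    intro v
    rw [← mfderiv_eq_fderiv]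
    have := congrArg (fun L => L v) hd
    have h' := congrArg (fun L => L v) hd2
    exact this.trans h'
  set L := fderiv ℝ φ y with hL
  let b := EuclideanSpace.basisFun (Fin n) ℝ
  let J : Matrix (Fin n) (Fin n) ℝ := LinearMap.toMatrix b.toBasis b.toBasis L.toLinearMap
  have hdet : J.det = L.det := by
    simp [J, ContinuousLinearMap.det, LinearMap.det_toMatrix]
  have hexp : ∀ j, L (b j) = ∑ i, J i j • b i := by
    intro j
    have := (b.toBasis.sum_repr (L (b j))).symm
    simpa [J, LinearMap.toMatrix_apply] using this
  let D : EuclideanSpace ℝ (Fin n) →L[ℝ] TangentSpace (𝓡 n) (e'.symm (φ y)) :=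
    mfderiv (𝓡 n) (𝓡 n) e'.symm (φ y)
  have hmat : metricMatrix e y = J.transpose * metricMatrix e' (φ y) * J := by
    ext i j
    have h1 : metricMatrix e y i j =
        inner ℝ (D (L (b i))) (D (L (b j))) := by
      have := inner_tangent_congr hpt.symm (coordVector e y i) (coordVector e y j)
      refine this.trans ?_
      have hi := hvec (b i)
      have hj := hvec (b j)
      change (coordVector e y i : EuclideanSpace ℝ (Fin n)) = D (L (b i)) at hi
      change (coordVector e y j : EuclideanSpace ℝ (Fin n)) = D (L (b j)) at hj
      rw [hi, hj]
    rw [h1, hexp, hexp, map_sum, map_sum]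
    simp only [map_smul, sum_inner, inner_sum, real_inner_smul_left, real_inner_smul_right]
    simp only [Matrix.mul_apply, Matrix.transpose_apply, Finset.sum_mul]
    refine Finset.sum_congr rfl fun k _ => Finset.sum_congr rfl fun l _ => ?_
    have : metricMatrix e' (φ y) l k = inner ℝ (D (b l)) (D (b k)) := rfl
    rw [this]; ring
  rw [hmat, Matrix.det_mul, Matrix.det_mul, Matrix.det_transpose, hdet]
  ring

/-- Change of charts for the density `√det g`. -/
theorem volumeDensity_change [IsManifold (𝓡 n) 1 X]
    {e e' : OpenPartialHomeomorph X (EuclideanSpace ℝ (Fin n))}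
    (he : e ∈ atlas (EuclideanSpace ℝ (Fin n)) X) (he' : e' ∈ atlas (EuclideanSpace ℝ (Fin n)) X)
    {y : EuclideanSpace ℝ (Fin n)} (hy : y ∈ e.target) (hy' : e.symm y ∈ e'.source) :
    volumeDensity e y = ENNReal.ofReal |(fderiv ℝ (e' ∘ e.symm) y).det| *
      volumeDensity e' ((e' ∘ e.symm) y) := by
  rw [volumeDensity, det_metricMatrix_change he he' hy hy', Real.sqrt_mul (sq_nonneg _),
    Real.sqrt_sq_eq_abs, ENNReal.ofReal_mul (abs_nonneg _), volumeDensity]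


/-- The Riemannian volume on the domain of the chart `e`: the image under `e⁻¹` of the measure
`√det g dx₁ ⋯ dxₙ`. -/
def chartVolume [MeasurableSpace X] [BorelSpace X]
    (e : OpenPartialHomeomorph X (EuclideanSpace ℝ (Fin n))) : Measure X :=
  (((volume : Measure (EuclideanSpace ℝ (Fin n))).restrict e.target).withDensity
    (volumeDensity e)).map e.symm

/-- The chart volume of a subset of the chart domain. -/
theorem chartVolume_apply [MeasurableSpace X] [BorelSpace X]
    (e : OpenPartialHomeomorph X (EuclideanSpace ℝ (Fin n)))
    {s : Set X} (hs : MeasurableSet s) (hse : s ⊆ e.source) :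
    chartVolume e s = ∫⁻ y in e '' s, volumeDensity e y := by
  have hme : MeasurableSet e.target := e.open_target.measurableSet
  have hmeas : AEMeasurable e.symm
      (((volume : Measure (EuclideanSpace ℝ (Fin n))).restrict e.target).withDensity
        (volumeDensity e)) :=
    (e.continuousOn_symm.aemeasurable hme).mono_ac (withDensity_absolutelyContinuous _ _)
  have himg : e '' s = e.target ∩ e.symm ⁻¹' s := e.image_eq_target_inter_inv_preimage hse
  have hmi : MeasurableSet (e '' s) := measurableSet_chart_image e hs hse
  have hnull : ((volume : Measure (EuclideanSpace ℝ (Fin n))).restrict e.target).withDensity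
        (volumeDensity e) e.targetᶜ = 0 :=
    withDensity_absolutelyContinuous _ _ (by simp [Measure.restrict_apply hme.compl])
  rw [chartVolume, Measure.map_apply_of_aemeasurable hmeas hs,
    ← measure_inter_conull (t := e.target) (by simpa using hnull), Set.inter_comm, ← himg,
    withDensity_apply _ hmi, Measure.restrict_restrict hmi,
    Set.inter_eq_left.mpr (himg.trans_subset Set.inter_subset_left)]

/-- The chart volumes of two charts agree on the intersection of their domains. -/
theorem lintegral_volumeDensity_change [MeasurableSpace X] [BorelSpace X] [IsManifold (𝓡 n) 1 X]
    {e e' : OpenPartialHomeomorph X (EuclideanSpace ℝ (Fin n))}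
    (he : e ∈ atlas (EuclideanSpace ℝ (Fin n)) X) (he' : e' ∈ atlas (EuclideanSpace ℝ (Fin n)) X)
    {s : Set X} (hs : MeasurableSet s) (hse : s ⊆ e.source) (hse' : s ⊆ e'.source) :
    ∫⁻ y in e' '' s, volumeDensity e' y = ∫⁻ y in e '' s, volumeDensity e y := by
  have himg : e' '' s = (e' ∘ e.symm) '' (e '' s) := by
    rw [Set.image_image]
    exact Set.image_congr fun x hx => by simp [e.left_inv (hse hx)]
  have hmem : ∀ y ∈ e '' s, y ∈ e.target ∧ e.symm y ∈ s := by
    rintro _ ⟨x, hx, rfl⟩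
    exact ⟨e.map_source (hse hx), by rwa [e.left_inv (hse hx)]⟩
  have hmi : MeasurableSet (e '' s) := measurableSet_chart_image e hs hse
  have hinj : Set.InjOn (e' ∘ e.symm) (e '' s) := by
    intro y hy z hz h
    have h1 := e'.injOn (hse' (hmem y hy).2) (hse' (hmem z hz).2) h
    exact e.symm.injOn (hmem y hy).1 (hmem z hz).1 h1
  have hdiff : ∀ y ∈ e '' s, HasFDerivWithinAt (e' ∘ e.symm) (fderiv ℝ (e' ∘ e.symm) y)
      (e '' s) y := by
    intro y hy
    have h1 := (mdifferentiable_of_mem_atlas (I := 𝓡 n) he).mdifferentiableAt_symm (hmem y hy).1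
    have h2 := (mdifferentiable_of_mem_atlas (I := 𝓡 n) he').mdifferentiableAt
      (hse' (hmem y hy).2)
    have h3 : MDifferentiableAt (𝓡 n) (𝓡 n) (e' ∘ e.symm) y := h2.comp y h1
    exact h3.differentiableAt.hasFDerivAt.hasFDerivWithinAt
  rw [himg, lintegral_image_eq_lintegral_abs_det_fderiv_mul _ hmi hdiff hinj]
  exact setLIntegral_congr_fun hmi fun y hy =>
    (volumeDensity_change he he' (hmem y hy).1 (hse' (hmem y hy).2)).symm

/-- The Riemannian volume measure `ω`, glued from the chart volumes along a countable cover by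
charts; it does not depend on the cover, see `riemannianVolume_apply`. -/
def riemannianVolume (n : ℕ) (X : Type*) [TopologicalSpace X]
    [ChartedSpace (EuclideanSpace ℝ (Fin n)) X]
    [RiemannianBundle (fun x : X => TangentSpace (𝓡 n) x)]
    [SecondCountableTopology X] [Nonempty X] [MeasurableSpace X] [BorelSpace X] : Measure X :=
  let e : ℕ → OpenPartialHomeomorph X (EuclideanSpace ℝ (Fin n)) :=
    fun i => chartAt (EuclideanSpace ℝ (Fin n)) ((exists_countable_charts n X).choose i)
  Measure.sum fun i => (chartVolume (e i)).restrict (disjointed (fun j => (e j).source) i)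

/-- In every chart of the atlas, the Riemannian volume is `√det g dx₁ ⋯ dxₙ`. -/
theorem riemannianVolume_apply [SecondCountableTopology X] [Nonempty X] [MeasurableSpace X]
    [BorelSpace X] [IsManifold (𝓡 n) 1 X]
    {e : OpenPartialHomeomorph X (EuclideanSpace ℝ (Fin n))}
    (he : e ∈ atlas (EuclideanSpace ℝ (Fin n)) X)
    {s : Set X} (hs : MeasurableSet s) (hse : s ⊆ e.source) :
    riemannianVolume n X s = ∫⁻ y in e '' s, volumeDensity e y := by
  set f : ℕ → OpenPartialHomeomorph X (EuclideanSpace ℝ (Fin n)) :=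
    fun i => chartAt (EuclideanSpace ℝ (Fin n)) ((exists_countable_charts n X).choose i) with hf
  set A : ℕ → Set X := disjointed (fun j => (f j).source) with hA
  have hAm : ∀ i, MeasurableSet (A i) :=
    fun i => MeasurableSet.disjointed (fun j => (f j).open_source.measurableSet) i
  have hAs : ∀ i, A i ⊆ (f i).source := fun i => disjointed_subset _ i
  have hAd : Pairwise (Function.onFun Disjoint A) := disjoint_disjointed _
  have hAu : ⋃ i, A i = Set.univ := by
    rw [hA, iUnion_disjointed]; exact (exists_countable_charts n X).choose_spec
  have hpart : s = ⋃ i, s ∩ A i := by rw [← Set.inter_iUnion, hAu, Set.inter_univ]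
  have hterm : ∀ i, (chartVolume (f i)).restrict (A i) s =
      ∫⁻ y in e '' (s ∩ A i), volumeDensity e y := by
    intro i
    have hsi : MeasurableSet (s ∩ A i) := hs.inter (hAm i)
    rw [Measure.restrict_apply hs, chartVolume_apply (f i) hsi (Set.inter_subset_right.trans (hAs i))]
    exact lintegral_volumeDensity_change he (chart_mem_atlas _ _) hsi
      (Set.inter_subset_left.trans hse) (Set.inter_subset_right.trans (hAs i))
  have hsum : riemannianVolume n X s = ∑' i, (chartVolume (f i)).restrict (A i) s :=
    Measure.sum_apply _ hs
  rw [hsum]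
  simp_rw [hterm]
  have himg : e '' s = ⋃ i, e '' (s ∩ A i) := by rw [← Set.image_iUnion, ← hpart]
  rw [himg, lintegral_iUnion
    (fun i => measurableSet_chart_image e (hs.inter (hAm i)) (Set.inter_subset_left.trans hse))]
  intro i j hij
  refine Set.disjoint_left.mpr ?_
  rintro _ ⟨x, hx, rfl⟩ ⟨z, hz, hzx⟩
  have h := e.injOn (hse hz.1) (hse hx.1) hzx
  subst h
  exact Set.disjoint_left.mp (hAd hij) hx.2 hz.2

end RiemannianVolume

noncomputable section GibbsMeasure

variable {X : Type*} [MeasurableSpace X]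

/-- The energy `H_N(x) = β ∑_{i < j} g(x_i, x_j) + ∑_j V(x_j)` of a configuration. The values of
`g` and `V` are meant to lie in `(-∞, +∞]`. -/
def gibbsEnergy (β : ℝ) (g : X → X → EReal) (V : X → EReal) {N : ℕ} (x : Fin N → X) : EReal :=
  (β : EReal) * (∑ i, ∑ j ∈ Finset.Ioi i, g (x i) (x j)) + ∑ j, V (x j)

/-- The partition function `∫ e^{-H_N} dω^{⊗N}`. -/
def partitionFunction (ω : Measure X) (β : ℝ) (g : X → X → EReal) (V : X → EReal) (N : ℕ) :
    ℝ≥0∞ :=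
  ∫⁻ x : Fin N → X, EReal.exp (-gibbsEnergy β g V x) ∂(Measure.pi fun _ => ω)

/-- The Gibbs measure on `X^N`. -/
def gibbsMeasure (ω : Measure X) (β : ℝ) (g : X → X → EReal) (V : X → EReal) (N : ℕ) :
    Measure (Fin N → X) :=
  (partitionFunction ω β g V N)⁻¹ •
    (Measure.pi fun _ => ω).withDensity fun x => EReal.exp (-gibbsEnergy β g V x)

/-- The empirical measure `N⁻¹ ∑_j δ_{x_j}`; a probability measure when `N ≥ 1`. -/
def empiricalMeasure {N : ℕ} (x : Fin N → X) : Measure X :=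
  (N : ℝ≥0∞)⁻¹ • ∑ j, Measure.dirac (x j)

/-- The probability, under the Gibbs measure on `X^N`, that the empirical measure belongs to the
set `A` of probability measures. -/
def empiricalLaw (ω : Measure X) (β : ℝ) (g : X → X → EReal) (V : X → EReal) (N : ℕ)
    (A : Set (ProbabilityMeasure X)) : ℝ≥0∞ :=
  gibbsMeasure ω β g V N {x | ∃ μ ∈ A, (μ : Measure X) = empiricalMeasure x}

/-- The potential `V - κ ϑ`. -/
def shiftedPotential (V : X → EReal) (ϑ : X → ℝ) (κ : ℝ) (x : X) : EReal :=
  V x - ((κ * ϑ x : ℝ) : EReal)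

/-- The reference probability measure `ν_κ ∝ e^{-(V - κ ϑ)} ω`. -/
def referenceMeasure (ω : Measure X) (V : X → EReal) (ϑ : X → ℝ) (κ : ℝ) : Measure X :=
  (∫⁻ x, EReal.exp (-shiftedPotential V ϑ κ x) ∂ω)⁻¹ •
    ω.withDensity fun x => EReal.exp (-shiftedPotential V ϑ κ x)

/-- The weighted energy `∬ (g(x, z) + ϑ(x) + ϑ(z)) μ(dz) μ(dx)`, whose integrand is nonnegative
when `-g(x, z) ≤ ϑ(x) + ϑ(z)`. -/
def weightedEnergy (g : X → X → EReal) (ϑ : X → ℝ) (μ : Measure X) : ℝ≥0∞ :=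
  ∫⁻ x, ∫⁻ z, (g x z + ((ϑ x + ϑ z : ℝ) : EReal)).toENNReal ∂μ ∂μ

/-- The free energy `(γ / 2) ∬ (g(x, z) + ϑ(x) + ϑ(z)) μ(dz) μ(dx) + H(μ | ν_γ)`. -/
def freeEnergy (ω : Measure X) (g : X → X → EReal) (V : X → EReal) (ϑ : X → ℝ) (γ : ℝ)
    (μ : Measure X) : ℝ≥0∞ :=
  ENNReal.ofReal (γ / 2) * weightedEnergy g ϑ μ +
    InformationTheory.klDiv μ (referenceMeasure ω V ϑ γ)

end GibbsMeasure

section Assumptions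

/-- Regularity and integrability of a potential `U : X → (-∞, +∞]`: the set `{U < +∞}` is open and
nonempty, `U` is continuous on it, and `∫ e^{-U} dω < +∞`. -/
structure IsAdmissiblePotential {X : Type*} [TopologicalSpace X] [MeasurableSpace X]
    (ω : Measure X) (U : X → EReal) : Prop where
  isOpen : IsOpen {x | U x < ⊤}
  nonempty : {x | U x < ⊤}.Nonempty
  continuousOn : ContinuousOn U {x | U x < ⊤}
  lintegral_lt_top : ∫⁻ x, EReal.exp (-U x) ∂ω < ⊤

/-- Conditions on the two-body kernel `g : X × X → (-∞, +∞]` on a space of dimension `n`. -/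
structure IsAdmissibleKernel (n : ℕ) {X : Type*} [MetricSpace X] [MeasurableSpace X]
    (ω : Measure X) (g : X → X → EReal) : Prop where
  symm : ∀ u x, g u x = g x u
  lowerSemicontinuous : LowerSemicontinuous fun q : X × X => g q.1 q.2
  /-- `|g(u, x)| ≤ ε dist(u, x)⁻ⁿ` at small distances (off the diagonal, where the right-hand side
  is finite). -/
  singularity : ∀ ε : ℝ, 0 < ε → ∃ δ : ℝ, 0 < δ ∧ ∀ u x, u ≠ x → dist u x ≤ δ →
    (g u x).abs ≤ ENNReal.ofReal (ε * (dist u x ^ n)⁻¹)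
  /-- `g = g_k + g^k` with `g_k ≤ k` continuous, `g^k ≥ 0` and `∫ g^k(u, x)^p ω(dx) ≤ c_k → 0`. -/
  decomposition : ∃ c : ℕ → ℝ, Tendsto c atTop (𝓝 0) ∧ ∀ k : ℕ, 1 ≤ k →
    ∃ (gc : X → X → ℝ) (gs : X → X → ℝ≥0∞) (p : ℝ), 1 < p ∧
      Continuous (fun q : X × X => gc q.1 q.2) ∧ (∀ u x, gc u x ≤ k) ∧
      (∀ u x, g u x = (gc u x : EReal) + (gs u x : EReal)) ∧
      ∀ u, ∫⁻ x, gs u x ^ p ∂ω ≤ ENNReal.ofReal (c k)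

/-- The assumptions on a kernel `g`, possibly not bounded below, a potential `V` and a compensating
function `ϑ`. -/
structure GasAssumptions (n : ℕ) {X : Type*} [MetricSpace X] [MeasurableSpace X]
    (ω : Measure X) (g : X → X → EReal) (V : X → EReal) (ϑ : X → ℝ) : Prop where
  kernel : IsAdmissibleKernel n ω g
  continuous_theta : Continuous ϑ
  theta_nonneg : ∀ x, 0 ≤ ϑ x
  neg_kernel_le : ∀ u x, -g u x ≤ ((ϑ u + ϑ x : ℝ) : EReal)
  bddBelow : ∀ κ : ℝ, 0 ≤ κ → ∃ m : ℝ, ∀ x, (m : EReal) ≤ shiftedPotential V ϑ κ x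
  potential : ∀ κ : ℝ, 0 ≤ κ → IsAdmissiblePotential ω (shiftedPotential V ϑ κ)

/-- Large deviation principle on `Y` with speed `a` and (good) rate function `I`, where `p N A` is
the probability that the `N`-th random element of `Y` belongs to `A`. -/
structure SatisfiesLDP {Y : Type*} [TopologicalSpace Y] (p : ℕ → Set Y → ℝ≥0∞) (a : ℕ → ℝ)
    (I : Y → ℝ≥0∞) : Prop where
  tendsto_speed : Tendsto a atTop atTop
  lowerSemicontinuous : LowerSemicontinuous I
  isCompact_sublevel : ∀ r : ℝ≥0, IsCompact {y | I y ≤ r}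
  upper_bound : ∀ C : Set Y, IsClosed C →
    limsup (fun N => (((a N)⁻¹ : ℝ) : EReal) * ENNReal.log (p N C)) atTop ≤
      -(⨅ y ∈ C, (I y : EReal))
  lower_bound : ∀ O : Set Y, IsOpen O →
    -(⨅ y ∈ O, (I y : EReal)) ≤
      liminf (fun N => (((a N)⁻¹ : ℝ) : EReal) * ENNReal.log (p N O)) atTop

end Assumptions

/-! The kernel is made nonnegative by moving ϑ from the interaction to the potential. Put G(x, z) =
g(x, z) + ϑ(x) + ϑ(z) ≥ 0. Each particle lies in N - 1 pairs, so the Gibbs weight is exp(-β ∑_{i<j}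
G(x_i, x_j)) times a product of factors e^{-(V - κ ϑ)}, with κ = κ_N = β_N (N - 1) → γ
(`exp_neg_gibbsEnergy`). The reference measures ρ_N = e^{-(V - κ_N ϑ)} ω converge to e^ℓ ν_γ, where
e^ℓ is the mass of e^{-(V - γ ϑ)} ω. Since N β_N → γ, energy and entropy are both of order N, and
the unnormalized Gibbs measure of a neighbourhood of μ should behave like exp(N (ℓ - F_γ(μ))).
Dividing by the total mass, of order exp(N (ℓ - inf F_γ)), and passing from N to the speed β_N N² ~
γ N yields I (`satisfiesLDP_of_exponential_bounds`).

Upper bound: F_γ is a supremum of weakly continuous functionals γ/2 ∬ φ dμ dμ + ∫ f dμ - ∫ e^f dν_γ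
+ 1, with φ ≤ G and f bounded continuous (`dualEnergy`, `exists_lt_dualEnergy`). This combines the
approximation of lower semicontinuous functions from below with the variational formula for the
entropy. Where such a functional exceeds c at the empirical measure, the Boltzmann factor is at most
about e^{-Nc} times a product of functions of one variable, which integrates explicitly
(`eventually_pairGibbs_dualEnergy_le`). A function h with relatively compact sublevel sets and
integrable e^h gives exponential tightness, so finitely many such functionals handle a closed set
(`eventually_pairGibbs_closed_le`). The same duality and the same h show that F_γ is lower
semicontinuous with compact sublevel sets.

Lower bound: for every μ with F_γ(μ) < ∞, the reference product is changed into μ^{⊗N}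
(`eventually_le_pairGibbs_open`). The law of large numbers controls the empirical measure and the
average of log dμ/dν_γ. The pair energy is controlled by Markov's inequality alone: it leaves an
event whose probability is bounded below by a positive constant, which is invisible on the
exponential scale. No regularization of μ is needed. -/

/-! ### Riemannian volume: positivity on open sets and local finiteness. -/

section RiemannianVolumeProperties

variable {n : ℕ} {X : Type*} [TopologicalSpace X] [ChartedSpace (EuclideanSpace ℝ (Fin n)) X]
  [IsManifold (𝓡 n) 1 X]

/-- The coordinate vector fields are continuous sections of the tangent bundle. -/
theorem continuousOn_coordVector {e : OpenPartialHomeomorph X (EuclideanSpace ℝ (Fin n))}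
    (he : e ∈ atlas (EuclideanSpace ℝ (Fin n)) X) (i : Fin n) :
    ContinuousOn (fun y => (⟨e.symm y, coordVector e y i⟩ : TangentBundle (𝓡 n) X)) e.target := by
  -- The coordinate field is the image of a constant field under the tangent map of the C¹ map
  -- `e.symm`.
  have h1 : ContMDiffOn (𝓡 n) (𝓡 n) 1 e.symm e.target :=
    contMDiffOn_symm_of_mem_maximalAtlas (IsManifold.subset_maximalAtlas he)
  have h2 := h1.continuousOn_tangentMapWithin le_rfl e.open_target.uniqueMDiffOn
  have h3 : Continuous fun y : EuclideanSpace ℝ (Fin n) =>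
      (⟨y, EuclideanSpace.basisFun (Fin n) ℝ i⟩ : TangentBundle (𝓡 n) (EuclideanSpace ℝ (Fin n))) := by
    have := (tangentBundleModelSpaceHomeomorph (𝓡 n)).symm.continuous.comp
      (Continuous.prodMk_left (EuclideanSpace.basisFun (Fin n) ℝ i))
    exact this
  refine (h2.comp h3.continuousOn fun y hy => hy).congr fun y hy => ?_
  have h4 := tangentMapWithin_eq_tangentMap (I := 𝓡 n) (I' := 𝓡 n) (f := e.symm) (s := e.target)
    (p := (⟨y, EuclideanSpace.basisFun (Fin n) ℝ i⟩ :
      TangentBundle (𝓡 n) (EuclideanSpace ℝ (Fin n))))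
    (e.open_target.uniqueMDiffOn y hy)
    ((mdifferentiable_of_mem_atlas (I := 𝓡 n) he).mdifferentiableAt_symm hy)
  exact h4.symm

variable [RiemannianBundle (fun x : X => TangentSpace (𝓡 n) x)]

/-- The Gram determinant of the coordinate vectors is positive. -/
theorem metricMatrix_det_pos {e : OpenPartialHomeomorph X (EuclideanSpace ℝ (Fin n))}
    (he : e ∈ atlas (EuclideanSpace ℝ (Fin n)) X) {y : EuclideanSpace ℝ (Fin n)}
    (hy : y ∈ e.target) : 0 < (metricMatrix e y).det := by
  have hinj : Function.Injective (mfderiv (𝓡 n) (𝓡 n) e.symm y) :=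
    (mdifferentiable_of_mem_atlas (I := 𝓡 n) he).symm.mfderiv_injective hy
  have hli : LinearIndependent ℝ (coordVector e y) := by
    have h := (EuclideanSpace.basisFun (Fin n) ℝ).toBasis.linearIndependent
    rw [OrthonormalBasis.coe_toBasis] at h
    exact h.map' (mfderiv (𝓡 n) (𝓡 n) e.symm y).toLinearMap (LinearMap.ker_eq_bot.mpr hinj)
  have h := (Matrix.posDef_gram_of_linearIndependent (𝕜 := ℝ) hli).det_pos
  have h3 : Matrix.gram ℝ (coordVector e y) = metricMatrix e y := by
    ext i j; rfl
  rwa [h3] at h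

variable [IsContinuousRiemannianBundle (EuclideanSpace ℝ (Fin n))
  (fun x : X => TangentSpace (𝓡 n) x)]

/-- The density of the Riemannian volume in a chart is continuous. -/
theorem continuousOn_volumeDensity {e : OpenPartialHomeomorph X (EuclideanSpace ℝ (Fin n))}
    (he : e ∈ atlas (EuclideanSpace ℝ (Fin n)) X) : ContinuousOn (volumeDensity e) e.target := by
  have h : ContinuousOn (metricMatrix e) e.target := by
    refine continuousOn_pi.2 fun i => continuousOn_pi.2 fun j => ?_
    exact ContinuousOn.inner_bundle (continuousOn_coordVector he i) (continuousOn_coordVector he j)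
  have h2 : ContinuousOn (fun y => (metricMatrix e y).det) e.target :=
    (Continuous.matrix_det continuous_id).comp_continuousOn h
  exact ENNReal.continuous_ofReal.comp_continuousOn (Real.continuous_sqrt.comp_continuousOn h2)

variable [SecondCountableTopology X] [Nonempty X] [MeasurableSpace X] [BorelSpace X]

/-- The Riemannian volume charges every nonempty open set. -/
theorem isOpenPosMeasure_riemannianVolume : (riemannianVolume n X).IsOpenPosMeasure := by
  refine ⟨fun U hU ⟨x, hx⟩ h0 => ?_⟩
  set e := chartAt (EuclideanSpace ℝ (Fin n)) x with he
  have hea : e ∈ atlas (EuclideanSpace ℝ (Fin n)) X := chart_mem_atlas _ x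
  have hs : IsOpen (U ∩ e.source) := hU.inter e.open_source
  have h1 : riemannianVolume n X (U ∩ e.source) = 0 := measure_mono_null Set.inter_subset_left h0
  rw [riemannianVolume_apply hea hs.measurableSet Set.inter_subset_right] at h1
  have himg : IsOpen (e '' (U ∩ e.source)) := e.isOpen_image_of_subset_source hs Set.inter_subset_right
  have hsub : e '' (U ∩ e.source) ⊆ e.target := by
    rintro _ ⟨z, hz, rfl⟩; exact e.map_source hz.2
  rw [lintegral_eq_zero_iff' (((continuousOn_volumeDensity hea).mono hsub).aemeasurable
    himg.measurableSet)] at h1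
  have h2 : ∀ᵐ y ∂(volume.restrict (e '' (U ∩ e.source))), False := by
    filter_upwards [h1, ae_restrict_mem himg.measurableSet] with y hy hy2
    have := metricMatrix_det_pos hea (hsub hy2)
    simp [volumeDensity] at hy
    exact absurd hy (not_le.2 (Real.sqrt_pos.2 this))
  have h3 : volume (e '' (U ∩ e.source)) = 0 := by
    rw [Filter.eventually_false_iff_eq_bot, ae_eq_bot, Measure.restrict_eq_zero] at h2
    exact h2
  exact (himg.measure_pos volume ⟨e x, x, ⟨hx, mem_chart_source _ x⟩, rfl⟩).ne' h3

/-- The Riemannian volume is locally finite. -/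
theorem isLocallyFiniteMeasure_riemannianVolume :
    IsLocallyFiniteMeasure (riemannianVolume n X) := by
  refine ⟨fun x => ?_⟩
  set e := chartAt (EuclideanSpace ℝ (Fin n)) x with he
  have hea : e ∈ atlas (EuclideanSpace ℝ (Fin n)) X := chart_mem_atlas _ x
  have hx : x ∈ e.source := mem_chart_source _ x
  have hxt : e x ∈ e.target := e.map_source hx
  have hc : ContinuousAt (volumeDensity e) (e x) :=
    (continuousOn_volumeDensity hea).continuousAt (e.open_target.mem_nhds hxt)
  have hlt : volumeDensity e (e x) < volumeDensity e (e x) + 1 :=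
    ENNReal.lt_add_right ENNReal.ofReal_ne_top one_ne_zero
  have hev : ∀ᶠ y in 𝓝 (e x), volumeDensity e y < volumeDensity e (e x) + 1 :=
    hc.eventually (gt_mem_nhds hlt)
  obtain ⟨r, hr, hball⟩ := Metric.eventually_nhds_iff_ball.1 hev
  set s := e.source ∩ e ⁻¹' Metric.ball (e x) r with hsdef
  have hs : IsOpen s := e.isOpen_inter_preimage Metric.isOpen_ball
  refine ⟨s, hs.mem_nhds ⟨hx, Metric.mem_ball_self hr⟩, ?_⟩
  rw [riemannianVolume_apply hea hs.measurableSet Set.inter_subset_left]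
  have hsub : e '' s ⊆ Metric.ball (e x) r := by
    rintro _ ⟨z, hz, rfl⟩; exact hz.2
  calc ∫⁻ y in e '' s, volumeDensity e y
      ≤ ∫⁻ y in e '' s, (volumeDensity e (e x) + 1) :=
        setLIntegral_mono measurable_const fun y hy => (hball y (hsub hy)).le
    _ = (volumeDensity e (e x) + 1) * volume (e '' s) := by rw [setLIntegral_const]
    _ < ⊤ := ENNReal.mul_lt_top (by simp [volumeDensity])
        ((measure_mono hsub).trans_lt measure_ball_lt_top)

end RiemannianVolumeProperties

/-! ### Approximation of lower semicontinuous functions from below. -/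

section LowerSemicontinuousApproximation

open scoped BoundedContinuousFunction

/-- A lower semicontinuous function with values in `[0, ∞]` is the supremum of an increasing
sequence of bounded continuous functions. -/
theorem LowerSemicontinuous.exists_monotone_seq_boundedContinuousFunction {Y : Type*}
    [PseudoEMetricSpace Y] {f : Y → ℝ≥0∞} (hf : LowerSemicontinuous f) :
    ∃ φ : ℕ → Y →ᵇ ℝ≥0, (∀ y, Monotone fun m => φ m y) ∧ ∀ y, ⨆ m, (φ m y : ℝ≥0∞) = f y := by
  -- Infimal convolution of the truncation min(f, m) with m · dist: the result is m-Lipschitz, at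
  -- most m, and increasing in m.
  let F : ℕ → Y → ℝ≥0∞ := fun m y => ⨅ z, (min (f z) m + m * edist y z)
  have hFle : ∀ m y, F m y ≤ min (f y) m := fun m y => (iInf_le _ y).trans (by simp)
  have hFm : ∀ m y, F m y ≤ m := fun m y => (hFle m y).trans (min_le_right _ _)
  have hFne : ∀ m y, F m y ≠ ⊤ := fun m y => ((hFm m y).trans_lt (by simp)).ne
  have hFmono : ∀ y, Monotone fun m => F m y := by
    intro y m k hmk
    have h : (m : ℝ≥0∞) ≤ k := by exact_mod_cast hmk
    refine iInf_mono fun z => ?_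
    gcongr
  have hFc : ∀ m, Continuous (F m) := by
    intro m
    refine continuous_of_le_add_edist m (by simp) fun x y => ?_
    simp only [F]
    rw [ENNReal.iInf_add]
    refine le_iInf fun z => (iInf_le _ z).trans ?_
    rw [add_assoc, ← mul_add, add_comm (edist y z)]
    gcongr
    exact edist_triangle _ _ _
  let φ : ℕ → Y →ᵇ ℝ≥0 := fun m => BoundedContinuousFunction.mkOfBound
    ⟨fun y => (F m y).toNNReal, by
      rw [continuous_iff_continuousAt]
      intro y
      exact (ENNReal.tendsto_toNNReal (hFne m y)).comp (hFc m).continuousAt⟩ m (by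
      intro x y
      have h1 : ∀ y, (F m y).toNNReal ≤ (m : ℝ≥0) := fun y => by
        have := ENNReal.toNNReal_mono (by simp) (hFm m y)
        simpa using this
      have hx : ((F m x).toNNReal : ℝ) ≤ m := by exact_mod_cast h1 x
      have hy : ((F m y).toNNReal : ℝ) ≤ m := by exact_mod_cast h1 y
      simp only [ContinuousMap.coe_mk, NNReal.dist_eq]
      rw [abs_le]
      constructor <;> linarith [(F m x).toNNReal.coe_nonneg, (F m y).toNNReal.coe_nonneg])
  have hφ : ∀ m y, (φ m y : ℝ≥0∞) = F m y := fun m y => ENNReal.coe_toNNReal (hFne m y)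
  refine ⟨φ, fun y m k hmk => ?_, fun y => ?_⟩
  · have := hFmono y hmk
    simp only [← hφ] at this
    exact_mod_cast this
  · simp only [hφ]
    refine le_antisymm (iSup_le fun m => (hFle m y).trans (min_le_left _ _)) ?_
    refine le_of_forall_lt_imp_le_of_dense fun c hc => ?_
    obtain ⟨ε, hε, hball⟩ := Metric.nhds_basis_eball.mem_iff.1 (hf y c hc)
    have hcne : c ≠ ⊤ := hc.ne_top
    -- The first bound makes the truncation harmless on the ball where f > c; the second makes the
    -- distance penalty alone at least c outside it.
    obtain ⟨m, hm⟩ : ∃ m : ℕ, c ≤ m ∧ c ≤ m * ε := by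
      obtain ⟨m1, h1⟩ := ENNReal.exists_nat_gt hcne
      obtain ⟨m2, h2⟩ : ∃ m2 : ℕ, c ≤ m2 * ε := by
        rcases eq_or_ne ε ⊤ with rfl | hεt
        · exact ⟨1, by simp⟩
        · obtain ⟨m2, h2⟩ := ENNReal.exists_nat_mul_gt hε.ne' hcne
          exact ⟨m2, h2.le⟩
      refine ⟨max m1 m2, h1.le.trans (by simp), h2.trans ?_⟩
      gcongr
      simp
    refine le_iSup_of_le m (le_iInf fun z => ?_)
    rcases lt_or_ge (edist z y) ε with h | h
    · have : c < f z := hball h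
      exact (le_min this.le hm.1).trans le_self_add
    · rw [edist_comm] at h
      exact hm.2.trans ((mul_le_mul_right h _).trans le_add_self)

end LowerSemicontinuousApproximation

/-! ### Variational formula for the relative entropy. -/

section EntropyDuality

open InformationTheory Real
open scoped BoundedContinuousFunction

/-- The Young inequality behind the variational formula for the entropy. -/
theorem mul_le_klFun_add_exp_sub_one (a : ℝ) {r : ℝ} (hr : 0 ≤ r) :
    a * r ≤ klFun r + exp a - 1 := by
  rw [klFun_apply]
  rcases hr.eq_or_lt with rfl | hr
  · simp [exp_nonneg]
  -- Multiplying 1 + t ≤ e^t at t = a - log r by r gives a r ≤ r log r - r + e^a.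
  · have h := add_one_le_exp (a - log r)
    rw [exp_sub, exp_log hr, le_div_iff₀ hr] at h
    linarith

variable {X : Type*} [MeasurableSpace X]

/-- The entropy inequality for functions that need not be bounded. -/
theorem lintegral_le_klDiv_add_lintegral_exp (μ ν : Measure X) [IsFiniteMeasure μ]
    [IsFiniteMeasure ν] {f : X → ℝ} (hf : Measurable f) :
    ∫⁻ x, ENNReal.ofReal (f x) ∂μ ≤ klDiv μ ν + ∫⁻ x, ENNReal.ofReal (exp (f x)) ∂ν := by
  by_cases hac : μ ≪ ν
  swap
  · simp [klDiv_of_not_ac hac]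
  rw [klDiv_eq_lintegral_klFun_of_ac hac, ← lintegral_rnDeriv_mul hac (by fun_prop),
    ← lintegral_add_right _ (by fun_prop)]
  refine lintegral_mono_ae ?_
  filter_upwards [μ.rnDeriv_lt_top ν] with x hx
  rw [← ENNReal.ofReal_add (klFun_nonneg ENNReal.toReal_nonneg) (exp_nonneg _)]
  conv_lhs => rw [← ENNReal.ofReal_toReal hx.ne]
  rw [← ENNReal.ofReal_mul ENNReal.toReal_nonneg]
  refine ENNReal.ofReal_le_ofReal ?_
  have := mul_le_klFun_add_exp_sub_one (f x) (ENNReal.toReal_nonneg (a := μ.rnDeriv ν x))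
  linarith [mul_comm (f x) (μ.rnDeriv ν x).toReal]

/-- A bounded measurable function is integrable, and so is its exponential. -/
theorem integrable_exp_of_bounded (μ : Measure X) [IsFiniteMeasure μ] {f : X → ℝ}
    (hf : Measurable f) {B : ℝ} (hB : ∀ x, |f x| ≤ B) :
    Integrable f μ ∧ Integrable (fun x => exp (f x)) μ := by
  refine ⟨Integrable.of_bound hf.aestronglyMeasurable B (ae_of_all _ hB),
    Integrable.of_bound (by fun_prop) (exp B) (ae_of_all _ fun x => ?_)⟩
  rw [Real.norm_eq_abs, abs_exp]
  exact exp_le_exp.2 ((le_abs_self _).trans (hB x))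

/-- The easy half of the variational formula for the entropy. -/
theorem integral_sub_integral_exp_le_klDiv (μ ν : Measure X) [IsProbabilityMeasure μ]
    [IsProbabilityMeasure ν] {f : X → ℝ} (hf : Measurable f) {B : ℝ} (hB : ∀ x, |f x| ≤ B)
    (hkl : klDiv μ ν ≠ ⊤) :
    ∫ x, f x ∂μ - ∫ x, exp (f x) ∂ν + 1 ≤ (klDiv μ ν).toReal := by
  obtain ⟨hac, hint⟩ := klDiv_ne_top_iff.1 hkl
  have hk : Integrable (fun x => klFun (μ.rnDeriv ν x).toReal) ν :=
    (integrable_klFun_rnDeriv_iff hac).2 hint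
  obtain ⟨-, he⟩ := integrable_exp_of_bounded ν hf hB
  obtain ⟨hfi, -⟩ := integrable_exp_of_bounded μ hf hB
  have hfi' : Integrable (fun x => (μ.rnDeriv ν x).toReal • f x) ν :=
    (integrable_rnDeriv_smul_iff hac).2 hfi
  rw [toReal_klDiv_eq_integral_klFun hac, ← integral_rnDeriv_smul hac]
  have h1 : ∫ x, ((μ.rnDeriv ν x).toReal • f x - exp (f x) + 1) ∂ν =
      ∫ x, (μ.rnDeriv ν x).toReal • f x ∂ν - ∫ x, exp (f x) ∂ν + 1 := by
    have h2 : Integrable (fun x => (μ.rnDeriv ν x).toReal • f x - exp (f x)) ν := hfi'.sub he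
    rw [integral_add h2 (integrable_const _), integral_sub hfi' he]
    simp
  rw [← h1]
  refine integral_mono ((hfi'.sub he).add (integrable_const _)) hk fun x => ?_
  have := mul_le_klFun_add_exp_sub_one (f x) (ENNReal.toReal_nonneg (a := μ.rnDeriv ν x))
  simp only [smul_eq_mul]
  linarith [mul_comm (f x) (μ.rnDeriv ν x).toReal]

/-- A number is farther from `1` than its truncation to an interval containing `1`. -/
theorem sub_clamp_mul_log_nonneg {a b : ℝ} (ha : 0 < a) (ha1 : a ≤ 1) (hb : 1 ≤ b) (r : ℝ) :
    0 ≤ (r - max a (min r b)) * log (max a (min r b)) := by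
  rcases le_total r b with h | h
  · rw [min_eq_left h]
    rcases le_total a r with h' | h'
    · simp [h']
    · rw [max_eq_left h']
      exact mul_nonneg_of_nonpos_of_nonpos (by linarith) (log_nonpos ha.le ha1)
  · rw [min_eq_right h, max_eq_right (ha1.trans hb)]
    exact mul_nonneg (by linarith) (log_nonneg hb)

/-- The entropy is approached by bounded measurable functions in the variational formula. -/
theorem exists_measurable_lt_of_lt_klDiv (μ ν : Measure X) [IsProbabilityMeasure μ]
    [IsProbabilityMeasure ν] {c : ℝ} (hc0 : 0 ≤ c) (hc : ENNReal.ofReal c < klDiv μ ν) :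
    ∃ (f : X → ℝ) (B : ℝ), Measurable f ∧ (∀ x, |f x| ≤ B) ∧
      c < ∫ x, f x ∂μ - ∫ x, exp (f x) ∂ν + 1 := by
  by_cases hac : μ ≪ ν
  · rw [klDiv_eq_lintegral_klFun_of_ac hac] at hc
    set r : X → ℝ := fun x => (μ.rnDeriv ν x).toReal with hr
    have hrm : Measurable r := by fun_prop
    -- The optimal test function is log r; truncating r to [1/(m+1), m+1] makes the logarithm
    -- bounded.
    let s : ℕ → X → ℝ := fun m x => max (1 / ((m : ℝ) + 1)) (min (r x) (m + 1))
    have hsm : ∀ m, Measurable (s m) := fun m => by fun_prop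
    have hm1 : ∀ m : ℕ, (0 : ℝ) < 1 / ((m : ℝ) + 1) ∧ 1 / ((m : ℝ) + 1) ≤ 1 ∧ (1 : ℝ) ≤ m + 1 := by
      intro m
      have hm : (1 : ℝ) ≤ m + 1 := by linarith [(Nat.cast_nonneg m : (0 : ℝ) ≤ m)]
      exact ⟨by positivity, by rw [div_le_one (by positivity)]; exact hm, hm⟩
    have hs0 : ∀ m x, 0 < s m x := fun m x => (hm1 m).1.trans_le (le_max_left _ _)
    -- The expression equals klFun(s) + (r - s) log s. Its nonnegativity is what makes Fatou's lemma
    -- applicable.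
    have hnn : ∀ m x, 0 ≤ r x * log (s m x) - s m x + 1 := by
      intro m x
      have h1 := klFun_nonneg (hs0 m x).le
      rw [klFun_apply] at h1
      nlinarith [sub_clamp_mul_log_nonneg (hm1 m).1 (hm1 m).2.1 (hm1 m).2.2 (r x)]
    have hlim : ∀ x, Tendsto (fun m => r x * log (s m x) - s m x + 1) atTop (𝓝 (klFun (r x))) := by
      intro x
      have h0 : Tendsto (fun m : ℕ => 1 / ((m : ℝ) + 1)) atTop (𝓝 0) :=
        tendsto_one_div_add_atTop_nhds_zero_nat
      have hrx : 0 ≤ r x := ENNReal.toReal_nonneg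
      have hs : Tendsto (fun m => s m x) atTop (𝓝 (r x)) := by
        have h1 : Tendsto (fun m : ℕ => max (1 / ((m : ℝ) + 1)) (r x)) atTop (𝓝 (r x)) := by
          simpa [hrx] using h0.max (tendsto_const_nhds (x := r x))
        refine h1.congr' ?_
        obtain ⟨k, hk⟩ := exists_nat_gt (r x)
        filter_upwards [eventually_ge_atTop k] with m hm
        have : r x ≤ m + 1 := by
          have : (k : ℝ) ≤ m := by exact_mod_cast hm
          linarith
        simp [s, min_eq_left this]
      have hlog : Tendsto (fun m => r x * log (s m x)) atTop (𝓝 (r x * log (r x))) := by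
        rcases hrx.eq_or_lt with h | h
        · simp [← h]
        · exact (hs.log h.ne').const_mul _
      have := (hlog.sub hs).add_const 1
      rw [klFun_apply]
      convert this using 2
      ring
    have hfatou : ∫⁻ x, ENNReal.ofReal (klFun (r x)) ∂ν ≤
        liminf (fun m => ∫⁻ x, ENNReal.ofReal (r x * log (s m x) - s m x + 1) ∂ν) atTop := by
      refine le_trans (le_of_eq ?_) (lintegral_liminf_le fun m => by fun_prop)
      refine lintegral_congr fun x => ?_
      exact ((ENNReal.continuous_ofReal.tendsto _).comp (hlim x)).liminf_eq.symm
    obtain ⟨m, hm⟩ := (eventually_lt_of_lt_liminf (hc.trans_le hfatou)).exists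
    have hBd : ∀ x, |log (s m x)| ≤ log (m + 1) := by
      intro x
      have h1 : log (s m x) ≤ log (m + 1) :=
        log_le_log (hs0 m x) (max_le ((hm1 m).2.1.trans (hm1 m).2.2) (min_le_right _ _))
      have h2 : log (1 / ((m : ℝ) + 1)) ≤ log (s m x) := log_le_log (hm1 m).1 (le_max_left _ _)
      rw [one_div, log_inv] at h2
      exact abs_le.2 ⟨h2, h1⟩
    have hfm : Measurable fun x => log (s m x) := by fun_prop
    refine ⟨fun x => log (s m x), _, hfm, hBd, ?_⟩
    obtain ⟨hfi, -⟩ := integrable_exp_of_bounded μ hfm hBd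
    obtain ⟨-, he⟩ := integrable_exp_of_bounded ν hfm hBd
    simp only [exp_log (hs0 _ _)] at he ⊢
    have hfi' : Integrable (fun x => r x * log (s m x)) ν := by
      simpa using (integrable_rnDeriv_smul_iff hac).2 hfi
    have h2 : Integrable (fun x => r x * log (s m x) - s m x) ν := hfi'.sub he
    have h3 : Integrable (fun x => r x * log (s m x) - s m x + 1) ν := h2.add (integrable_const 1)
    rw [← ofReal_integral_eq_lintegral_ofReal h3 (ae_of_all _ (hnn m)),
      ENNReal.ofReal_lt_ofReal_iff_of_nonneg hc0] at hm
    refine hm.trans_eq ?_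
    rw [integral_add h2 (integrable_const _), integral_sub hfi' he, ← integral_rnDeriv_smul hac]
    simp [hr]
  · obtain ⟨A, hA, hνA, hμA⟩ : ∃ A, MeasurableSet A ∧ ν A = 0 ∧ μ A ≠ 0 := by
      by_contra! h
      exact hac (Measure.AbsolutelyContinuous.mk h)
    have hpos : 0 < μ.real A := ENNReal.toReal_pos hμA (measure_ne_top _ _)
    -- A large constant on a ν-null set charged by μ costs nothing in ∫ e^f dν; this t makes the
    -- functional equal to c + 1.
    set t : ℝ := (c + 1) / μ.real A with ht
    have ht0 : 0 ≤ t := by positivity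
    refine ⟨A.indicator fun _ => t, t, measurable_const.indicator hA, fun x => ?_, ?_⟩
    · by_cases hx : x ∈ A <;> simp [hx, ht0, abs_of_nonneg]
    · have h1 : ∫ x, exp (A.indicator (fun _ => t) x) ∂ν = 1 := by
        have : ∀ᵐ x ∂ν, exp (A.indicator (fun _ => t) x) = 1 := by
          filter_upwards [measure_eq_zero_iff_ae_notMem.1 hνA] with x hx
          simp [hx]
        rw [integral_congr_ae this]
        simp
      rw [h1, integral_indicator_const _ hA, smul_eq_mul, ht, mul_div_cancel₀ _ hpos.ne']
      linarith

/-- The hard half of the variational formula for the entropy: bounded continuous functions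
suffice. -/
theorem exists_boundedContinuous_lt_of_lt_klDiv [TopologicalSpace X]
    [TopologicalSpace.PseudoMetrizableSpace X] [BorelSpace X] (μ ν : Measure X)
    [IsProbabilityMeasure μ] [IsProbabilityMeasure ν] {c : ℝ}
    (hc : ENNReal.ofReal c < klDiv μ ν ∨ c < 0) :
    ∃ f : X →ᵇ ℝ, c < ∫ x, f x ∂μ - ∫ x, exp (f x) ∂ν + 1 := by
  rcases lt_or_ge c 0 with hc0 | hc0
  · exact ⟨0, by simpa using hc0⟩
  obtain ⟨f, B, hf, hB, hlt⟩ :=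
    exists_measurable_lt_of_lt_klDiv μ ν hc0 (hc.resolve_right (not_lt.2 hc0))
  have hX : Nonempty X := μ.nonempty_of_neZero
  have hB0 : 0 ≤ B := (abs_nonneg _).trans (hB hX.some)
  set d := ∫ x, f x ∂μ - ∫ x, exp (f x) ∂ν + 1 - c with hd
  have hd0 : 0 < d := by linarith
  obtain ⟨hfi, -⟩ := integrable_exp_of_bounded (μ + ν) hf hB
  -- An L¹ error ε under μ + ν changes the functional by at most (1 + e^B) ε = d / 2, since exp is
  -- e^B-Lipschitz below B.
  set ε := d / (2 * (1 + exp B)) with hε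
  have hε0 : 0 < ε := by positivity
  obtain ⟨g, hg, -⟩ := hfi.exists_boundedContinuous_integral_sub_le hε0
  -- Truncating at the bound B of f does not increase the distance to f and keeps exp Lipschitz.
  let g' : X →ᵇ ℝ := BoundedContinuousFunction.ofNormedAddCommGroup
    (fun x => max (-B) (min (g x) B)) (by fun_prop) B fun x => by
      rw [Real.norm_eq_abs, abs_le]
      exact ⟨le_max_left _ _, max_le (by linarith) (min_le_right _ _)⟩
  have hg' : ∀ x, |g' x - f x| ≤ |f x - g x| := by
    intro x
    have h1 := abs_le.1 (hB x)
    have h2 : f x = max (-B) (min (f x) B) := by rw [min_eq_left h1.2, max_eq_right h1.1]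
    conv_lhs => rw [h2]
    change |max (-B) (min (g x) B) - max (-B) (min (f x) B)| ≤ _
    rw [abs_sub_comm (f x)]
    calc _ ≤ |min (g x) B - min (f x) B| := by
          have := abs_max_sub_max_le_max (-B) (min (g x) B) (-B) (min (f x) B)
          simpa using this
      _ ≤ _ := by
          have := abs_min_sub_min_le_max (g x) B (f x) B
          simpa using this
  have hgB : ∀ x, |g' x| ≤ B := fun x =>
    abs_le.2 ⟨le_max_left _ _, max_le (by linarith) (min_le_right _ _)⟩
  have hgm : Measurable g' := g'.continuous.measurable
  obtain ⟨hgμ, -⟩ := integrable_exp_of_bounded μ hgm hgB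
  obtain ⟨-, hgν⟩ := integrable_exp_of_bounded ν hgm hgB
  obtain ⟨hfμ, -⟩ := integrable_exp_of_bounded μ hf hB
  obtain ⟨-, hfν⟩ := integrable_exp_of_bounded ν hf hB
  have hfg : Integrable (fun x => |f x - g x|) (μ + ν) :=
    (hfi.sub (g.integrable _)).abs
  have hfgμ : Integrable (fun x => |f x - g x|) μ := hfg.left_of_add_measure
  have hfgν : Integrable (fun x => |f x - g x|) ν := hfg.right_of_add_measure
  have hsum : ∫ x, |f x - g x| ∂μ + ∫ x, |f x - g x| ∂ν ≤ ε := by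
    rw [← integral_add_measure hfgμ hfgν]
    exact hg
  have hμ0 : 0 ≤ ∫ x, |f x - g x| ∂μ := integral_nonneg fun x => abs_nonneg _
  have hν0 : 0 ≤ ∫ x, |f x - g x| ∂ν := integral_nonneg fun x => abs_nonneg _
  have h1 : ∫ x, f x ∂μ - ∫ x, g' x ∂μ ≤ ∫ x, |f x - g x| ∂μ := by
    rw [← integral_sub hfμ hgμ]
    refine integral_mono (hfμ.sub hgμ) hfgμ fun x => ?_
    exact (neg_sub (g' x) (f x) ▸ neg_le_abs _).trans (hg' x)
  have h2 : ∫ x, exp (g' x) ∂ν - ∫ x, exp (f x) ∂ν ≤ exp B * ∫ x, |f x - g x| ∂ν := by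
    rw [← integral_sub hgν hfν, ← integral_const_mul]
    refine integral_mono (hgν.sub hfν) (hfgν.const_mul _) fun x => ?_
    have h3 := add_one_le_exp (f x - g' x)
    have h4 : exp (f x) = exp (g' x) * exp (f x - g' x) := by rw [← exp_add]; ring_nf
    have h5 : exp (g' x) ≤ exp B := exp_le_exp.2 ((le_abs_self _).trans (hgB x))
    have h6 := (le_abs_self _).trans (hg' x)
    calc exp (g' x) - exp (f x) ≤ exp (g' x) * (g' x - f x) := by
          rw [h4]; nlinarith [exp_pos (g' x)]
      _ ≤ exp (g' x) * |f x - g x| := by gcongr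
      _ ≤ exp B * |f x - g x| := by gcongr
  refine ⟨g', ?_⟩
  have hεd : ε * (1 + exp B) < d := by
    rw [hε, div_mul_eq_mul_div, div_lt_iff₀ (by positivity)]
    nlinarith [exp_pos B]
  have := exp_pos B
  nlinarith

end EntropyDuality

/-! ### Product measures and the law of large numbers. -/

section ProductMeasures

variable {X : Type*} [MeasurableSpace X]

/-- Fubini's theorem for products of nonnegative functions of separate variables. -/
theorem lintegral_pi_fin_prod {N : ℕ} (μ : Fin N → Measure X) [∀ i, SigmaFinite (μ i)]
    {f : Fin N → X → ℝ≥0∞} (hf : ∀ i, Measurable (f i)) :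
    ∫⁻ x, ∏ i, f i (x i) ∂(Measure.pi μ) = ∏ i, ∫⁻ y, f i y ∂(μ i) := by
  induction N with
  | zero => simp
  | succ N ih =>
    have h := (measurePreserving_piFinSuccAbove μ 0).symm
    rw [← h.lintegral_comp (by fun_prop)]
    simp only [Fin.prod_univ_succ]
    have h2 := lintegral_prod_mul (μ := μ 0) (ν := Measure.pi fun j => μ (Fin.succAbove 0 j))
      (f := f 0) (g := fun y => ∏ i, f i.succ (y i)) (hf 0).aemeasurable
      (Finset.measurable_prod _ fun i _ =>
        (hf i.succ).comp (measurable_pi_apply i)).aemeasurable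
    rw [ih (fun j => μ (Fin.succAbove 0 j)) (fun i => hf i.succ)] at h2
    simpa using h2

/-- A product of measures with densities has the product density. -/
theorem pi_withDensity {N : ℕ} (ω : Measure X) [SigmaFinite ω] {f : X → ℝ≥0∞} (hf : Measurable f)
    [SigmaFinite (ω.withDensity f)] :
    (Measure.pi fun _ : Fin N => ω.withDensity f) =
      (Measure.pi fun _ : Fin N => ω).withDensity fun x => ∏ i, f (x i) := by
  refine Measure.pi_eq fun s hs => ?_
  rw [withDensity_apply _ (MeasurableSet.univ_pi hs), Measure.restrict_pi_pi,
    lintegral_pi_fin_prod _ (fun _ => hf)]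
  exact Finset.prod_congr rfl fun i _ => (withDensity_apply _ (hs i)).symm

/-- The weak law of large numbers for integrable functions of independent samples. -/
theorem tendsto_pi_average_sub_ge (μ : Measure X) [IsProbabilityMeasure μ] {f : X → ℝ}
    (hf : Measurable f) (hint : Integrable f μ) {δ : ℝ} (hδ : 0 < δ) :
    Tendsto (fun N : ℕ => (Measure.pi fun _ : Fin N => μ)
      {x | δ ≤ |(∑ j, f (x j)) / N - ∫ y, f y ∂μ|}) atTop (𝓝 0) := by
  let P := Measure.infinitePi fun _ : ℕ => μ
  let Y : ℕ → (ℕ → X) → ℝ := fun i x => f (x i)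
  have hY : ∀ i, Measurable (Y i) := fun i => by fun_prop
  have hmp : ∀ i, MeasurePreserving (fun x : ℕ → X => x i) P μ := fun i =>
    measurePreserving_eval_infinitePi _ i
  have hI : ∫ x, Y 0 x ∂P = ∫ y, f y ∂μ := by
    rw [← (hmp 0).map_eq, integral_map (hmp 0).measurable.aemeasurable
      hf.aestronglyMeasurable]
  have hlaw := ProbabilityTheory.strong_law_ae_real Y ((hmp 0).integrable_comp_of_integrable hint)
    (fun i j hij => (ProbabilityTheory.iIndepFun_infinitePi (P := fun _ : ℕ => μ)
      (X := fun _ => f) (fun _ => hf)).indepFun hij)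
    (fun i => ⟨(hY i).aemeasurable, (hY 0).aemeasurable, by
      have h : ∀ i, P.map (Y i) = μ.map f := fun i => by
        rw [← (hmp i).map_eq, Measure.map_map hf (by fun_prop)]; rfl
      rw [h i, h 0]⟩)
  rw [hI] at hlaw
  have h1 := tendstoInMeasure_of_tendsto_ae
    (f := fun (n : ℕ) (x : ℕ → X) => (∑ i ∈ Finset.range n, Y i x) / n)
    (fun n => (by fun_prop : Measurable _).aestronglyMeasurable) hlaw
  have h2 := tendstoInMeasure_iff_norm.1 h1 δ hδ
  refine h2.congr fun N => ?_
  -- The strong law lives on the infinite product; its first N coordinates have law μ^{⊗N}.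
  have hmap : P.map (fun x (i : Fin N) => x i) = Measure.pi fun _ : Fin N => μ := by
    rw [← Measure.infinitePi_eq_pi]
    exact Measure.map_infinitePi_infinitePi_of_inj (P := fun _ : ℕ => μ) Fin.val_injective
  rw [← hmap, Measure.map_apply (by fun_prop)
    (measurableSet_le measurable_const (by fun_prop))]
  congr 1
  ext x
  simp [Y, Finset.sum_range]

end ProductMeasures

/-! ### Transfer of ϑ from the kernel to the potential. -/

section GibbsFactorization

/-- The kernel `g(x, z) + ϑ(x) + ϑ(z)`, with values in `[0, ∞]`. -/
noncomputable def pairKernel {X : Type*} (g : X → X → EReal) (ϑ : X → ℝ) (x z : X) : ℝ≥0∞ :=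
  (g x z + ((ϑ x + ϑ z : ℝ) : EReal)).toENNReal

/-- The pair energy `∑_{i < j} G(x_i, x_j)`. -/
noncomputable def pairSum {X : Type*} (G : X → X → ℝ≥0∞) {N : ℕ} (x : Fin N → X) : ℝ≥0∞ :=
  ∑ i, ∑ j ∈ Finset.Ioi i, G (x i) (x j)

/-- The Boltzmann factor `e^{-β s}`. -/
noncomputable def boltzmann (β : ℝ) (s : ℝ≥0∞) : ℝ≥0∞ :=
  EReal.exp (-((ENNReal.ofReal β * s : ℝ≥0∞) : EReal))

/-- Every index occurs in N - 1 pairs. For N = 0 the truncated subtraction is harmless because the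
sums are empty. -/
theorem sum_sum_Ioi_add {N : ℕ} (t : Fin N → ℝ) :
    ∑ i, ∑ j ∈ Finset.Ioi i, (t i + t j) = ((N - 1 : ℕ) : ℝ) * ∑ j, t j := by
  rw [Finset.sum_sum_Ioi_add_eq_sum_sum_off_diag (fun _ j : Fin N => t j), Finset.mul_sum]
  refine Finset.sum_congr rfl fun i _ => ?_
  simp [Finset.card_compl]

/-- Negation distributes over an `EReal` sum only if ⊤ and ⊥ do not meet, so the induction carries
along that the partial sums avoid ⊥. -/
theorem exp_neg_sum_eq_prod {ι : Type*} (s : Finset ι) (u : ι → EReal) (hu : ∀ i, u i ≠ ⊥) :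
    ∑ i ∈ s, u i ≠ ⊥ ∧ EReal.exp (-∑ i ∈ s, u i) = ∏ i ∈ s, EReal.exp (-u i) := by
  classical
  induction s using Finset.induction_on with
  | empty => simp
  | insert a s ha ih =>
    rw [Finset.sum_insert ha, Finset.prod_insert ha, ← ih.2, ← EReal.exp_add,
      EReal.neg_add (Or.inl (hu a)) (Or.inr ih.1), sub_eq_add_neg]
    exact ⟨EReal.add_ne_bot_iff.2 ⟨hu a, ih.1⟩, rfl⟩

theorem coe_ennreal_finset_sum {ι : Type*} (s : Finset ι) (a : ι → ℝ≥0∞) :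
    ((∑ i ∈ s, a i : ℝ≥0∞) : EReal) = ∑ i ∈ s, (a i : EReal) := by
  classical
  induction s using Finset.induction_on with
  | empty => simp
  | insert b s hb ih => rw [Finset.sum_insert hb, Finset.sum_insert hb, EReal.coe_ennreal_add, ih]

theorem coe_real_finset_sum {ι : Type*} (s : Finset ι) (a : ι → ℝ) :
    ((∑ i ∈ s, a i : ℝ) : EReal) = ∑ i ∈ s, (a i : EReal) := by
  classical
  induction s using Finset.induction_on with
  | empty => simp
  | insert b s hb ih => rw [Finset.sum_insert hb, Finset.sum_insert hb, EReal.coe_add, ih]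

/-- Moving the compensating function from the kernel to the potential turns the Gibbs weight into
a bounded Boltzmann factor times a product. -/
theorem exp_neg_gibbsEnergy {X : Type*} {g : X → X → EReal} {V : X → EReal} {ϑ : X → ℝ}
    (hg : ∀ u x, -g u x ≤ ((ϑ u + ϑ x : ℝ) : EReal)) (hV : ∀ x, V x ≠ ⊥) {β : ℝ} (hβ : 0 ≤ β)
    {N : ℕ} (x : Fin N → X) :
    EReal.exp (-gibbsEnergy β g V x) =
      boltzmann β (pairSum (pairKernel g ϑ) x) *
        ∏ j, EReal.exp (-shiftedPotential V ϑ (β * ((N - 1 : ℕ) : ℝ)) (x j)) := by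
  set κ : ℝ := β * ((N - 1 : ℕ) : ℝ) with hκ
  have hgK : ∀ u z, g u z = (pairKernel g ϑ u z : EReal) + ((-(ϑ u + ϑ z) : ℝ) : EReal) := by
    intro u z
    -- Nonnegativity ensures that `toENNReal` in `pairKernel` loses nothing, so g can be recovered
    -- from G.
    have h0 : 0 ≤ g u z + ((ϑ u + ϑ z : ℝ) : EReal) := by
      have h := hg u z
      generalize g u z = a at h ⊢
      induction a with
      | bot =>
        simp only [EReal.neg_bot, top_le_iff] at h
        exact absurd h (EReal.coe_ne_top _)
      | top => simp
      | coe a =>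
        norm_cast at h ⊢
        linarith
    rw [pairKernel, EReal.coe_toENNReal h0, EReal.coe_neg, ← sub_eq_add_neg,
      EReal.add_sub_cancel_right]
  have hsum : ∑ i, ∑ j ∈ Finset.Ioi i, g (x i) (x j) =
      ((pairSum (pairKernel g ϑ) x : ℝ≥0∞) : EReal) +
        ((-(((N - 1 : ℕ) : ℝ) * ∑ j, ϑ (x j)) : ℝ) : EReal) := by
    rw [← sum_sum_Ioi_add (fun j => ϑ (x j)), ← Finset.sum_neg_distrib, pairSum]
    simp only [← Finset.sum_neg_distrib]
    rw [coe_ennreal_finset_sum, coe_real_finset_sum, ← Finset.sum_add_distrib]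
    refine Finset.sum_congr rfl fun i _ => ?_
    rw [coe_ennreal_finset_sum, coe_real_finset_sum, ← Finset.sum_add_distrib]
    exact Finset.sum_congr rfl fun j _ => hgK _ _
  have hV' : ∀ y, V y = shiftedPotential V ϑ κ y + ((κ * ϑ y : ℝ) : EReal) := fun y => by
    rw [shiftedPotential, EReal.sub_add_cancel]
  have hS : ∀ y, shiftedPotential V ϑ κ y ≠ ⊥ := fun y => by
    rw [shiftedPotential, sub_eq_add_neg, ← EReal.coe_neg]
    exact EReal.add_ne_bot_iff.2 ⟨hV y, EReal.coe_ne_bot _⟩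
  have hsumV : ∑ j, V (x j) = ∑ j, shiftedPotential V ϑ κ (x j) +
      ((κ * ∑ j, ϑ (x j) : ℝ) : EReal) := by
    rw [Finset.mul_sum, coe_real_finset_sum, ← Finset.sum_add_distrib]
    exact Finset.sum_congr rfl fun j _ => hV' _
  obtain ⟨hne, hprod⟩ := exp_neg_sum_eq_prod Finset.univ (fun j => shiftedPotential V ϑ κ (x j))
    (fun j => hS _)
  set P : ℝ≥0∞ := pairSum (pairKernel g ϑ) x with hP
  have hH : gibbsEnergy β g V x =
      ((ENNReal.ofReal β * P : ℝ≥0∞) : EReal) + ∑ j, shiftedPotential V ϑ κ (x j) := by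
    rw [gibbsEnergy, hsum, hsumV, EReal.left_distrib_of_nonneg_of_ne_top (by exact_mod_cast hβ)
      (EReal.coe_ne_top _), EReal.coe_ennreal_mul, EReal.coe_ennreal_ofReal, max_eq_left hβ,
      ← EReal.coe_mul, add_add_add_comm, ← EReal.coe_add]
    -- The choice κ = β (N - 1) is dictated by this cancellation.
    have : β * -(((N - 1 : ℕ) : ℝ) * ∑ j, ϑ (x j)) + κ * ∑ j, ϑ (x j) = 0 := by rw [hκ]; ring
    rw [this, EReal.coe_zero, add_zero]
  rw [hH, EReal.neg_add (Or.inl (EReal.coe_ennreal_ne_bot _)) (Or.inr hne), sub_eq_add_neg,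
    EReal.exp_add, hprod, boltzmann]

end GibbsFactorization

/-! ### Dual representation, lower semicontinuity and compact sublevel sets of the free energy. -/

section MeanFieldEnergy

open InformationTheory
open scoped BoundedContinuousFunction

variable {X : Type*} [MeasurableSpace X]

/-- The mean-field free energy `(γ / 2) ∬ G dμ dμ + H(μ | ν)`. -/
noncomputable def meanFieldEnergy (G : X → X → ℝ≥0∞) (ν : Measure X) (γ : ℝ) (μ : Measure X) :
    ℝ≥0∞ :=
  ENNReal.ofReal (γ / 2) * ∫⁻ x, ∫⁻ z, G x z ∂μ ∂μ + klDiv μ ν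

variable [TopologicalSpace X]

/-- The continuous functionals whose supremum is the mean-field free energy. -/
noncomputable def dualEnergy (φ : X × X →ᵇ ℝ≥0) (f : X →ᵇ ℝ) (ν : Measure X) (γ : ℝ)
    (μ : Measure X) : ℝ :=
  γ / 2 * (∫⁻ x, ∫⁻ z, φ (x, z) ∂μ ∂μ).toReal + (∫ x, f x ∂μ - ∫ x, Real.exp (f x) ∂ν + 1)

variable [BorelSpace X]

/-- Easy half of the duality: monotonicity in the kernel together with
`integral_sub_integral_exp_le_klDiv`. -/
theorem dualEnergy_le {G : X → X → ℝ≥0∞} {φ : X × X →ᵇ ℝ≥0} (hφ : ∀ x z, (φ (x, z) : ℝ≥0∞) ≤ G x z)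
    (f : X →ᵇ ℝ) (ν : Measure X) [IsProbabilityMeasure ν] {γ : ℝ} (hγ : 0 < γ)
    (μ : ProbabilityMeasure X) (hF : meanFieldEnergy G ν γ μ ≠ ⊤) :
    dualEnergy φ f ν γ μ ≤ (meanFieldEnergy G ν γ μ).toReal := by
  obtain ⟨h1, h2⟩ := ENNReal.add_ne_top.1 hF
  rw [meanFieldEnergy, ENNReal.toReal_add h1 h2, ENNReal.toReal_mul,
    ENNReal.toReal_ofReal (by positivity), dualEnergy]
  have hG : ∫⁻ x, ∫⁻ z, G x z ∂(μ : Measure X) ∂(μ : Measure X) ≠ ⊤ := by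
    rintro h
    rw [h, ENNReal.mul_top (by simpa using hγ)] at h1
    exact h1 rfl
  refine add_le_add (mul_le_mul_of_nonneg_left (ENNReal.toReal_mono hG ?_) (by positivity))
    (integral_sub_integral_exp_le_klDiv _ _ f.continuous.measurable f.norm_coe_le_norm h2)
  exact lintegral_mono fun x => lintegral_mono fun z => hφ x z

variable [SecondCountableTopology X]

theorem lintegral_lintegral_eq_prod (φ : X × X →ᵇ ℝ≥0) (μ : ProbabilityMeasure X) :
    ∫⁻ x, ∫⁻ z, φ (x, z) ∂(μ : Measure X) ∂(μ : Measure X) =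
      ∫⁻ q, φ q ∂((μ.prod μ : ProbabilityMeasure (X × X)) : Measure (X × X)) := by
  rw [ProbabilityMeasure.toMeasure_prod, lintegral_prod]
  exact (φ.continuous.measurable.coe_nnreal_ennreal).aemeasurable

theorem lintegral_lintegral_ne_top (φ : X × X →ᵇ ℝ≥0) (μ : ProbabilityMeasure X) :
    ∫⁻ x, ∫⁻ z, φ (x, z) ∂(μ : Measure X) ∂(μ : Measure X) ≠ ⊤ := by
  rw [lintegral_lintegral_eq_prod]
  exact (BoundedContinuousFunction.lintegral_lt_top_of_nnreal _ φ).ne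

variable [TopologicalSpace.PseudoMetrizableSpace X]

/-- The quadratic term is the integral of φ against μ ⊗ μ, and μ ↦ μ ⊗ μ is weakly continuous. -/
theorem continuous_dualEnergy (φ : X × X →ᵇ ℝ≥0) (f : X →ᵇ ℝ) (ν : Measure X) (γ : ℝ) :
    Continuous fun μ : ProbabilityMeasure X => dualEnergy φ f ν γ μ := by
  have h1 : Continuous fun μ : ProbabilityMeasure X =>
      (∫⁻ x, ∫⁻ z, φ (x, z) ∂(μ : Measure X) ∂(μ : Measure X)).toReal := by
    simp only [lintegral_lintegral_eq_prod]
    have h2 := (ProbabilityMeasure.continuous_testAgainstNN_eval φ).comp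
      (ProbabilityMeasure.continuous_prod.comp (continuous_id.prodMk continuous_id :
        Continuous fun μ : ProbabilityMeasure X => (μ, μ)))
    exact NNReal.continuous_coe.comp h2
  have h2 := ProbabilityMeasure.continuous_integral_boundedContinuousFunction f
  unfold dualEnergy
  fun_prop

/-- G is an increasing limit of bounded continuous functions, and monotone convergence applies under
μ ⊗ μ. The case c < 0 is separate because `ENNReal.ofReal` sends it to 0. -/
theorem exists_lt_toReal_lintegral_lintegral {G : X → X → ℝ≥0∞}
    (hG : LowerSemicontinuous fun q : X × X => G q.1 q.2) (μ : ProbabilityMeasure X) {c : ℝ}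
    (hc : c < 0 ∨ ENNReal.ofReal c < ∫⁻ x, ∫⁻ z, G x z ∂(μ : Measure X) ∂(μ : Measure X)) :
    ∃ φ : X × X →ᵇ ℝ≥0, (∀ x z, (φ (x, z) : ℝ≥0∞) ≤ G x z) ∧
      c < (∫⁻ x, ∫⁻ z, φ (x, z) ∂(μ : Measure X) ∂(μ : Measure X)).toReal := by
  rcases lt_or_ge c 0 with hc0 | hc0
  · exact ⟨0, by simp, by simpa using hc0⟩
  replace hc := hc.resolve_left (not_lt.2 hc0)
  let := TopologicalSpace.pseudoMetrizableSpacePseudoMetric X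
  obtain ⟨φ, hmono, hsup⟩ := hG.exists_monotone_seq_boundedContinuousFunction
  have hm : ∀ m, Measurable fun q => (φ m q : ℝ≥0∞) :=
    fun m => (φ m).continuous.measurable.coe_nnreal_ennreal
  have h1 : ∫⁻ x, ∫⁻ z, G x z ∂(μ : Measure X) ∂(μ : Measure X) =
      ⨆ m, ∫⁻ x, ∫⁻ z, φ m (x, z) ∂(μ : Measure X) ∂(μ : Measure X) := by
    simp only [lintegral_lintegral_eq_prod]
    rw [← lintegral_iSup hm fun m k h q => ENNReal.coe_le_coe.2 (hmono q h)]
    simp only [hsup]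
    rw [ProbabilityMeasure.toMeasure_prod, lintegral_prod]
    exact hG.measurable.aemeasurable
  rw [h1, lt_iSup_iff] at hc
  obtain ⟨m, hm⟩ := hc
  refine ⟨φ m, fun x z => ?_, ?_⟩
  · rw [← hsup (x, z)]
    exact le_iSup (fun m => (φ m (x, z) : ℝ≥0∞)) m
  · exact (ENNReal.ofReal_lt_iff_lt_toReal hc0 (lintegral_lintegral_ne_top _ μ)).1 hm

/-- Hard half of the duality: energy and entropy are approached independently, by φ and by f, once c
has been split between them. -/
theorem exists_lt_dualEnergy {G : X → X → ℝ≥0∞}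
    (hG : LowerSemicontinuous fun q : X × X => G q.1 q.2) (ν : Measure X) [IsProbabilityMeasure ν]
    {γ : ℝ} (hγ : 0 < γ) (μ : ProbabilityMeasure X) {c : ℝ}
    (hc : c < 0 ∨ ENNReal.ofReal c < meanFieldEnergy G ν γ μ) :
    ∃ (φ : X × X →ᵇ ℝ≥0) (f : X →ᵇ ℝ), (∀ x z, (φ (x, z) : ℝ≥0∞) ≤ G x z) ∧
      c < dualEnergy φ f ν γ μ := by
  set E := ∫⁻ x, ∫⁻ z, G x z ∂(μ : Measure X) ∂(μ : Measure X) with hE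
  have hγ2 : 0 < γ / 2 := by positivity
  have key : ∀ a b : ℝ, (a < 0 ∨ ENNReal.ofReal a < E) →
      (ENNReal.ofReal b < klDiv (μ : Measure X) ν ∨ b < 0) → c ≤ γ / 2 * a + b →
      ∃ (φ : X × X →ᵇ ℝ≥0) (f : X →ᵇ ℝ), (∀ x z, (φ (x, z) : ℝ≥0∞) ≤ G x z) ∧
      c < dualEnergy φ f ν γ μ := by
    intro a b ha hb hab
    obtain ⟨φ, hφ, h1⟩ := exists_lt_toReal_lintegral_lintegral hG μ ha
    obtain ⟨f, h2⟩ := exists_boundedContinuous_lt_of_lt_klDiv (μ : Measure X) ν hb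
    refine ⟨φ, f, hφ, hab.trans_lt ?_⟩
    rw [dualEnergy]
    exact add_lt_add (mul_lt_mul_of_pos_left h1 hγ2) h2
  -- If one term is infinite it carries all of c, while the other is only asked to exceed the
  -- threshold -1.
  by_cases hK : klDiv (μ : Measure X) ν = ⊤
  · exact key (-1) (c + γ / 2) (Or.inl (by norm_num)) (Or.inl (by simp [hK])) (by linarith)
  by_cases hEt : E = ⊤
  · exact key ((c + 1) / (γ / 2)) (-1) (Or.inr (by simp [hEt])) (Or.inr (by norm_num))
      (by rw [mul_div_cancel₀ _ hγ2.ne']; linarith)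
  have hcF : c < γ / 2 * E.toReal + (klDiv (μ : Measure X) ν).toReal := by
    rcases lt_or_ge c 0 with hc0 | hc0
    · exact hc0.trans_le (by positivity)
    · have h := (ENNReal.ofReal_lt_iff_lt_toReal hc0 ?_).1 (hc.resolve_left (not_lt.2 hc0))
      · rwa [meanFieldEnergy, ENNReal.toReal_add (ENNReal.mul_ne_top (by simp) hEt) hK,
          ENNReal.toReal_mul, ENNReal.toReal_ofReal hγ2.le] at h
      · exact ENNReal.add_ne_top.2 ⟨ENNReal.mul_ne_top (by simp) hEt, hK⟩
  set d := γ / 2 * E.toReal + (klDiv (μ : Measure X) ν).toReal - c with hd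
  have hd0 : 0 < d := by linarith
  have hlt : ∀ (A : ℝ≥0∞) (t : ℝ), A ≠ ⊤ → 0 < t →
      (A.toReal - t < 0 ∨ ENNReal.ofReal (A.toReal - t) < A) := by
    intro A t hA ht
    rcases lt_or_ge (A.toReal - t) 0 with h | h
    · exact Or.inl h
    · exact Or.inr ((ENNReal.ofReal_lt_iff_lt_toReal h hA).2 (by linarith))
  -- With both terms finite, each gives up half of the gap d.
  refine key (E.toReal - d / 2 / (γ / 2)) ((klDiv (μ : Measure X) ν).toReal - d / 2)
    (hlt E _ hEt (by positivity)) (hlt _ _ hK (by positivity)).symm ?_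
  rw [mul_sub, mul_div_cancel₀ _ hγ2.ne']
  linarith

/-- The mean-field free energy is lower semicontinuous. -/
theorem lowerSemicontinuous_meanFieldEnergy {G : X → X → ℝ≥0∞}
    (hG : LowerSemicontinuous fun q : X × X => G q.1 q.2) (ν : Measure X) [IsProbabilityMeasure ν]
    {γ : ℝ} (hγ : 0 < γ) :
    LowerSemicontinuous fun μ : ProbabilityMeasure X => meanFieldEnergy G ν γ μ := by
  intro μ c hc
  have hct : c ≠ ⊤ := hc.ne_top
  obtain ⟨φ, f, hφ, hlt⟩ := exists_lt_dualEnergy hG ν hγ μ (c := c.toReal)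
    (Or.inr (by rwa [ENNReal.ofReal_toReal hct]))
  filter_upwards [(continuous_dualEnergy φ f ν γ).continuousAt.eventually (lt_mem_nhds hlt)]
    with μ' h
  by_cases hF : meanFieldEnergy G ν γ μ' = ⊤
  · rw [hF]; exact hct.lt_top
  · rw [gt_iff_lt, ← ENNReal.toReal_lt_toReal hct hF]
    exact h.trans_le (dualEnergy_le hφ f ν hγ μ' hF)

/-- A set of probability measures under which a function with relatively compact sublevel sets has
a bounded integral is relatively compact. -/
theorem isCompact_closure_lintegral_le {Y : Type*} [MeasurableSpace Y] [TopologicalSpace Y]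
    [T2Space Y] [BorelSpace Y] {h : Y → ℕ} (hm : Measurable h)
    (hK : ∀ k, ∃ K, IsCompact K ∧ {x | h x ≤ k} ⊆ K) (L : ℝ≥0) :
    IsCompact (closure {μ : ProbabilityMeasure Y | ∫⁻ x, h x ∂(μ : Measure Y) ≤ L}) := by
  refine isCompact_closure_of_isTightMeasureSet ?_
  rw [isTightMeasureSet_iff_exists_isCompact_measure_compl_le]
  intro ε hε
  obtain ⟨k, hk⟩ : ∃ k : ℕ, (L : ℝ≥0∞) ≤ k * ε := by
    rcases eq_or_ne ε ⊤ with rfl | hεt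
    · exact ⟨1, by simp⟩
    · obtain ⟨k, hk⟩ := ENNReal.exists_nat_mul_gt hε.ne' (b := (L : ℝ≥0∞)) (by simp)
      exact ⟨k, hk.le⟩
  obtain ⟨K, hKc, hKs⟩ := hK k
  refine ⟨K, hKc, ?_⟩
  rintro _ ⟨μ, hμ, rfl⟩
  -- Markov's inequality for integer-valued h: outside K one has h ≥ k + 1, a nonzero factor that
  -- can be cancelled even when k = 0.
  have h1 : Kᶜ ⊆ {x | ((k + 1 : ℕ) : ℝ≥0∞) ≤ h x} := fun x hx => by
    have : ¬ h x ≤ k := fun h' => hx (hKs h')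
    simp only [Set.mem_ofPred_eq]
    exact_mod_cast not_le.1 this
  have h2 := mul_meas_ge_le_lintegral (μ := (μ : Measure Y)) (f := fun x => (h x : ℝ≥0∞))
    (by fun_prop) ((k + 1 : ℕ) : ℝ≥0∞)
  have h3 : ((k + 1 : ℕ) : ℝ≥0∞) * (μ : Measure Y) Kᶜ ≤ ((k + 1 : ℕ) : ℝ≥0∞) * ε := by
    calc _ ≤ _ := by gcongr
      _ ≤ _ := h2
      _ ≤ L := hμ
      _ ≤ k * ε := hk
      _ ≤ _ := by gcongr; simp
  exact (ENNReal.mul_le_mul_iff_right (by simp) (by simp)).1 h3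

/-- The sublevel sets of the mean-field free energy are compact. -/
theorem isCompact_meanFieldEnergy_le [T2Space X] {G : X → X → ℝ≥0∞}
    (hG : LowerSemicontinuous fun q : X × X => G q.1 q.2) (ν : Measure X) [IsProbabilityMeasure ν]
    {γ : ℝ} (hγ : 0 < γ) {h : X → ℕ} (hm : Measurable h)
    (hK : ∀ k, ∃ K, IsCompact K ∧ {x | h x ≤ k} ⊆ K)
    (hint : ∫⁻ x, ENNReal.ofReal (Real.exp (h x)) ∂ν ≠ ⊤) {r : ℝ≥0∞} (hr : r ≠ ⊤) :
    IsCompact {μ : ProbabilityMeasure X | meanFieldEnergy G ν γ μ ≤ r} := by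
  have hcl : IsClosed {μ : ProbabilityMeasure X | meanFieldEnergy G ν γ μ ≤ r} :=
    (lowerSemicontinuous_meanFieldEnergy hG ν hγ).isClosed_preimage r
  refine (isCompact_closure_lintegral_le hm hK
    (r + ∫⁻ x, ENNReal.ofReal (Real.exp (h x)) ∂ν).toNNReal).of_isClosed_subset hcl ?_
  intro μ hμ
  refine subset_closure ?_
  rw [Set.mem_ofPred_eq, ENNReal.coe_toNNReal (ENNReal.add_ne_top.2 ⟨hr, hint⟩)]
  -- The entropy inequality bounds ∫ h dμ on the sublevel set, which is therefore tight.
  have h1 := lintegral_le_klDiv_add_lintegral_exp (μ : Measure X) ν (f := fun x => (h x : ℝ))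
    (by fun_prop)
  simp only [ENNReal.ofReal_natCast] at h1
  refine h1.trans ?_
  gcongr
  exact le_add_self.trans hμ

end MeanFieldEnergy

/-! ### Chernoff bounds at fixed N. -/

section UpperBound

open scoped BoundedContinuousFunction

/-- The pair sum of a symmetric kernel dominates half of the off-diagonal double sum of any
function below it. -/
theorem ofReal_le_pairSum {X : Type*} {G : X → X → ℝ≥0∞} (hsymm : ∀ x z, G x z = G z x) {φ : X × X → ℝ≥0}
    (hφ : ∀ x z, (φ (x, z) : ℝ≥0∞) ≤ G x z) {M : ℝ} (hM : ∀ q, (φ q : ℝ) ≤ M) {N : ℕ}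
    (x : Fin N → X) :
    ENNReal.ofReal ((∑ i, ∑ j, (φ (x i, x j) : ℝ) - N * M) / 2) ≤ pairSum G x := by
  have h1 : 2 * pairSum G x = ∑ i, ∑ j ∈ {i}ᶜ, G (x j) (x i) := by
    rw [← Finset.sum_sum_Ioi_add_eq_sum_sum_off_diag (fun i j => G (x i) (x j)), pairSum,
      Finset.mul_sum]
    refine Finset.sum_congr rfl fun i _ => ?_
    rw [Finset.mul_sum]
    refine Finset.sum_congr rfl fun j _ => ?_
    rw [hsymm (x j) (x i), two_mul]
  have h2 : ENNReal.ofReal (∑ i, ∑ j ∈ {i}ᶜ, (φ (x j, x i) : ℝ)) ≤ 2 * pairSum G x := by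
    rw [h1, ENNReal.ofReal_sum_of_nonneg fun i _ => Finset.sum_nonneg fun j _ => NNReal.coe_nonneg _]
    refine Finset.sum_le_sum fun i _ => ?_
    rw [ENNReal.ofReal_sum_of_nonneg fun j _ => NNReal.coe_nonneg _]
    refine Finset.sum_le_sum fun j _ => ?_
    rw [ENNReal.ofReal_coe_nnreal]
    exact hφ _ _
  -- The N diagonal terms, present in the double sum but not in the energy, cost at most M each.
  have h3 : ∑ i, ∑ j, (φ (x i, x j) : ℝ) - N * M ≤ ∑ i, ∑ j ∈ {i}ᶜ, (φ (x j, x i) : ℝ) := by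
    have h4 : ∀ i : Fin N, ∑ j, (φ (x j, x i) : ℝ) =
        φ (x i, x i) + ∑ j ∈ {i}ᶜ, (φ (x j, x i) : ℝ) := by
      intro i
      rw [← Finset.sum_add_sum_compl {i}]
      simp
    rw [Finset.sum_comm]
    simp only [h4]
    rw [Finset.sum_add_distrib]
    have h5 : ∑ i : Fin N, (φ (x i, x i) : ℝ) ≤ N * M := by
      calc _ ≤ ∑ i : Fin N, M := Finset.sum_le_sum fun i _ => hM _
        _ = N * M := by simp
    linarith
  rw [ENNReal.ofReal_div_of_pos two_pos]
  refine ENNReal.div_le_of_le_mul ?_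
  rw [mul_comm (pairSum G x), ENNReal.ofReal_ofNat]
  exact (ENNReal.ofReal_le_ofReal h3).trans h2

variable {X : Type*} [MeasurableSpace X]

/-- The configurations whose empirical measure belongs to `A`. -/
def empiricalEvent (N : ℕ) (A : Set (ProbabilityMeasure X)) : Set (Fin N → X) :=
  {x | ∃ μ ∈ A, (μ : Measure X) = empiricalMeasure x}

/-- The unnormalized Gibbs measure with nonnegative kernel `G` and reference measure `ρ`. -/
noncomputable def pairGibbs (G : X → X → ℝ≥0∞) (β : ℝ) (ρ : Measure X) (N : ℕ) :
    Measure (Fin N → X) :=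
  (Measure.pi fun _ => ρ).withDensity fun x => boltzmann β (pairSum G x)

theorem boltzmann_le_one (β : ℝ) (s : ℝ≥0∞) : boltzmann β s ≤ 1 := by
  rw [boltzmann, EReal.exp_le_one_iff, ← neg_zero, EReal.neg_le_neg_iff]
  exact EReal.coe_ennreal_nonneg _

theorem boltzmann_le {β : ℝ} (hβ : 0 ≤ β) {t : ℝ} {s : ℝ≥0∞} (h : ENNReal.ofReal t ≤ s) :
    boltzmann β s ≤ ENNReal.ofReal (Real.exp (-(β * t))) := by
  rw [← EReal.exp_coe, boltzmann, EReal.exp_le_exp_iff, EReal.coe_neg, EReal.neg_le_neg_iff]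
  rcases le_or_gt t 0 with ht | ht
  · exact (EReal.coe_le_coe_iff.2 (mul_nonpos_of_nonneg_of_nonpos hβ ht)).trans
      (EReal.coe_ennreal_nonneg _)
  · have h1 : ((β * t : ℝ) : EReal) = ((ENNReal.ofReal (β * t) : ℝ≥0∞) : EReal) := by
      rw [EReal.coe_ennreal_ofReal, max_eq_left (by positivity)]
    rw [h1, EReal.coe_ennreal_le_coe_ennreal_iff, ENNReal.ofReal_mul hβ]
    gcongr

theorem le_boltzmann {β : ℝ} (hβ : 0 ≤ β) {t : ℝ} {s : ℝ≥0∞} (ht : 0 ≤ t)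
    (h : s ≤ ENNReal.ofReal t) :
    ENNReal.ofReal (Real.exp (-(β * t))) ≤ boltzmann β s := by
  rw [← EReal.exp_coe, boltzmann, EReal.exp_le_exp_iff, EReal.coe_neg, EReal.neg_le_neg_iff]
  have h1 : ((β * t : ℝ) : EReal) = ((ENNReal.ofReal (β * t) : ℝ≥0∞) : EReal) := by
    rw [EReal.coe_ennreal_ofReal, max_eq_left (by positivity)]
  rw [h1, EReal.coe_ennreal_le_coe_ennreal_iff, ENNReal.ofReal_mul hβ]
  gcongr

theorem measurable_boltzmann (β : ℝ) : Measurable (boltzmann β) := by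
  unfold boltzmann
  fun_prop

theorem measurable_pairSum {G : X → X → ℝ≥0∞} (hG : Measurable fun q : X × X => G q.1 q.2) (N : ℕ) :
    Measurable fun x : Fin N → X => pairSum G x := by
  unfold pairSum
  refine Finset.measurable_sum _ fun i _ => Finset.measurable_sum _ fun j _ => ?_
  exact Measurable.comp (g := fun q : X × X => G q.1 q.2) (f := fun x : Fin N → X => (x i, x j)) hG
    ((measurable_pi_apply i).prodMk (measurable_pi_apply j))

theorem lintegral_empiricalMeasure {N : ℕ} (x : Fin N → X) {f : X → ℝ≥0∞} (hf : Measurable f) :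
    ∫⁻ y, f y ∂(empiricalMeasure x) = (N : ℝ≥0∞)⁻¹ * ∑ j, f (x j) := by
  rw [empiricalMeasure, lintegral_smul_measure, lintegral_finsetSum_measure, smul_eq_mul]
  simp [lintegral_dirac' _ hf]

theorem integral_empiricalMeasure {N : ℕ} (x : Fin N → X) {f : X → ℝ} (hf : StronglyMeasurable f) :
    ∫ y, f y ∂(empiricalMeasure x) = (N : ℝ)⁻¹ * ∑ j, f (x j) := by
  rw [empiricalMeasure, integral_smul_measure, integral_finsetSum_measure]
  · simp [integral_dirac' _ _ hf]
  · intro i _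
    exact integrable_dirac' hf (by simp)

/-- Chernoff's bound for the Gibbs measure. -/
theorem pairGibbs_le_of_boltzmann_le {G : X → X → ℝ≥0∞}
    (hG : Measurable fun q : X × X => G q.1 q.2) (β : ℝ) (ρ : Measure X) [IsFiniteMeasure ρ]
    {N : ℕ} {E : Set (Fin N → X)} {K : ℝ≥0∞} {u : X → ℝ≥0∞} (hu : Measurable u)
    (hE : ∀ x ∈ E, boltzmann β (pairSum G x) ≤ K * ∏ j, u (x j)) :
    pairGibbs G β ρ N E ≤ K * (∫⁻ y, u y ∂ρ) ^ N := by
  have hum : Measurable fun x : Fin N → X => ∏ j, u (x j) :=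
    Finset.measurable_prod _ fun j _ => hu.comp (measurable_pi_apply j)
  -- E is not assumed measurable; it is enlarged to the measurable set where the bound holds.
  have hT : MeasurableSet {x : Fin N → X | boltzmann β (pairSum G x) ≤ K * ∏ j, u (x j)} :=
    measurableSet_le ((measurable_boltzmann β).comp (measurable_pairSum hG N)) (hum.const_mul K)
  calc pairGibbs G β ρ N E
      ≤ pairGibbs G β ρ N {x | boltzmann β (pairSum G x) ≤ K * ∏ j, u (x j)} := measure_mono hE
    _ = ∫⁻ x in {x | boltzmann β (pairSum G x) ≤ K * ∏ j, u (x j)}, boltzmann β (pairSum G x)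
          ∂(Measure.pi fun _ => ρ) := withDensity_apply _ hT
    _ ≤ ∫⁻ x in {x | boltzmann β (pairSum G x) ≤ K * ∏ j, u (x j)}, K * ∏ j, u (x j)
          ∂(Measure.pi fun _ => ρ) := setLIntegral_mono (hum.const_mul K) fun x hx => hx
    _ ≤ ∫⁻ x, K * ∏ j, u (x j) ∂(Measure.pi fun _ => ρ) := setLIntegral_le_lintegral _ _
    _ = K * (∫⁻ y, u y ∂ρ) ^ N := by
        rw [lintegral_const_mul _ hum, lintegral_pi_fin_prod _ fun _ => hu]
        simp

variable [TopologicalSpace X] [SecondCountableTopology X] [BorelSpace X]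

/-- On the event that the dual energy of the empirical measure exceeds `c`, the Boltzmann factor
is at most an exponentially small multiple of a product. -/
theorem boltzmann_le_of_lt_dualEnergy {G : X → X → ℝ≥0∞} (hsymm : ∀ x z, G x z = G z x)
    {φ : X × X →ᵇ ℝ≥0} (hφ : ∀ x z, (φ (x, z) : ℝ≥0∞) ≤ G x z) {M : ℝ} (hM : ∀ q, (φ q : ℝ) ≤ M)
    (f : X →ᵇ ℝ) (ν : Measure X) {γ β c : ℝ} (hβ : 0 ≤ β) {N : ℕ} (hN : 0 < N) (x : Fin N → X)
    (hc : c < dualEnergy φ f ν γ (empiricalMeasure x)) :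
    boltzmann β (pairSum G x) ≤
      ENNReal.ofReal (Real.exp (N * (-c - ∫ y, Real.exp (f y) ∂ν + 1 + (|N * β - γ| + β) * M / 2))) *
        ∏ j, ENNReal.ofReal (Real.exp (f (x j))) := by
  have hN0 : (0 : ℝ) < N := by exact_mod_cast hN
  set A := (∫⁻ y, ∫⁻ z, φ (y, z) ∂(empiricalMeasure x) ∂(empiricalMeasure x)).toReal with hA
  have hφm : Measurable fun q => (φ q : ℝ≥0∞) := φ.continuous.measurable.coe_nnreal_ennreal
  have hA2 : A = (N : ℝ)⁻¹ * ((N : ℝ)⁻¹ * ∑ i, ∑ j, (φ (x i, x j) : ℝ)) := by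
    have h1 : ∀ y, ∫⁻ z, φ (y, z) ∂(empiricalMeasure x) =
        (N : ℝ≥0∞)⁻¹ * ∑ j, (φ (y, x j) : ℝ≥0∞) := fun y =>
      lintegral_empiricalMeasure x (hφm.comp measurable_prodMk_left)
    simp only [hA, h1]
    rw [lintegral_empiricalMeasure]
    · rw [← Finset.mul_sum, ENNReal.toReal_mul, ENNReal.toReal_mul, ENNReal.toReal_inv,
        ENNReal.toReal_natCast, ENNReal.toReal_sum]
      · congr 2
        refine Finset.sum_congr rfl fun i _ => ?_
        rw [ENNReal.toReal_sum (by simp)]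
        rfl
      · simp [ENNReal.sum_eq_top]
    · refine Measurable.const_mul (Finset.measurable_sum _ fun j _ => ?_) _
      exact hφm.comp measurable_prodMk_right
  set S := ∑ i, ∑ j, (φ (x i, x j) : ℝ) with hS
  have hS0 : 0 ≤ S := Finset.sum_nonneg fun i _ => Finset.sum_nonneg fun j _ => NNReal.coe_nonneg _
  have hSA : S = N * (N * A) := by rw [hA2]; field_simp
  have hA0 : 0 ≤ A := ENNReal.toReal_nonneg
  have hM0 : 0 ≤ M := (NNReal.coe_nonneg _).trans (hM (x ⟨0, hN⟩, x ⟨0, hN⟩))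
  have hAM : A ≤ M := by
    have : S ≤ N * (N * M) := by
      calc S ≤ ∑ i : Fin N, ∑ j : Fin N, M :=
            Finset.sum_le_sum fun i _ => Finset.sum_le_sum fun j _ => hM _
        _ = _ := by simp
    rw [hSA] at this
    exact le_of_mul_le_mul_left (le_of_mul_le_mul_left this hN0) hN0
  rw [dualEnergy, ← hA, integral_empiricalMeasure x f.continuous.stronglyMeasurable] at hc
  set T := ∑ j, f (x j) with hT
  set I := ∫ y, Real.exp (f y) ∂ν with hI
  refine (boltzmann_le hβ (ofReal_le_pairSum hsymm hφ hM x)).trans ?_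
  rw [← ENNReal.ofReal_prod_of_nonneg fun j _ => Real.exp_nonneg _, ← Real.exp_sum,
    ← ENNReal.ofReal_mul (Real.exp_nonneg _), ← Real.exp_add]
  refine ENNReal.ofReal_le_ofReal (Real.exp_le_exp.2 ?_)
  rw [← hS, hSA, ← hT]
  have h1 : N * c ≤ N * (γ / 2 * A) + T - N * I + N := by
    have := mul_le_mul_of_nonneg_left hc.le hN0.le
    have e : (N : ℝ) * (γ / 2 * A + ((N : ℝ)⁻¹ * T - I + 1)) = N * (γ / 2 * A) + T - N * I + N := by
      field_simp; ring
    linarith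
  -- Cost of replacing the actual coupling Nβ by its limit γ in front of the energy A ≤ M; the
  -- remaining βM/2 in the exponent pays for the diagonal.
  have h2 : (γ - N * β) * A ≤ |N * β - γ| * M := by
    calc (γ - N * β) * A ≤ |N * β - γ| * A := by
          gcongr; rw [abs_sub_comm]; exact le_abs_self _
      _ ≤ _ := by gcongr
  have h3 := mul_le_mul_of_nonneg_left h2 hN0.le
  nlinarith

end UpperBound

/-! ### Exponential tightness and the upper bound for closed sets. -/

section UpperBoundAsymptotics

open scoped BoundedContinuousFunction

theorem tendsto_zero_of_tendsto_nat_mul {β : ℕ → ℝ} {γ : ℝ}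
    (hβγ : Tendsto (fun N : ℕ => (N : ℝ) * β N) atTop (𝓝 γ)) : Tendsto β atTop (𝓝 0) := by
  have h := hβγ.mul (tendsto_inv_atTop_nhds_zero_nat (𝕜 := ℝ))
  rw [mul_zero] at h
  refine h.congr' ?_
  filter_upwards [eventually_gt_atTop 0] with N hN
  have : (N : ℝ) ≠ 0 := by exact_mod_cast hN.ne'
  field_simp

variable {X : Type*} [MeasurableSpace X]

/-- Exponential tightness of the empirical measures. -/
theorem pairGibbs_lt_lintegral_le {G : X → X → ℝ≥0∞}
    (hG : Measurable fun q : X × X => G q.1 q.2) (β : ℝ) (ρ : Measure X) [IsFiniteMeasure ρ]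
    {h : X → ℕ} (hm : Measurable h) (L : ℝ≥0) {N : ℕ} (hN : 0 < N) :
    pairGibbs G β ρ N (empiricalEvent N {μ | (L : ℝ≥0∞) < ∫⁻ y, h y ∂(μ : Measure X)}) ≤
      ENNReal.ofReal (Real.exp (-(N * L))) *
        (∫⁻ y, ENNReal.ofReal (Real.exp (h y)) ∂ρ) ^ N := by
  refine pairGibbs_le_of_boltzmann_le hG β ρ (by fun_prop) ?_
  rintro x ⟨μ, hμ, hμx⟩
  -- G ≥ 0, so the interaction is dropped and only the product measure matters.
  refine (boltzmann_le_one _ _).trans ?_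
  have hN0 : (0 : ℝ) < N := by exact_mod_cast hN
  rw [Set.mem_ofPred_eq, hμx, lintegral_empiricalMeasure x (by fun_prop)] at hμ
  have h1 : (N : ℝ) * L ≤ ∑ j, (h (x j) : ℝ) := by
    have h2 := ENNReal.toReal_mono (by
      refine ENNReal.mul_ne_top (by simp [hN.ne']) ?_
      simp [ENNReal.sum_eq_top]) hμ.le
    rw [ENNReal.toReal_mul, ENNReal.toReal_sum (by simp)] at h2
    simp only [ENNReal.coe_toReal, ENNReal.toReal_inv, ENNReal.toReal_natCast] at h2
    rw [← div_eq_inv_mul, le_div_iff₀ hN0] at h2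
    linarith
  rw [← ENNReal.ofReal_prod_of_nonneg fun j _ => Real.exp_nonneg _, ← Real.exp_sum,
    ← ENNReal.ofReal_mul (Real.exp_nonneg _), ← Real.exp_add, ENNReal.one_le_ofReal,
    Real.one_le_exp_iff]
  linarith

theorem empiricalEvent_mono {N : ℕ} {A B : Set (ProbabilityMeasure X)} (h : A ⊆ B) :
    empiricalEvent N A ⊆ empiricalEvent N B := fun _ ⟨μ, hμ, e⟩ => ⟨μ, h hμ, e⟩

theorem empiricalEvent_union {N : ℕ} (A B : Set (ProbabilityMeasure X)) :
    empiricalEvent N (A ∪ B) ⊆ empiricalEvent N A ∪ empiricalEvent N B := by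
  rintro x ⟨μ, hμ | hμ, e⟩
  exacts [Or.inl ⟨μ, hμ, e⟩, Or.inr ⟨μ, hμ, e⟩]

theorem empiricalEvent_biUnion {N : ℕ} {ι : Type*} (t : Finset ι)
    (A : ι → Set (ProbabilityMeasure X)) :
    empiricalEvent N (⋃ i ∈ t, A i) ⊆ ⋃ i ∈ t, empiricalEvent N (A i) := by
  rintro x ⟨μ, hμ, e⟩
  simp only [Set.mem_iUnion] at hμ ⊢
  obtain ⟨i, hi, h⟩ := hμ
  exact ⟨i, hi, μ, h, e⟩

variable [TopologicalSpace X] [SecondCountableTopology X] [BorelSpace X]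

/-- The exponential upper bound for the superlevel sets of the dual energies. -/
theorem eventually_pairGibbs_dualEnergy_le {G : X → X → ℝ≥0∞}
    (hG : Measurable fun q : X × X => G q.1 q.2) (hsymm : ∀ x z, G x z = G z x)
    {φ : X × X →ᵇ ℝ≥0} (hφ : ∀ x z, (φ (x, z) : ℝ≥0∞) ≤ G x z) (f : X →ᵇ ℝ)
    {ν : Measure X} [IsProbabilityMeasure ν] {γ : ℝ} {β : ℕ → ℝ} (hβ : ∀ N, 0 < β N)
    (hβγ : Tendsto (fun N : ℕ => (N : ℝ) * β N) atTop (𝓝 γ))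
    {ρ : ℕ → Measure X} [∀ N, IsFiniteMeasure (ρ N)] {ℓ : ℝ}
    (hρ : Tendsto (fun N => ∫⁻ y, ENNReal.ofReal (Real.exp (f y)) ∂(ρ N)) atTop
      (𝓝 (ENNReal.ofReal (Real.exp ℓ * ∫ y, Real.exp (f y) ∂ν)))) (c : ℝ) {ε : ℝ} (hε : 0 < ε) :
    ∀ᶠ N : ℕ in atTop, pairGibbs G (β N) (ρ N) N
      (empiricalEvent N {μ | c < dualEnergy φ f ν γ μ}) ≤
        ENNReal.ofReal (Real.exp (N * (ℓ - c + ε))) := by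
  obtain ⟨M, hM⟩ : ∃ M : ℝ, ∀ q, (φ q : ℝ) ≤ M := by
    obtain ⟨M, hM⟩ := φ.isBounded_range.bddAbove
    exact ⟨M, fun q => NNReal.coe_le_coe.2 (hM ⟨q, rfl⟩)⟩
  set I := ∫ y, Real.exp (f y) ∂ν with hI
  have hI0 : 0 < I := integral_exp_pos
    (integrable_exp_of_bounded ν f.continuous.measurable f.norm_coe_le_norm).2
  have hδ : Tendsto (fun N : ℕ => (|N * β N - γ| + β N) * M / 2) atTop (𝓝 0) := by
    have h1 : Tendsto (fun N : ℕ => |N * β N - γ|) atTop (𝓝 0) := by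
      simpa using (hβγ.sub_const γ).abs
    simpa using ((h1.add (tendsto_zero_of_tendsto_nat_mul hβγ)).mul_const M).div_const 2
  have hlt : ENNReal.ofReal (Real.exp ℓ * I) < ENNReal.ofReal (Real.exp ℓ * (I + ε / 2)) := by
    rw [ENNReal.ofReal_lt_ofReal_iff (by positivity)]
    gcongr
    linarith
  filter_upwards [hδ.eventually (gt_mem_nhds (half_pos hε)), hρ.eventually (gt_mem_nhds hlt),
    eventually_gt_atTop 0] with N h1 h2 hN
  -- By t ≤ e^{t-1}, the N-th power of this integral cancels the 1 - I coming from the dual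
  -- functional; hence no logarithm is needed in `dualEnergy`.
  have h3 : ∫⁻ y, ENNReal.ofReal (Real.exp (f y)) ∂(ρ N) ≤
      ENNReal.ofReal (Real.exp (ℓ + (I + ε / 2 - 1))) := by
    refine h2.le.trans (ENNReal.ofReal_le_ofReal ?_)
    rw [Real.exp_add]
    gcongr
    linarith [Real.add_one_le_exp (I + ε / 2 - 1)]
  refine (pairGibbs_le_of_boltzmann_le hG (β N) (ρ N) (u := fun y => ENNReal.ofReal (Real.exp (f y)))
    (by fun_prop) (K := ENNReal.ofReal (Real.exp (N * (-c - I + 1 + ε / 2)))) ?_).trans ?_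
  · rintro x ⟨μ, hμ, hμx⟩
    rw [Set.mem_ofPred_eq, hμx] at hμ
    refine (boltzmann_le_of_lt_dualEnergy hsymm hφ hM f ν (hβ N).le hN x hμ).trans ?_
    gcongr
  · calc _ ≤ ENNReal.ofReal (Real.exp (N * (-c - I + 1 + ε / 2))) *
          ENNReal.ofReal (Real.exp (ℓ + (I + ε / 2 - 1))) ^ N := by gcongr
      _ = ENNReal.ofReal (Real.exp (N * (ℓ - c + ε))) := by
        rw [← ENNReal.ofReal_pow (Real.exp_nonneg _), ← Real.exp_nat_mul,
          ← ENNReal.ofReal_mul (Real.exp_nonneg _), ← Real.exp_add]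
        congr 2
        ring

/-- The large deviation upper bound for the unnormalized Gibbs measures. -/
theorem eventually_pairGibbs_closed_le [T2Space X] [TopologicalSpace.PseudoMetrizableSpace X]
    {G : X → X → ℝ≥0∞}
    (hG : LowerSemicontinuous fun q : X × X => G q.1 q.2) (hsymm : ∀ x z, G x z = G z x)
    {ν : Measure X} [IsProbabilityMeasure ν] {γ : ℝ} (hγ : 0 < γ) {β : ℕ → ℝ} (hβ : ∀ N, 0 < β N)
    (hβγ : Tendsto (fun N : ℕ => (N : ℝ) * β N) atTop (𝓝 γ))
    {ρ : ℕ → Measure X} [∀ N, IsFiniteMeasure (ρ N)] {ℓ : ℝ}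
    (hρ : ∀ f : X →ᵇ ℝ, Tendsto (fun N => ∫⁻ y, ENNReal.ofReal (Real.exp (f y)) ∂(ρ N)) atTop
      (𝓝 (ENNReal.ofReal (Real.exp ℓ * ∫ y, Real.exp (f y) ∂ν))))
    {h : X → ℕ} (hm : Measurable h) (hK : ∀ k, ∃ K, IsCompact K ∧ {x | h x ≤ k} ⊆ K) {b : ℝ}
    (hb : ∀ᶠ N in atTop, ∫⁻ y, ENNReal.ofReal (Real.exp (h y)) ∂(ρ N) ≤
      ENNReal.ofReal (Real.exp b))
    {C : Set (ProbabilityMeasure X)} (hC : IsClosed C) {c : ℝ}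
    (hc : ∀ μ ∈ C, ENNReal.ofReal c ≤ meanFieldEnergy G ν γ μ) {ε : ℝ} (hε : 0 < ε) :
    ∀ᶠ N : ℕ in atTop, pairGibbs G (β N) (ρ N) N (empiricalEvent N C) ≤
      ENNReal.ofReal (Real.exp (N * (ℓ - c + ε))) := by
  -- L makes the non-tight part e^{N(b - L)} at most e^{N(ℓ - c)}. The three thirds of ε below pay
  -- for approaching c by a dual functional, for its Chernoff bound, and for the number of sets in
  -- the cover.
  obtain ⟨L, hL⟩ : ∃ L : ℝ≥0, b - ℓ + c ≤ L := ⟨(b - ℓ + c).toNNReal, Real.le_coe_toNNReal _⟩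
  have hKc := (isCompact_closure_lintegral_le hm hK L).inter_left hC
  have hex : ∀ μ : ProbabilityMeasure X, ∃ (φ : X × X →ᵇ ℝ≥0) (f : X →ᵇ ℝ),
      (∀ x z, (φ (x, z) : ℝ≥0∞) ≤ G x z) ∧ (μ ∈ C → c - ε / 3 < dualEnergy φ f ν γ μ) := by
    intro μ
    by_cases hμ : μ ∈ C
    · have h1 : c - ε / 3 < 0 ∨ ENNReal.ofReal (c - ε / 3) < meanFieldEnergy G ν γ μ := by
        rcases lt_or_ge (c - ε / 3) 0 with h0 | h0
        · exact Or.inl h0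
        · refine Or.inr (lt_of_lt_of_le ?_ (hc μ hμ))
          rw [ENNReal.ofReal_lt_ofReal_iff (by linarith)]
          linarith
      obtain ⟨φ, f, h2, h3⟩ := exists_lt_dualEnergy hG ν hγ μ h1
      exact ⟨φ, f, h2, fun _ => h3⟩
    · exact ⟨0, 0, by simp, fun h => absurd h hμ⟩
  choose φ f hφ hlt using hex
  let U : ProbabilityMeasure X → Set (ProbabilityMeasure X) :=
    fun μ => {μ' | c - ε / 3 < dualEnergy (φ μ) (f μ) ν γ μ'}
  have hUo : ∀ μ, IsOpen (U μ) := fun μ =>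
    isOpen_lt continuous_const (continuous_dualEnergy _ _ _ _)
  obtain ⟨t, ht⟩ := hKc.elim_finite_subcover U hUo fun μ hμ => Set.mem_iUnion.2 ⟨μ, hlt μ hμ.1⟩
  have hcover : C ⊆ {μ | (L : ℝ≥0∞) < ∫⁻ y, h y ∂(μ : Measure X)} ∪ ⋃ μ ∈ t, U μ := by
    intro μ hμ
    by_cases hμL : (L : ℝ≥0∞) < ∫⁻ y, h y ∂(μ : Measure X)
    · exact Or.inl hμL
    · exact Or.inr (ht ⟨hμ, subset_closure (not_lt.1 hμL)⟩)
  have hev : ∀ᶠ N : ℕ in atTop, ∀ μ ∈ t, pairGibbs G (β N) (ρ N) N (empiricalEvent N (U μ)) ≤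
      ENNReal.ofReal (Real.exp (N * (ℓ - (c - ε / 3) + ε / 3))) :=
    (Filter.eventually_all_finset t).2 fun μ _ => eventually_pairGibbs_dualEnergy_le hG.measurable
      hsymm (hφ μ) (f μ) hβ hβγ (hρ _) _ (by positivity)
  have hcard : ∀ᶠ N : ℕ in atTop, ((t.card : ℝ) + 1) ≤ Real.exp (N * (ε / 3)) := by
    have h1 : Tendsto (fun N : ℕ => Real.exp (N * (ε / 3))) atTop atTop :=
      Real.tendsto_exp_atTop.comp
        (tendsto_natCast_atTop_atTop.atTop_mul_const (by positivity))
    exact h1.eventually_ge_atTop _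
  filter_upwards [hev, hcard, hb, eventually_gt_atTop 0] with N h1 h2 h3 hN
  set q := ENNReal.ofReal (Real.exp (N * (ℓ - (c - ε / 3) + ε / 3))) with hq
  have hN0 : (0 : ℝ) < N := by exact_mod_cast hN
  have h4 : pairGibbs G (β N) (ρ N) N
      (empiricalEvent N {μ | (L : ℝ≥0∞) < ∫⁻ y, h y ∂(μ : Measure X)}) ≤ q := by
    refine (pairGibbs_lt_lintegral_le hG.measurable (β N) (ρ N) hm L hN).trans ?_
    calc _ ≤ ENNReal.ofReal (Real.exp (-(N * L))) * ENNReal.ofReal (Real.exp b) ^ N := by gcongr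
      _ ≤ q := by
        rw [← ENNReal.ofReal_pow (Real.exp_nonneg _), ← Real.exp_nat_mul,
          ← ENNReal.ofReal_mul (Real.exp_nonneg _), ← Real.exp_add]
        refine ENNReal.ofReal_le_ofReal (Real.exp_le_exp.2 ?_)
        nlinarith
  calc pairGibbs G (β N) (ρ N) N (empiricalEvent N C)
      ≤ pairGibbs G (β N) (ρ N) N
          (empiricalEvent N {μ | (L : ℝ≥0∞) < ∫⁻ y, h y ∂(μ : Measure X)} ∪
            ⋃ μ ∈ t, empiricalEvent N (U μ)) :=
        measure_mono (((empiricalEvent_mono hcover).trans (empiricalEvent_union _ _)).trans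
          (Set.union_subset_union_right _ (empiricalEvent_biUnion _ _)))
    _ ≤ q + ∑ μ ∈ t, q := (measure_union_le _ _).trans
        (add_le_add h4 ((measure_biUnion_finset_le _ _).trans (Finset.sum_le_sum h1)))
    _ = ENNReal.ofReal ((t.card : ℝ) + 1) * q := by
        rw [Finset.sum_const, nsmul_eq_mul, ENNReal.ofReal_add (by positivity) zero_le_one]
        simp [add_mul, add_comm]
    _ ≤ ENNReal.ofReal (Real.exp (N * (ε / 3))) * q := by gcongr
    _ = ENNReal.ofReal (Real.exp (N * (ℓ - c + ε))) := by
        rw [hq, ← ENNReal.ofReal_mul (Real.exp_nonneg _), ← Real.exp_add]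
        congr 2
        ring

end UpperBoundAsymptotics

/-! ### Change of measure and the lower bound for open sets. -/

section LowerBound

open InformationTheory
open scoped BoundedContinuousFunction

variable {X : Type*} [MeasurableSpace X]

theorem isProbabilityMeasure_empiricalMeasure {N : ℕ} (hN : 0 < N) (x : Fin N → X) :
    IsProbabilityMeasure (empiricalMeasure x) := by
  refine ⟨?_⟩
  rw [empiricalMeasure, Measure.smul_apply, Measure.coe_finsetSum, Finset.sum_apply]
  simp only [measure_univ, Finset.sum_const, Finset.card_univ, Fintype.card_fin, nsmul_eq_mul,
    mul_one, smul_eq_mul]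
  exact ENNReal.inv_mul_cancel (by exact_mod_cast hN.ne') (by simp)

/-- Change of the reference measure of a product. -/
theorem lintegral_pi_mul_prod_inv_le {μ ρ : Measure X} [IsProbabilityMeasure μ] [SigmaFinite ρ]
    {q : X → ℝ≥0∞} (hq : Measurable q) (hμ : μ = ρ.withDensity q) {N : ℕ}
    {u : (Fin N → X) → ℝ≥0∞} (hu : Measurable u) :
    ∫⁻ x, u x * ∏ j, (q (x j))⁻¹ ∂(Measure.pi fun _ => μ) ≤
      ∫⁻ x, u x ∂(Measure.pi fun _ => ρ) := by
  have : SigmaFinite (ρ.withDensity q) := hμ ▸ inferInstance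
  have hqm : Measurable fun x : Fin N → X => ∏ j, q (x j) :=
    Finset.measurable_prod _ fun j _ => hq.comp (measurable_pi_apply j)
  have hqm' : Measurable fun x : Fin N → X => ∏ j, (q (x j))⁻¹ :=
    Finset.measurable_prod _ fun j _ => hq.inv.comp (measurable_pi_apply j)
  have h1 : (Measure.pi fun _ : Fin N => μ) =
      (Measure.pi fun _ => ρ).withDensity fun x => ∏ j, q (x j) := by
    rw [← pi_withDensity ρ hq]
    simp only [← hμ]
  have huq : Measurable fun x => u x * ∏ j, (q (x j))⁻¹ := hu.mul hqm'
  rw [h1, lintegral_withDensity_eq_lintegral_mul _ hqm huq]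
  refine lintegral_mono fun x => ?_
  simp only [Pi.mul_apply]
  rw [mul_left_comm, ← Finset.prod_mul_distrib]
  -- Only an inequality, because q may take the values 0 and ∞.
  calc u x * ∏ j, (q (x j) * (q (x j))⁻¹) ≤ u x * 1 := by
        gcongr
        exact Finset.prod_le_one' fun j _ => ENNReal.mul_inv_le_one _
    _ = u x := mul_one _

/-- Tilting: a lower bound K for the Gibbs weight divided by the density of μ^{⊗N} reduces the
estimate to the probability of T under independent samples from μ. -/
theorem mul_pi_le_pairGibbs {G : X → X → ℝ≥0∞} (hG : Measurable fun q : X × X => G q.1 q.2)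
    (β : ℝ) {μ ρ : Measure X} [IsProbabilityMeasure μ] [SigmaFinite ρ]
    {q : X → ℝ≥0∞} (hq : Measurable q) (hμ : μ = ρ.withDensity q) {N : ℕ}
    {T : Set (Fin N → X)} (hT : MeasurableSet T) {K : ℝ≥0∞}
    (hK : ∀ x ∈ T, K ≤ boltzmann β (pairSum G x) * ∏ j, (q (x j))⁻¹) :
    K * (Measure.pi fun _ => μ) T ≤ pairGibbs G β ρ N T := by
  have hb : Measurable fun x : Fin N → X => boltzmann β (pairSum G x) :=
    (measurable_boltzmann β).comp (measurable_pairSum hG N)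
  rw [pairGibbs, withDensity_apply _ hT, ← lintegral_indicator hT]
  refine le_trans ?_ (lintegral_pi_mul_prod_inv_le hq hμ (hb.indicator hT))
  rw [← lintegral_indicator_const hT]
  refine lintegral_mono fun x => ?_
  by_cases hx : x ∈ T
  · simpa [hx] using hK x hx
  · simp [hx]

/-- The expected pair energy of independent samples. -/
theorem lintegral_pairSum_le {G : X → X → ℝ≥0∞} (hG : Measurable fun q : X × X => G q.1 q.2)
    (μ : Measure X) [IsProbabilityMeasure μ] (N : ℕ) :
    ∫⁻ x : Fin N → X, pairSum G x ∂(Measure.pi fun _ => μ) ≤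
      ENNReal.ofReal ((N : ℝ) ^ 2 / 2) * ∫⁻ x, ∫⁻ z, G x z ∂μ ∂μ := by
  have hm : ∀ i j : Fin N, Measurable fun x : Fin N → X => G (x i) (x j) := fun i j =>
    Measurable.comp (g := fun q : X × X => G q.1 q.2) (f := fun x : Fin N → X => (x i, x j)) hG
      ((measurable_pi_apply i).prodMk (measurable_pi_apply j))
  have h1 : ∀ i j : Fin N, i ≠ j → ∫⁻ x : Fin N → X, G (x i) (x j) ∂(Measure.pi fun _ => μ) =
      ∫⁻ x, ∫⁻ z, G x z ∂μ ∂μ := by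
    intro i j hij
    have h2 := Measure.infinitePi_map_eval_prod (P := fun _ : Fin N => μ) hij
    rw [Measure.infinitePi_eq_pi] at h2
    rw [← lintegral_prod (fun q : X × X => G q.1 q.2) hG.aemeasurable, ← h2,
      lintegral_map hG ((measurable_pi_apply i).prodMk (measurable_pi_apply j))]
  unfold pairSum
  rw [lintegral_finsetSum _ fun i _ => Finset.measurable_sum _ fun j _ => hm i j]
  have h3 : ∀ i : Fin N, ∫⁻ x : Fin N → X, ∑ j ∈ Finset.Ioi i, G (x i) (x j)
      ∂(Measure.pi fun _ => μ) = ∑ j ∈ Finset.Ioi i, ∫⁻ x, ∫⁻ z, G x z ∂μ ∂μ := by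
    intro i
    rw [lintegral_finsetSum _ fun j _ => hm i j]
    exact Finset.sum_congr rfl fun j hj => h1 i j (Finset.mem_Ioi.1 hj).ne
  simp only [h3, Finset.sum_const, nsmul_eq_mul]
  rw [← Finset.sum_mul]
  gcongr
  have h4 := sum_sum_Ioi_add (N := N) fun _ => (1 / 2 : ℝ)
  have h5 : ∑ i : Fin N, ((Finset.Ioi i).card : ℝ) = ((N - 1 : ℕ) : ℝ) * (N / 2) := by
    have e : ∀ i : Fin N, ∑ j ∈ Finset.Ioi i, ((1 / 2 : ℝ) + 1 / 2) = ((Finset.Ioi i).card : ℝ) := by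
      intro i
      rw [Finset.sum_const, nsmul_eq_mul]
      norm_num
    rw [← Finset.sum_congr rfl fun i _ => e i, h4]
    simp [div_eq_mul_inv]
  have h6 : ((N - 1 : ℕ) : ℝ) ≤ N := by exact_mod_cast Nat.sub_le _ _
  calc ∑ i : Fin N, ((Finset.Ioi i).card : ℝ≥0∞)
      = ENNReal.ofReal (∑ i : Fin N, ((Finset.Ioi i).card : ℝ)) := by
        rw [ENNReal.ofReal_sum_of_nonneg fun i _ => by positivity]
        simp
    _ ≤ _ := by
        rw [h5]
        refine ENNReal.ofReal_le_ofReal ?_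
        nlinarith [(Nat.cast_nonneg N : (0 : ℝ) ≤ N)]

/-- The unnormalized Gibbs measure does not vanish. -/
theorem pairGibbs_univ_pos {G : X → X → ℝ≥0∞} (hG : Measurable fun q : X × X => G q.1 q.2)
    (β : ℝ) {μ ρ : Measure X} [IsProbabilityMeasure μ] [SigmaFinite ρ]
    {q : X → ℝ≥0∞} (hq : Measurable q) (hqt : ∀ x, q x ≠ ⊤) (hμ : μ = ρ.withDensity q)
    (hE : ∫⁻ x, ∫⁻ z, G x z ∂μ ∂μ ≠ ⊤) (N : ℕ) : 0 < pairGibbs G β ρ N Set.univ := by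
  have hS : Measurable fun x : Fin N → X => pairSum G x := measurable_pairSum hG N
  have hb : Measurable fun x : Fin N → X => boltzmann β (pairSum G x) :=
    (measurable_boltzmann β).comp hS
  rw [pairGibbs, withDensity_apply _ MeasurableSet.univ, Measure.restrict_univ]
  refine lt_of_lt_of_le ?_ (lintegral_pi_mul_prod_inv_le hq hμ hb)
  -- A finite expected energy makes the Boltzmann factor positive almost surely.
  have hfin : ∀ᵐ x ∂(Measure.pi fun _ : Fin N => μ), pairSum G x < ⊤ :=
    ae_lt_top hS ((lintegral_pairSum_le hG μ N).trans_lt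
      (ENNReal.mul_lt_top (by simp) hE.lt_top)).ne
  have hqm' : Measurable fun x : Fin N → X => ∏ j, (q (x j))⁻¹ :=
    Finset.measurable_prod _ fun j _ => hq.inv.comp (measurable_pi_apply j)
  have hbq : Measurable fun x => boltzmann β (pairSum G x) * ∏ j, (q (x j))⁻¹ := hb.mul hqm'
  rw [pos_iff_ne_zero, Ne, lintegral_eq_zero_iff hbq]
  intro h0
  have : ∀ᵐ x ∂(Measure.pi fun _ : Fin N => μ), False := by
    filter_upwards [h0, hfin] with x hx hx2
    have h1 : boltzmann β (pairSum G x) ≠ 0 := by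
      rw [boltzmann, Ne, EReal.exp_eq_zero_iff, EReal.neg_eq_bot_iff,
        EReal.coe_ennreal_eq_top_iff]
      exact ENNReal.mul_ne_top (by simp) hx2.ne
    have h2 : ∏ j, (q (x j))⁻¹ ≠ 0 := Finset.prod_ne_zero_iff.2 fun j _ => by simpa using hqt _
    exact mul_ne_zero h1 h2 hx
  simp at this
  exact NeZero.ne _ this

variable [TopologicalSpace X] [OpensMeasurableSpace X]

/-- The law of large numbers for empirical measures in the weak topology. -/
theorem tendsto_pi_empiricalEvent_compl (μ : ProbabilityMeasure X) {O : Set (ProbabilityMeasure X)}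
    (hO : O ∈ 𝓝 μ) :
    Tendsto (fun N : ℕ => (Measure.pi fun _ : Fin N => (μ : Measure X)) (empiricalEvent N Oᶜ))
      atTop (𝓝 0) := by
  let P : (N : ℕ) → Measure (Fin N → X) := fun N => Measure.pi fun _ : Fin N => (μ : Measure X)
  -- Sets whose complement has vanishing probability form a filter. Its convergence to μ can be
  -- tested on one bounded continuous function at a time, so finite intersections of neighbourhoods
  -- need no separate treatment.
  let F : Filter (ProbabilityMeasure X) :=
    { sets := {A | Tendsto (fun N => P N (empiricalEvent N Aᶜ)) atTop (𝓝 0)}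
      univ_sets := by simp [empiricalEvent]
      sets_of_superset := fun {A B} hA hAB => tendsto_of_tendsto_of_tendsto_of_le_of_le
        tendsto_const_nhds hA (fun _ => zero_le) fun N =>
          measure_mono (empiricalEvent_mono (Set.compl_subset_compl.2 hAB))
      inter_sets := fun {A B} hA hB => by
        have h : Tendsto (fun N => P N (empiricalEvent N Aᶜ) + P N (empiricalEvent N Bᶜ)) atTop
            (𝓝 0) := by simpa using Tendsto.add hA hB
        refine tendsto_of_tendsto_of_tendsto_of_le_of_le tendsto_const_nhds h
          (fun _ => zero_le) fun N => ?_
        rw [Set.compl_inter]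
        exact (measure_mono (empiricalEvent_union _ _)).trans (measure_union_le _ _) }
  have hF : Tendsto id F (𝓝 μ) := by
    rw [ProbabilityMeasure.tendsto_iff_forall_integral_tendsto]
    intro f
    rw [Metric.tendsto_nhds]
    intro δ hδ
    refine tendsto_of_tendsto_of_tendsto_of_le_of_le tendsto_const_nhds
      (tendsto_pi_average_sub_ge (μ : Measure X) f.continuous.measurable (f.integrable _) hδ)
      (fun _ => zero_le) fun N => measure_mono ?_
    rintro x ⟨μ', hμ', e⟩
    simp only [id, Set.mem_compl_iff, Set.mem_ofPred_eq, not_lt, Real.dist_eq, e] at hμ' ⊢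
    rwa [integral_empiricalMeasure x f.continuous.measurable.stronglyMeasurable,
      ← div_eq_inv_mul] at hμ'
  exact hF hO

/-- The large deviation lower bound for the unnormalized Gibbs measures. -/
theorem eventually_le_pairGibbs_open {G : X → X → ℝ≥0∞}
    (hG : Measurable fun q : X × X => G q.1 q.2) {ν : Measure X} [IsProbabilityMeasure ν]
    {γ : ℝ} (hγ : 0 < γ) {β : ℕ → ℝ} (hβ : ∀ N, 0 < β N)
    (hβγ : Tendsto (fun N : ℕ => (N : ℝ) * β N) atTop (𝓝 γ)) (μ : ProbabilityMeasure X)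
    (hF : meanFieldEnergy G ν γ μ ≠ ⊤) {θ : X → ℝ} (hθ : Measurable θ) (hθ0 : ∀ x, 0 ≤ θ x)
    (hθμ : ∫⁻ x, ENNReal.ofReal (θ x) ∂(μ : Measure X) ≠ ⊤)
    {a : ℕ → ℝ} (ha0 : ∀ N, 0 ≤ a N) (ha : Tendsto a atTop (𝓝 0)) {ℓ : ℝ}
    {ρ : ℕ → Measure X} [∀ N, SigmaFinite (ρ N)] {q : ℕ → X → ℝ≥0∞} (hq : ∀ N, Measurable (q N))
    (hqρ : ∀ N, (μ : Measure X) = (ρ N).withDensity (q N))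
    (hql : ∀ N x, q N x ≤ ENNReal.ofReal (Real.exp (llr (μ : Measure X) ν x - ℓ + a N * θ x)))
    {O : Set (ProbabilityMeasure X)} (hO : O ∈ 𝓝 μ) {ε : ℝ} (hε : 0 < ε) :
    ∀ᶠ N : ℕ in atTop,
      ENNReal.ofReal (Real.exp (N * (ℓ - (meanFieldEnergy G ν γ μ).toReal - 3 * ε))) ≤
        pairGibbs G (β N) (ρ N) N (empiricalEvent N O) := by
  obtain ⟨hEm, hK⟩ := ENNReal.add_ne_top.1 hF
  have hγ2 : 0 < γ / 2 := by positivity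
  set E := ∫⁻ x, ∫⁻ z, G x z ∂(μ : Measure X) ∂(μ : Measure X) with hEdef
  have hE : E ≠ ⊤ := by
    intro h
    rw [h, ENNReal.mul_top (by simpa using hγ)] at hEm
    exact hEm rfl
  obtain ⟨hac, hint⟩ := klDiv_ne_top_iff.1 hK
  set H := (klDiv (μ : Measure X) ν).toReal with hH
  have hHint : ∫ x, llr (μ : Measure X) ν x ∂(μ : Measure X) = H :=
    (toReal_klDiv_of_measure_eq hac (by simp)).symm
  set Θ := ∫⁻ x, ENNReal.ofReal (θ x) ∂(μ : Measure X) with hΘ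
  set τ := γ / 2 * E.toReal with hτ
  have hτ0 : 0 ≤ τ := by positivity
  have hFr : (meanFieldEnergy G ν γ μ).toReal = τ + H := by
    rw [meanFieldEnergy, ENNReal.toReal_add hEm hK, ENNReal.toReal_mul,
      ENNReal.toReal_ofReal hγ2.le]
  -- Upper bound for the expectation of W / N under μ^{⊗N}, where W collects the pair energy and the
  -- error a_N ∑ θ(x_j).
  set τN : ℕ → ℝ := fun N => N * β N / 2 * E.toReal + a N * Θ.toReal with hτN
  have hτlim : Tendsto τN atTop (𝓝 τ) := by
    simpa using ((hβγ.div_const 2).mul_const E.toReal).add (ha.mul_const Θ.toReal)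
  set P : (N : ℕ) → Measure (Fin N → X) := fun N => Measure.pi fun _ => (μ : Measure X) with hP
  -- Markov's inequality gives P(W ≥ N(τ + ε)) ≤ (τ + ε/2)/(τ + ε) = 1 - 2η. The two
  -- law-of-large-numbers events take η/2 each, so probability at least η remains.
  set η := ε / (4 * (τ + ε)) with hη
  have hη0 : 0 < η := by positivity
  have hB1 : Tendsto (fun N : ℕ => P N
      {x | ε ≤ |(∑ j, llr (μ : Measure X) ν (x j)) / N - H|}) atTop (𝓝 0) := by
    rw [← hHint]
    exact tendsto_pi_average_sub_ge (μ : Measure X) (measurable_llr _ _) hint hε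
  have hB3 := tendsto_pi_empiricalEvent_compl μ hO
  have hη4 : 0 < ENNReal.ofReal (η / 2) := by simpa using hη0
  -- The constant η is paid for by the third ε; the other two go to the entropy and to W.
  have hexp : ∀ᶠ N : ℕ in atTop, Real.exp (-(N * ε)) ≤ η := by
    have h1 : Tendsto (fun N : ℕ => Real.exp (-(N * ε))) atTop (𝓝 0) :=
      Real.tendsto_exp_neg_atTop_nhds_zero.comp
        (tendsto_natCast_atTop_atTop.atTop_mul_const hε)
    exact h1.eventually_le_const hη0
  filter_upwards [hB1.eventually (gt_mem_nhds hη4), hB3.eventually (gt_mem_nhds hη4),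
    hτlim.eventually (gt_mem_nhds (by linarith : τ < τ + ε / 2)), hexp, eventually_gt_atTop 0]
    with N h1 h3 h2 h4 hN
  have hN0 : (0 : ℝ) < N := by exact_mod_cast hN
  let W : (Fin N → X) → ℝ≥0∞ := fun x =>
    ENNReal.ofReal (β N) * pairSum G x + ∑ j, ENNReal.ofReal (a N) * ENNReal.ofReal (θ (x j))
  have hWs : ∀ j : Fin N, Measurable fun x : Fin N → X =>
      ENNReal.ofReal (a N) * ENNReal.ofReal (θ (x j)) := fun j => by fun_prop
  have hSm : Measurable fun x : Fin N → X => pairSum G x := measurable_pairSum hG N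
  have hWm : Measurable W :=
    (hSm.const_mul _).add (Finset.measurable_sum _ fun j _ => hWs j)
  have hWint : ∫⁻ x, W x ∂(P N) ≤ ENNReal.ofReal (N * τN N) := by
    have e1 : ∀ j : Fin N, ∫⁻ x, ENNReal.ofReal (a N) * ENNReal.ofReal (θ (x j)) ∂(P N) =
        ENNReal.ofReal (a N) * Θ := by
      intro j
      rw [lintegral_const_mul _ (by fun_prop)]
      congr 1
      exact (measurePreserving_eval (fun _ : Fin N => (μ : Measure X)) j).lintegral_comp
        (f := fun y => ENNReal.ofReal (θ y)) (by fun_prop)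
    simp only [W]
    rw [lintegral_add_left (hSm.const_mul _), lintegral_const_mul _ hSm,
      lintegral_finsetSum _ fun j _ => hWs j, Finset.sum_congr rfl fun j _ => e1 j]
    calc _ ≤ ENNReal.ofReal (β N) * (ENNReal.ofReal ((N : ℝ) ^ 2 / 2) * E) +
          ∑ j : Fin N, ENNReal.ofReal (a N) * Θ := by
            gcongr
            exact lintegral_pairSum_le hG (μ : Measure X) N
      _ = ENNReal.ofReal (N * τN N) := by
        have hEo : E = ENNReal.ofReal E.toReal := (ENNReal.ofReal_toReal hE).symm
        have hΘo : Θ = ENNReal.ofReal Θ.toReal := (ENNReal.ofReal_toReal hθμ).symm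
        have hβN := (hβ N).le
        have haN := ha0 N
        rw [Finset.sum_const, Finset.card_univ, Fintype.card_fin, nsmul_eq_mul, hEo, hΘo,
          ← ENNReal.ofReal_natCast, ← ENNReal.ofReal_mul (by positivity),
          ← ENNReal.ofReal_mul hβN, ← ENNReal.ofReal_mul haN,
          ← ENNReal.ofReal_mul (by positivity), ← ENNReal.ofReal_add (by positivity)
            (by positivity)]
        simp only [hτN]
        congr 1
        ring
  set B1 : Set (Fin N → X) := {x | ε ≤ |(∑ j, llr (μ : Measure X) ν (x j)) / N - H|} with hB1d
  set B2 : Set (Fin N → X) := {x | ENNReal.ofReal (N * (τ + ε)) ≤ W x} with hB2d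
  -- A measurable hull of the same measure, since measurability of the event itself is not
  -- established.
  set B3 : Set (Fin N → X) := toMeasurable (P N) (empiricalEvent N Oᶜ) with hB3d
  have hB1m : MeasurableSet B1 := by
    refine measurableSet_le measurable_const ?_
    have : Measurable fun x : Fin N → X => ∑ j, llr (μ : Measure X) ν (x j) :=
      Finset.measurable_sum _ fun j _ => (measurable_llr _ _).comp (measurable_pi_apply j)
    fun_prop
  have hB2m : MeasurableSet B2 := measurableSet_le measurable_const hWm
  have hTm : MeasurableSet (B1 ∪ B2 ∪ B3)ᶜ :=
    ((hB1m.union hB2m).union (measurableSet_toMeasurable _ _)).compl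
  have hPB2 : P N B2 ≤ ENNReal.ofReal (1 - 2 * η) := by
    have hpos : 0 < N * (τ + ε) := by positivity
    refine (meas_ge_le_lintegral_div hWm.aemeasurable (ENNReal.ofReal_pos.2 hpos).ne'
      ENNReal.ofReal_ne_top).trans ?_
    refine (ENNReal.div_le_div_right hWint _).trans ?_
    rw [← ENNReal.ofReal_div_of_pos hpos]
    refine ENNReal.ofReal_le_ofReal ?_
    rw [div_le_iff₀ hpos, hη]
    have e : (1 - 2 * (ε / (4 * (τ + ε)))) * (N * (τ + ε)) = N * (τ + ε / 2) := by
      field_simp; ring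
    rw [e]
    gcongr
  have hη2 : 0 ≤ 1 - 2 * η := by
    rw [hη, sub_nonneg, ← mul_div_assoc, div_le_one (by positivity)]
    linarith
  have hPT : ENNReal.ofReal η ≤ P N (B1 ∪ B2 ∪ B3)ᶜ := by
    have hbad : P N (B1 ∪ B2 ∪ B3) ≤ ENNReal.ofReal (1 - η) := by
      calc _ ≤ P N B1 + P N B2 + P N B3 :=
            (measure_union_le _ _).trans (add_le_add_left (measure_union_le _ _) _)
        _ ≤ ENNReal.ofReal (η / 2) + ENNReal.ofReal (1 - 2 * η) + ENNReal.ofReal (η / 2) := by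
            rw [hB3d, measure_toMeasurable]
            exact add_le_add (add_le_add h1.le hPB2) h3.le
        _ = ENNReal.ofReal (1 - η) := by
            rw [← ENNReal.ofReal_add (by positivity) hη2,
              ← ENNReal.ofReal_add (by positivity) (by positivity)]
            congr 1
            ring
    have hone : 1 ≤ P N (B1 ∪ B2 ∪ B3) + P N (B1 ∪ B2 ∪ B3)ᶜ := by
      have : P N Set.univ = 1 := measure_univ
      rw [← this, ← Set.union_compl_self (B1 ∪ B2 ∪ B3)]
      exact measure_union_le _ _
    have h5 : ENNReal.ofReal η + ENNReal.ofReal (1 - η) = 1 := by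
      rw [← ENNReal.ofReal_add hη0.le (by linarith)]
      simp
    have h6 : ENNReal.ofReal (1 - η) + ENNReal.ofReal η ≤
        ENNReal.ofReal (1 - η) + P N (B1 ∪ B2 ∪ B3)ᶜ := by
      rw [add_comm, h5]
      exact hone.trans (by gcongr)
    exact (ENNReal.add_le_add_iff_left ENNReal.ofReal_ne_top).1 h6
  have hsub : (B1 ∪ B2 ∪ B3)ᶜ ⊆ empiricalEvent N O := by
    intro x hx
    have hx3 : x ∉ empiricalEvent N Oᶜ := fun h => hx (Or.inr (subset_toMeasurable _ _ h))
    by_contra hcon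
    exact hx3 ⟨⟨empiricalMeasure x, isProbabilityMeasure_empiricalMeasure hN x⟩,
      fun h => hcon ⟨_, h, rfl⟩, rfl⟩
  have hKT : ∀ x ∈ (B1 ∪ B2 ∪ B3)ᶜ,
      ENNReal.ofReal (Real.exp (N * (ℓ - (τ + H) - 2 * ε))) ≤
        boltzmann (β N) (pairSum G x) * ∏ j, (q N (x j))⁻¹ := by
    intro x hx
    have hx1 : ¬ ε ≤ |(∑ j, llr (μ : Measure X) ν (x j)) / N - H| :=
      fun h => hx (Or.inl (Or.inl h))
    have hx2 : ¬ ENNReal.ofReal (N * (τ + ε)) ≤ W x := fun h => hx (Or.inl (Or.inr h))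
    have hllr : ∑ j, llr (μ : Measure X) ν (x j) ≤ N * (H + ε) := by
      have := (abs_lt.1 (not_le.1 hx1)).2
      have h5 : (∑ j, llr (μ : Measure X) ν (x j)) / N < H + ε := by linarith
      rw [div_lt_iff₀ hN0] at h5
      linarith
    have hWlt := not_le.1 hx2
    have hSt : pairSum G x ≠ ⊤ := by
      intro h
      have : W x = ⊤ := by
        simp only [W, h]
        rw [ENNReal.mul_top (by simpa using hβ N), top_add]
      rw [this] at hWlt
      exact not_top_lt hWlt
    set S := (pairSum G x).toReal with hS
    have hWeq : W x = ENNReal.ofReal (β N * S + a N * ∑ j, θ (x j)) := by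
      simp only [W]
      rw [← Finset.mul_sum, ENNReal.ofReal_add
          (mul_nonneg (hβ N).le ENNReal.toReal_nonneg)
          (mul_nonneg (ha0 N) (Finset.sum_nonneg fun j _ => hθ0 _)),
        ENNReal.ofReal_mul (hβ N).le, ENNReal.ofReal_mul (ha0 N), ENNReal.ofReal_toReal hSt,
        ENNReal.ofReal_sum_of_nonneg fun j _ => hθ0 _]
    rw [hWeq, ENNReal.ofReal_lt_ofReal_iff (by positivity)] at hWlt
    have hb := le_boltzmann (hβ N).le (t := S) (s := pairSum G x) ENNReal.toReal_nonneg
      (ENNReal.ofReal_toReal hSt).ge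
    have hqi : ∀ j : Fin N,
        ENNReal.ofReal (Real.exp (-(llr (μ : Measure X) ν (x j) - ℓ + a N * θ (x j)))) ≤
          (q N (x j))⁻¹ := by
      intro j
      rw [Real.exp_neg, ENNReal.ofReal_inv_of_pos (Real.exp_pos _), ENNReal.inv_le_inv]
      exact hql N (x j)
    calc ENNReal.ofReal (Real.exp (N * (ℓ - (τ + H) - 2 * ε)))
        ≤ ENNReal.ofReal (Real.exp (-(β N * S))) * ∏ j,
          ENNReal.ofReal (Real.exp (-(llr (μ : Measure X) ν (x j) - ℓ + a N * θ (x j)))) := by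
          rw [← ENNReal.ofReal_prod_of_nonneg fun j _ => Real.exp_nonneg _, ← Real.exp_sum,
            ← ENNReal.ofReal_mul (Real.exp_nonneg _), ← Real.exp_add]
          refine ENNReal.ofReal_le_ofReal (Real.exp_le_exp.2 ?_)
          rw [Finset.sum_neg_distrib, Finset.sum_add_distrib, Finset.sum_sub_distrib,
            ← Finset.mul_sum, Finset.sum_const, Finset.card_univ, Fintype.card_fin, nsmul_eq_mul]
          nlinarith
      _ ≤ _ := mul_le_mul' hb (Finset.prod_le_prod' fun j _ => hqi j)
  have hmain := mul_pi_le_pairGibbs hG (β N) (hq N) (hqρ N) hTm hKT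
  rw [hFr]
  calc ENNReal.ofReal (Real.exp (N * (ℓ - (τ + H) - 3 * ε)))
      = ENNReal.ofReal (Real.exp (N * (ℓ - (τ + H) - 2 * ε))) *
          ENNReal.ofReal (Real.exp (-(N * ε))) := by
        rw [← ENNReal.ofReal_mul (Real.exp_nonneg _), ← Real.exp_add]
        congr 2
        ring
    _ ≤ ENNReal.ofReal (Real.exp (N * (ℓ - (τ + H) - 2 * ε))) * P N (B1 ∪ B2 ∪ B3)ᶜ := by
        gcongr
        exact (ENNReal.ofReal_le_ofReal h4).trans hPT
    _ ≤ pairGibbs G (β N) (ρ N) N (B1 ∪ B2 ∪ B3)ᶜ := hmain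
    _ ≤ _ := measure_mono hsub

end LowerBound

/-! ### Coercive functions, measurability and conditioned measures. -/

section ReferenceMeasures

open InformationTheory
open scoped BoundedContinuousFunction

/-- A finite measure on a locally compact, σ-compact space integrates the exponential of a function
with relatively compact sublevel sets. -/
theorem exists_nat_lintegral_exp_ne_top {X : Type*} [TopologicalSpace X] [T2Space X]
    [WeaklyLocallyCompactSpace X] [SigmaCompactSpace X] [MeasurableSpace X]
    [OpensMeasurableSpace X] (μ : Measure X) [IsFiniteMeasure μ] :
    ∃ h : X → ℕ, Measurable h ∧ (∀ k, ∃ K, IsCompact K ∧ {x | h x ≤ k} ⊆ K) ∧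
      ∫⁻ x, ENNReal.ofReal (Real.exp (h x)) ∂μ ≠ ⊤ := by
  classical
  let K : CompactExhaustion X := default
  have hKm : ∀ j, MeasurableSet (K j) := fun j => (K.isCompact j).isClosed.measurableSet
  have hlim : Tendsto (fun j => μ (K j)ᶜ) atTop (𝓝 0) := by
    have h := tendsto_measure_iInter_atTop (μ := μ) (s := fun j => (K j)ᶜ)
      (fun j => (hKm j).compl.nullMeasurableSet)
      (fun i j hij => Set.compl_subset_compl.2 (K.subset hij)) ⟨0, measure_ne_top _ _⟩
    rwa [← Set.compl_iUnion, K.iUnion_eq, Set.compl_univ, measure_empty] at h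
  -- The complement of the j-th compact set is so small that the value e^{j+1} on it contributes at
  -- most 2^{-j}. The function h is the first index whose compact set contains x, so h(x) = m + 1
  -- forces x outside the m-th one.
  have hex : ∀ j : ℕ, ∃ m, j ≤ m ∧
      μ (K m)ᶜ < (ENNReal.ofReal (Real.exp (j + 1)))⁻¹ * 2⁻¹ ^ j := by
    intro j
    have hpos : (0 : ℝ≥0∞) < (ENNReal.ofReal (Real.exp (j + 1)))⁻¹ * 2⁻¹ ^ j :=
      ENNReal.mul_pos (by simp) (by simp)
    obtain ⟨m, hm, hj⟩ := ((hlim.eventually_lt_const hpos).and (eventually_ge_atTop j)).exists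
    exact ⟨m, hj, hm⟩
  choose φ hφj hφ using hex
  have hcov : ∀ x, ∃ j, x ∈ K (φ j) := by
    intro x
    obtain ⟨j, hj⟩ := K.exists_mem x
    exact ⟨j, K.subset (hφj j) hj⟩
  refine ⟨fun x => Nat.find (hcov x), measurable_find _ fun k => hKm (φ k), fun k =>
    ⟨⋃ j ∈ Finset.range (k + 1), K (φ j),
      (Finset.range (k + 1)).isCompact_biUnion fun j _ => K.isCompact _, ?_⟩, ?_⟩
  · intro x hx
    simp only [Set.mem_iUnion, Finset.mem_range]
    exact ⟨_, Nat.lt_succ_of_le hx, Nat.find_spec (hcov x)⟩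
  · have hle : ∀ x, ENNReal.ofReal (Real.exp (Nat.find (hcov x))) ≤
        1 + ∑' j : ℕ, (K (φ j))ᶜ.indicator
          (fun _ => ENNReal.ofReal (Real.exp (j + 1))) x := by
      intro x
      rcases h : Nat.find (hcov x) with _ | m
      · simp
      · have hx : x ∈ (K (φ m))ᶜ := Nat.find_min (hcov x) (by omega)
        refine le_add_left (le_trans ?_ (ENNReal.le_tsum m))
        rw [Set.indicator_of_mem hx]
        push_cast
        rfl
    have hsum : ∫⁻ x, (1 + ∑' j : ℕ, (K (φ j))ᶜ.indicator
        (fun _ => ENNReal.ofReal (Real.exp (j + 1))) x) ∂μ ≤ μ Set.univ + 2 := by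
      rw [lintegral_add_left measurable_const, lintegral_one, lintegral_tsum fun j =>
        (measurable_const.indicator (hKm _).compl).aemeasurable]
      gcongr
      calc _ = ∑' j : ℕ, ENNReal.ofReal (Real.exp (j + 1)) * μ (K (φ j))ᶜ := by
            congr 1
            ext j
            rw [lintegral_indicator_const (hKm _).compl]
        _ ≤ ∑' j : ℕ, (2⁻¹ : ℝ≥0∞) ^ j := by
            refine ENNReal.tsum_le_tsum fun j => ?_
            refine (mul_le_mul_right (hφ j).le _).trans ?_
            rw [← mul_assoc, ENNReal.mul_inv_cancel
              (ENNReal.ofReal_pos.2 (Real.exp_pos _)).ne' ENNReal.ofReal_ne_top, one_mul]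
        _ = 2 := by rw [ENNReal.tsum_geometric, ENNReal.one_sub_inv_two, inv_inv]
    exact ne_top_of_le_ne_top (ENNReal.add_ne_top.2 ⟨measure_ne_top _ _, by simp⟩)
      ((lintegral_mono hle).trans hsum)

/-- A function with values in `[-∞, +∞]` that is continuous on the open set where it is not `+∞`
is measurable. -/
theorem measurable_of_continuousOn_lt_top {X : Type*} [TopologicalSpace X] [MeasurableSpace X]
    [OpensMeasurableSpace X] {U : X → EReal} (ho : IsOpen {x | U x < ⊤})
    (hc : ContinuousOn U {x | U x < ⊤}) : Measurable U := by
  classical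
  have h := hc.measurable_piecewise (g := fun _ => ⊤) continuousOn_const ho.measurableSet
  have e : {x | U x < ⊤}.piecewise U (fun _ => ⊤) = U := by
    ext x
    by_cases hx : x ∈ {x | U x < ⊤}
    · rw [Set.piecewise_eq_of_mem _ _ _ hx]
    · rw [Set.piecewise_eq_of_notMem _ _ _ hx]
      exact (not_lt_top_iff.1 hx).symm
  rwa [e] at h

/-- Conditioning a probability measure on a set of positive measure has finite relative entropy. -/
theorem klDiv_cond_ne_top {X : Type*} [MeasurableSpace X] (ν : Measure X) [IsProbabilityMeasure ν]
    {K : Set X} (hK : MeasurableSet K) (hν : ν K ≠ 0) :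
    klDiv ((ν K)⁻¹ • ν.restrict K) ν ≠ ⊤ := by
  have hc : (ν K)⁻¹ ≠ ⊤ := ENNReal.inv_ne_top.2 hν
  set μ := (ν K)⁻¹ • ν.restrict K with hμ
  have : IsFiniteMeasure μ := ⟨by
    rw [hμ, Measure.smul_apply, smul_eq_mul]
    exact ENNReal.mul_lt_top hc.lt_top (measure_lt_top _ _)⟩
  have hw : μ = ν.withDensity (K.indicator fun _ => (ν K)⁻¹) := by
    rw [withDensity_indicator hK, withDensity_const]
  have hac : μ ≪ ν := hw ▸ withDensity_absolutelyContinuous _ _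
  refine klDiv_ne_top_iff.2 ⟨hac, ?_⟩
  have h1 : μ.rnDeriv ν =ᵐ[ν] K.indicator fun _ => (ν K)⁻¹ := by
    rw [hw]
    exact Measure.rnDeriv_withDensity ν (measurable_const.indicator hK)
  have h2 : ∀ᵐ x ∂μ, x ∈ K := by
    rw [ae_iff, hμ, Measure.smul_apply, Measure.restrict_apply' hK]
    have : {x | x ∉ K} ∩ K = ∅ := by ext; simp
    rw [this]
    simp
  -- The log-likelihood ratio is almost surely the constant -log ν(K).
  refine (integrable_const (Real.log ((ν K)⁻¹).toReal)).congr ?_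
  filter_upwards [hac.ae_le h1, h2] with x hx hxK
  rw [llr, hx, Set.indicator_of_mem hxK]

end ReferenceMeasures

/-! ### The weights e^{-(V - κϑ)} and their dependence on κ. -/

section Gas

open InformationTheory
open scoped BoundedContinuousFunction

/-- The density `e^{-(V - κ ϑ)}`. -/
noncomputable def boltzmannWeight {X : Type*} (V : X → EReal) (ϑ : X → ℝ) (κ : ℝ) (x : X) :
    ℝ≥0∞ :=
  EReal.exp (-shiftedPotential V ϑ κ x)

/-- Isolates κ in a finite positive factor; where V = +∞ both sides vanish. -/
theorem boltzmannWeight_eq {X : Type*} {V : X → EReal} (hV : ∀ x, V x ≠ ⊥) (ϑ : X → ℝ) (κ : ℝ)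
    (x : X) :
    boltzmannWeight V ϑ κ x = EReal.exp (-V x) * ENNReal.ofReal (Real.exp (κ * ϑ x)) := by
  rw [boltzmannWeight, shiftedPotential]
  have hx := hV x
  generalize V x = v at hx
  induction v with
  | bot => exact absurd rfl hx
  | coe r =>
    rw [← EReal.coe_sub, ← EReal.coe_neg, ← EReal.coe_neg, EReal.exp_coe, EReal.exp_coe,
      ← ENNReal.ofReal_mul (Real.exp_pos _).le, ← Real.exp_add]
    congr 2
    ring
  | top => rw [EReal.top_sub_coe]; simp

/-- Trades a shift of κ for an exponential factor in ϑ: integrability at all κ ≥ 0 thus provides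
exponential moments of ϑ. -/
theorem boltzmannWeight_add {X : Type*} {V : X → EReal} (hV : ∀ x, V x ≠ ⊥) (ϑ : X → ℝ)
    (κ s : ℝ) (x : X) :
    boltzmannWeight V ϑ (κ + s) x =
      boltzmannWeight V ϑ κ x * ENNReal.ofReal (Real.exp (s * ϑ x)) := by
  rw [boltzmannWeight_eq hV, boltzmannWeight_eq hV, mul_assoc,
    ← ENNReal.ofReal_mul (Real.exp_pos _).le, ← Real.exp_add, add_mul]

theorem boltzmannWeight_mono {X : Type*} {V : X → EReal} (hV : ∀ x, V x ≠ ⊥) {ϑ : X → ℝ}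
    (hϑ : ∀ x, 0 ≤ ϑ x) {κ κ' : ℝ} (h : κ ≤ κ') (x : X) :
    boltzmannWeight V ϑ κ x ≤ boltzmannWeight V ϑ κ' x := by
  rw [boltzmannWeight_eq hV, boltzmannWeight_eq hV]
  have := hϑ x
  gcongr

namespace GasAssumptions

variable {n : ℕ} {X : Type*} [MetricSpace X] [MeasurableSpace X] {ω : Measure X}
  {g : X → X → EReal} {V : X → EReal} {ϑ : X → ℝ}

theorem potential_ne_bot (hA : GasAssumptions n ω g V ϑ) (x : X) : V x ≠ ⊥ := by
  obtain ⟨m, hm⟩ := hA.bddBelow 0 le_rfl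
  intro h
  have := hm x
  rw [shiftedPotential, h] at this
  simp at this

theorem pairKernel_symm (hA : GasAssumptions n ω g V ϑ) (x z : X) :
    pairKernel g ϑ x z = pairKernel g ϑ z x := by
  rw [pairKernel, pairKernel, hA.kernel.symm x z, add_comm (ϑ x)]

theorem lowerSemicontinuous_pairKernel (hA : GasAssumptions n ω g V ϑ) :
    LowerSemicontinuous fun q : X × X => pairKernel g ϑ q.1 q.2 := by
  have h1 : LowerSemicontinuous fun q : X × X => g q.1 q.2 + ((ϑ q.1 + ϑ q.2 : ℝ) : EReal) := by
    refine LowerSemicontinuous.add' hA.kernel.lowerSemicontinuous ?_ fun q =>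
      EReal.continuousAt_add (Or.inr (EReal.coe_ne_bot _)) (Or.inr (EReal.coe_ne_top _))
    have hc : Continuous fun q : X × X => ϑ q.1 + ϑ q.2 :=
      (hA.continuous_theta.comp continuous_fst).add (hA.continuous_theta.comp continuous_snd)
    exact (continuous_coe_real_ereal.comp hc).lowerSemicontinuous
  exact EReal.continuous_toENNReal.comp_lowerSemicontinuous h1 fun a b h =>
    EReal.toENNReal_le_toENNReal h

/-- Used to dominate ν_κ by a multiple of ω, so that the L^p bound on the singular part of g
applies. -/
theorem exists_boltzmannWeight_le (hA : GasAssumptions n ω g V ϑ) {κ : ℝ} (hκ : 0 ≤ κ) :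
    ∃ C : ℝ≥0, ∀ x, boltzmannWeight V ϑ κ x ≤ C := by
  obtain ⟨m, hm⟩ := hA.bddBelow κ hκ
  refine ⟨(Real.exp (-m)).toNNReal, fun x => ?_⟩
  have : EReal.exp ((-m : ℝ) : EReal) = ((Real.exp (-m)).toNNReal : ℝ≥0∞) := EReal.exp_coe _
  rw [← this, boltzmannWeight]
  exact EReal.exp_monotone (by rw [EReal.coe_neg]; exact EReal.neg_le_neg_iff.2 (hm x))

theorem isFiniteMeasure_boltzmannWeight (hA : GasAssumptions n ω g V ϑ) {κ : ℝ} (hκ : 0 ≤ κ) :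
    IsFiniteMeasure (ω.withDensity (boltzmannWeight V ϑ κ)) :=
  isFiniteMeasure_withDensity (hA.potential κ hκ).lintegral_lt_top.ne

variable [BorelSpace X]

theorem measurable_boltzmannWeight (hA : GasAssumptions n ω g V ϑ) (κ : ℝ) :
    Measurable (boltzmannWeight V ϑ κ) := by
  have h0 := hA.potential 0 le_rfl
  have hV : Measurable V := by
    have := measurable_of_continuousOn_lt_top h0.isOpen h0.continuousOn
    have e : shiftedPotential V ϑ 0 = V := by ext x; simp [shiftedPotential]
    rwa [e] at this
  have e : boltzmannWeight V ϑ κ =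
      fun x => EReal.exp (-V x) * ENNReal.ofReal (Real.exp (κ * ϑ x)) := by
    ext x
    exact boltzmannWeight_eq hA.potential_ne_bot ϑ κ x
  rw [e]
  have := hA.continuous_theta.measurable
  exact (EReal.measurable_exp.comp (measurable_neg.comp hV)).mul (by fun_prop)

/-- The reference measures converge when tested against exponentials of bounded functions. -/
theorem tendsto_lintegral_exp_withDensity (hA : GasAssumptions n ω g V ϑ) {γ : ℝ} (hγ : 0 ≤ γ)
    {κ : ℕ → ℝ} (hκ : Tendsto κ atTop (𝓝 γ)) (f : X →ᵇ ℝ) :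
    Tendsto (fun N => ∫⁻ y, ENNReal.ofReal (Real.exp (f y))
        ∂(ω.withDensity (boltzmannWeight V ϑ (κ N)))) atTop
      (𝓝 (∫⁻ y, ENNReal.ofReal (Real.exp (f y)) ∂(ω.withDensity (boltzmannWeight V ϑ γ)))) := by
  have hm : Measurable fun y => ENNReal.ofReal (Real.exp (f y)) := by
    have := f.continuous.measurable
    fun_prop
  simp only [fun κ => lintegral_withDensity_eq_lintegral_mul ω (hA.measurable_boltzmannWeight κ) hm,
    Pi.mul_apply]
  refine tendsto_lintegral_filter_of_dominated_convergence
    -- Weights increase with κ because ϑ ≥ 0, and eventually κ_N ≤ γ + 1.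
    (fun y => boltzmannWeight V ϑ (γ + 1) y * ENNReal.ofReal (Real.exp ‖f‖))
    (Eventually.of_forall fun N => (hA.measurable_boltzmannWeight _).mul hm) ?_ ?_ ?_
  · filter_upwards [hκ.eventually_le_const (lt_add_one γ)] with N hN
    refine Eventually.of_forall fun y => ?_
    gcongr
    · exact boltzmannWeight_mono hA.potential_ne_bot hA.theta_nonneg hN y
    · exact (le_abs_self _).trans (f.norm_coe_le_norm y)
  · rw [lintegral_mul_const _ (hA.measurable_boltzmannWeight _)]
    exact ENNReal.mul_ne_top (hA.potential (γ + 1) (by linarith)).lintegral_lt_top.ne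
      ENNReal.ofReal_ne_top
  · refine Eventually.of_forall fun y => ?_
    refine ENNReal.Tendsto.mul_const ?_ (Or.inr ENNReal.ofReal_ne_top)
    simp only [boltzmannWeight_eq hA.potential_ne_bot]
    refine ENNReal.Tendsto.const_mul ?_ (Or.inl ?_)
    · exact (ENNReal.continuous_ofReal.comp (Real.continuous_exp.comp
        (continuous_id.mul continuous_const))).continuousAt.tendsto.comp hκ
    · simpa using Real.exp_pos _

/-- The weight is positive on a nonempty open subset of A, and ω charges such sets. -/
theorem withDensity_boltzmannWeight_pos [ω.IsOpenPosMeasure] (hA : GasAssumptions n ω g V ϑ) {κ : ℝ}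
    (hκ : 0 ≤ κ) {A : Set X} (hAo : IsOpen A)
    (hne : (A ∩ {x | shiftedPotential V ϑ κ x < ⊤}).Nonempty) :
    0 < ω.withDensity (boltzmannWeight V ϑ κ) A := by
  have ho := hAo.inter (hA.potential κ hκ).isOpen
  refine pos_iff_ne_zero.2 fun h => ?_
  rw [withDensity_apply_eq_zero (hA.measurable_boltzmannWeight κ)] at h
  refine (ho.measure_pos ω hne).ne' (measure_mono_null ?_ h)
  rintro x ⟨hxA, hx⟩
  refine ⟨?_, hxA⟩
  rw [Set.mem_ofPred_eq, boltzmannWeight, ne_eq, EReal.exp_eq_zero_iff, EReal.neg_eq_bot_iff]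
  exact hx.ne

end GasAssumptions

end Gas

/-! ### Finiteness of the free energy, densities, and the partition function. -/

section GasMeasures

open InformationTheory

theorem referenceMeasure_eq {X : Type*} [MeasurableSpace X] (ω : Measure X) (V : X → EReal) (ϑ : X → ℝ) (κ : ℝ) :
    referenceMeasure ω V ϑ κ = (ω.withDensity (boltzmannWeight V ϑ κ) Set.univ)⁻¹ •
      ω.withDensity (boltzmannWeight V ϑ κ) := by
  rw [withDensity_apply _ MeasurableSet.univ, Measure.restrict_univ]
  rfl

namespace GasAssumptions

variable {n : ℕ} {X : Type*} [MetricSpace X] [MeasurableSpace X] {ω : Measure X}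
  {g : X → X → EReal} {V : X → EReal} {ϑ : X → ℝ}

/-- The energy of a measure on a compact set which is dominated by a multiple of `ω` is finite. -/
theorem lintegral_pairKernel_ne_top (hA : GasAssumptions n ω g V ϑ) {μ : Measure X}
    [IsFiniteMeasure μ] {C : ℝ≥0∞} (hC : C ≠ ⊤) (hμ : μ ≤ C • ω) {K : Set X} (hK : IsCompact K)
    (hμK : ∀ᵐ x ∂μ, x ∈ K) : ∫⁻ x, ∫⁻ z, pairKernel g ϑ x z ∂μ ∂μ ≠ ⊤ := by
  obtain ⟨c, -, hdec⟩ := hA.kernel.decomposition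
  -- The single level k = 1 suffices: the continuous part is bounded on K × K, and t ≤ 1 + t^p
  -- controls the singular part.
  obtain ⟨gc, gs, p, hp, hgc, -, hg, hint⟩ := hdec 1 le_rfl
  have hcont : Continuous fun q : X × X => gc q.1 q.2 + (ϑ q.1 + ϑ q.2) :=
    hgc.add ((hA.continuous_theta.comp continuous_fst).add
      (hA.continuous_theta.comp continuous_snd))
  obtain ⟨M, hM⟩ := (hK.prod hK).bddAbove_image hcont.continuousOn
  have hle : ∀ x ∈ K, ∀ z ∈ K, pairKernel g ϑ x z ≤ ENNReal.ofReal M + 1 + gs x z ^ p := by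
    intro x hx z hz
    have h1 : gc x z + (ϑ x + ϑ z) ≤ M := hM ⟨(x, z), ⟨hx, hz⟩, rfl⟩
    have h2 : gs x z ≤ 1 + gs x z ^ p := by
      rcases le_total (gs x z) 1 with h | h
      · exact le_add_right h
      · refine le_add_left ?_
        conv_lhs => rw [← ENNReal.rpow_one (gs x z)]
        exact ENNReal.rpow_le_rpow_of_exponent_le h hp.le
    have h3 : g x z + ((ϑ x + ϑ z : ℝ) : EReal) ≤ ((ENNReal.ofReal M + gs x z : ℝ≥0∞) : EReal) := by
      rw [hg, add_right_comm, ← EReal.coe_add, EReal.coe_ennreal_add]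
      gcongr
      refine (EReal.coe_le_coe_iff.2 h1).trans ?_
      rw [EReal.coe_ennreal_ofReal]
      exact EReal.coe_le_coe_iff.2 (le_max_left _ _)
    calc pairKernel g ϑ x z ≤ ENNReal.ofReal M + gs x z := by
          have := EReal.toENNReal_le_toENNReal h3
          rwa [EReal.toENNReal_coe] at this
      _ ≤ _ := by rw [add_assoc]; gcongr
  have hin : ∀ x ∈ K, ∫⁻ z, pairKernel g ϑ x z ∂μ ≤
      (ENNReal.ofReal M + 1) * μ Set.univ + C * ENNReal.ofReal (c 1) := by
    intro x hx
    calc _ ≤ ∫⁻ z, (ENNReal.ofReal M + 1 + gs x z ^ p) ∂μ :=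
          lintegral_mono_ae (hμK.mono fun z hz => hle x hx z hz)
      _ = (ENNReal.ofReal M + 1) * μ Set.univ + ∫⁻ z, gs x z ^ p ∂μ := by
          rw [lintegral_add_left measurable_const, lintegral_const]
      _ ≤ _ := by
          gcongr
          calc ∫⁻ z, gs x z ^ p ∂μ ≤ ∫⁻ z, gs x z ^ p ∂(C • ω) := lintegral_mono' hμ le_rfl
            _ ≤ _ := by
              rw [lintegral_smul_measure, smul_eq_mul]
              gcongr
              exact hint x
  refine ne_top_of_le_ne_top ?_ (lintegral_mono_ae (hμK.mono fun x hx => hin x hx))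
  rw [lintegral_const]
  finiteness

variable [BorelSpace X]

theorem withDensity_boltzmannWeight_univ_pos [ω.IsOpenPosMeasure] (hA : GasAssumptions n ω g V ϑ)
    {κ : ℝ} (hκ : 0 ≤ κ) : 0 < ω.withDensity (boltzmannWeight V ϑ κ) Set.univ :=
  hA.withDensity_boltzmannWeight_pos hκ isOpen_univ (by
    rw [Set.univ_inter]; exact (hA.potential κ hκ).nonempty)

theorem isProbabilityMeasure_referenceMeasure [ω.IsOpenPosMeasure]
    (hA : GasAssumptions n ω g V ϑ) {κ : ℝ} (hκ : 0 ≤ κ) :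
    IsProbabilityMeasure (referenceMeasure ω V ϑ κ) := by
  have := hA.isFiniteMeasure_boltzmannWeight hκ
  refine ⟨?_⟩
  rw [referenceMeasure_eq, Measure.smul_apply, smul_eq_mul,
    ENNReal.inv_mul_cancel (hA.withDensity_boltzmannWeight_univ_pos hκ).ne' (measure_ne_top _ _)]

theorem smul_referenceMeasure [ω.IsOpenPosMeasure] (hA : GasAssumptions n ω g V ϑ) {κ : ℝ}
    (hκ : 0 ≤ κ) :
    ω.withDensity (boltzmannWeight V ϑ κ) Set.univ • referenceMeasure ω V ϑ κ =
      ω.withDensity (boltzmannWeight V ϑ κ) := by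
  have := hA.isFiniteMeasure_boltzmannWeight hκ
  rw [referenceMeasure_eq, smul_smul,
    ENNReal.mul_inv_cancel (hA.withDensity_boltzmannWeight_univ_pos hκ).ne' (measure_ne_top _ _),
    one_smul]

theorem exists_referenceMeasure_le [ω.IsOpenPosMeasure] (hA : GasAssumptions n ω g V ϑ) {κ : ℝ}
    (hκ : 0 ≤ κ) : ∃ C : ℝ≥0∞, C ≠ ⊤ ∧ referenceMeasure ω V ϑ κ ≤ C • ω := by
  obtain ⟨C, hC⟩ := hA.exists_boltzmannWeight_le hκ
  refine ⟨(ω.withDensity (boltzmannWeight V ϑ κ) Set.univ)⁻¹ * C, ENNReal.mul_ne_top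
    (ENNReal.inv_ne_top.2 (hA.withDensity_boltzmannWeight_univ_pos hκ).ne') ENNReal.coe_ne_top, ?_⟩
  rw [referenceMeasure_eq, ← smul_smul]
  have h : ω.withDensity (boltzmannWeight V ϑ κ) ≤ (C : ℝ≥0∞) • ω := by
    rw [← withDensity_const]
    exact withDensity_mono (Eventually.of_forall hC)
  refine Measure.le_iff'.2 fun s => ?_
  simp only [Measure.smul_apply, smul_eq_mul]
  gcongr
  simpa using h s

/-- The free energy is finite at the reference measure conditioned on a compact set with nonempty
interior in the domain of the potential. -/
theorem exists_freeEnergy_lt_top [ω.IsOpenPosMeasure] [WeaklyLocallyCompactSpace X]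
    (hA : GasAssumptions n ω g V ϑ) {γ : ℝ} (hγ : 0 ≤ γ) :
    ∃ μ : ProbabilityMeasure X, freeEnergy ω g V ϑ γ μ < ⊤ := by
  obtain ⟨x₀, hx₀⟩ := (hA.potential γ hγ).nonempty
  obtain ⟨K, hK, hKx⟩ := exists_compact_mem_nhds x₀
  set ν := referenceMeasure ω V ϑ γ with hν
  have hνp : IsProbabilityMeasure ν := hA.isProbabilityMeasure_referenceMeasure hγ
  have hfin := hA.isFiniteMeasure_boltzmannWeight hγ
  have hKm : MeasurableSet K := hK.isClosed.measurableSet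
  have hνK : ν K ≠ 0 := by
    rw [hν, referenceMeasure_eq, Measure.smul_apply, smul_eq_mul]
    refine mul_ne_zero (ENNReal.inv_ne_zero.2 (measure_ne_top _ _)) (ne_of_gt ?_)
    exact (hA.withDensity_boltzmannWeight_pos hγ isOpen_interior
      ⟨x₀, mem_interior_iff_mem_nhds.2 hKx, hx₀⟩).trans_le (measure_mono interior_subset)
  have hμp : IsProbabilityMeasure ((ν K)⁻¹ • ν.restrict K) := ⟨by
    rw [Measure.smul_apply, Measure.restrict_apply_univ, smul_eq_mul,
      ENNReal.inv_mul_cancel hνK (measure_ne_top _ _)]⟩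
  obtain ⟨C, hC, hle⟩ := hA.exists_referenceMeasure_le hγ
  refine ⟨⟨_, hμp⟩, ENNReal.add_lt_top.2 ⟨ENNReal.mul_lt_top ENNReal.ofReal_lt_top
    (lt_top_iff_ne_top.2 ?_), lt_top_iff_ne_top.2 (klDiv_cond_ne_top ν hKm hνK)⟩⟩
  refine hA.lintegral_pairKernel_ne_top (μ := (ν K)⁻¹ • ν.restrict K) (C := (ν K)⁻¹ * C)
    (ENNReal.mul_ne_top (ENNReal.inv_ne_top.2 hνK) hC) ?_ hK ?_
  · rw [← smul_smul]
    refine Measure.le_iff'.2 fun s => ?_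
    simp only [Measure.smul_apply, smul_eq_mul]
    gcongr
    simpa using (Measure.restrict_le_self s).trans (hle s)
  · rw [ae_iff, Measure.smul_apply, Measure.restrict_apply' hKm]
    have : {x | x ∉ K} ∩ K = ∅ := by ext; simp
    rw [this]
    simp

/-- A measure of finite entropy has finite `ϑ`-moment. -/
theorem lintegral_theta_ne_top [ω.IsOpenPosMeasure] (hA : GasAssumptions n ω g V ϑ) {γ : ℝ}
    (hγ : 0 ≤ γ) {μ : Measure X} [IsProbabilityMeasure μ]
    (hμ : klDiv μ (referenceMeasure ω V ϑ γ) ≠ ⊤) : ∫⁻ x, ENNReal.ofReal (ϑ x) ∂μ ≠ ⊤ := by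
  have := hA.isProbabilityMeasure_referenceMeasure hγ
  have hm : Measurable fun x => ENNReal.ofReal (Real.exp (ϑ x)) := by
    have := hA.continuous_theta.measurable
    fun_prop
  refine ne_top_of_le_ne_top (ENNReal.add_ne_top.2 ⟨hμ, ?_⟩)
    (lintegral_le_klDiv_add_lintegral_exp μ _ hA.continuous_theta.measurable)
  rw [referenceMeasure_eq, lintegral_smul_measure, smul_eq_mul,
    lintegral_withDensity_eq_lintegral_mul ω (hA.measurable_boltzmannWeight γ) hm]
  refine ENNReal.mul_ne_top
    (ENNReal.inv_ne_top.2 (hA.withDensity_boltzmannWeight_univ_pos hγ).ne') ?_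
  -- Up to normalization, ∫ e^ϑ dν_γ is the mass of the weight at γ + 1.
  have h1 := hA.potential (γ + 1) (by linarith)
  convert h1.lintegral_lt_top.ne using 4 with x
  have := boltzmannWeight_add hA.potential_ne_bot ϑ γ 1 x
  rw [one_mul] at this
  exact this.symm

/-- The density, with respect to the measure `e^{-(V - κ ϑ)} ω`, of a measure of finite entropy
relative to `ν_γ`. -/
theorem exists_eq_withDensity [ω.IsOpenPosMeasure] (hA : GasAssumptions n ω g V ϑ) {γ : ℝ}
    (hγ : 0 ≤ γ) {ℓ : ℝ}
    (hℓ : ω.withDensity (boltzmannWeight V ϑ γ) Set.univ = ENNReal.ofReal (Real.exp ℓ))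
    {μ : Measure X} [IsProbabilityMeasure μ] (hμ : μ ≪ referenceMeasure ω V ϑ γ) (κ : ℝ) :
    ∃ q : X → ℝ≥0∞, Measurable q ∧
      μ = (ω.withDensity (boltzmannWeight V ϑ κ)).withDensity q ∧
      ∀ x, q x ≤ ENNReal.ofReal
        (Real.exp (llr μ (referenceMeasure ω V ϑ γ) x - ℓ + |κ - γ| * ϑ x)) := by
  set ν := referenceMeasure ω V ϑ γ with hν
  have hνp : IsProbabilityMeasure ν := hA.isProbabilityMeasure_referenceMeasure hγ
  have hϑ := hA.continuous_theta.measurable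
  have hr : Measurable fun x => ENNReal.ofReal (μ.rnDeriv ν x).toReal :=
    (μ.measurable_rnDeriv ν).ennreal_toReal.ennreal_ofReal
  have hq : Measurable fun x => ENNReal.ofReal (Real.exp ((γ - κ) * ϑ x - ℓ)) := by fun_prop
  refine ⟨_, hq.mul hr, ?_, fun x => ?_⟩
  -- This version of the density is finite everywhere, so the bound on q holds at every point.
  · have h1 : μ = ν.withDensity fun x => ENNReal.ofReal (μ.rnDeriv ν x).toReal := by
      conv_lhs => rw [← Measure.withDensity_rnDeriv_eq μ ν hμ]
      refine withDensity_congr_ae ?_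
      filter_upwards [Measure.rnDeriv_lt_top μ ν] with x hx
      exact (ENNReal.ofReal_toReal hx.ne).symm
    have h2 : ν = (ω.withDensity (boltzmannWeight V ϑ κ)).withDensity
        fun x => ENNReal.ofReal (Real.exp ((γ - κ) * ϑ x - ℓ)) := by
      rw [hν, referenceMeasure_eq, hℓ, ← withDensity_smul _ (hA.measurable_boltzmannWeight γ),
        ← withDensity_mul _ (hA.measurable_boltzmannWeight κ) hq]
      congr 1
      ext x
      have h := boltzmannWeight_add hA.potential_ne_bot ϑ κ (γ - κ) x
      rw [add_sub_cancel] at h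
      rw [Pi.smul_apply, Pi.mul_apply, smul_eq_mul, h, sub_eq_add_neg _ ℓ, Real.exp_add,
        ENNReal.ofReal_mul (Real.exp_pos _).le, Real.exp_neg ℓ,
        ENNReal.ofReal_inv_of_pos (Real.exp_pos _)]
      ring
    rw [withDensity_mul _ hq hr, ← h2]
    exact h1
  · rw [Pi.mul_apply, ← ENNReal.ofReal_mul (Real.exp_pos _).le]
    refine ENNReal.ofReal_le_ofReal ?_
    -- An inequality because `Real.log 0 = 0`: where the density vanishes the right-hand side is 1.
    have h1 : (μ.rnDeriv ν x).toReal ≤ Real.exp (llr μ ν x) := Real.le_exp_log _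
    calc _ ≤ Real.exp ((γ - κ) * ϑ x - ℓ) * Real.exp (llr μ ν x) := by gcongr
      _ = Real.exp (llr μ ν x - ℓ + (γ - κ) * ϑ x) := by
          rw [← Real.exp_add]; congr 1; ring
      _ ≤ _ := by
          have h2 := hA.theta_nonneg x
          have h3 : γ - κ ≤ |κ - γ| := by rw [abs_sub_comm]; exact le_abs_self _
          gcongr

variable [SecondCountableTopology X]

theorem withDensity_exp_neg_gibbsEnergy [SigmaFinite ω] (hA : GasAssumptions n ω g V ϑ) {β : ℝ}
    (hβ : 0 ≤ β) (N : ℕ) :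
    ((Measure.pi fun _ : Fin N => ω).withDensity fun x => EReal.exp (-gibbsEnergy β g V x)) =
      pairGibbs (pairKernel g ϑ) β
        (ω.withDensity (boltzmannWeight V ϑ (β * ((N - 1 : ℕ) : ℝ)))) N := by
  have hw := hA.measurable_boltzmannWeight (β * ((N - 1 : ℕ) : ℝ))
  have := hA.isFiniteMeasure_boltzmannWeight (κ := β * ((N - 1 : ℕ) : ℝ)) (by positivity)
  rw [pairGibbs, pi_withDensity ω hw, ← withDensity_mul]
  · congr 1
    ext x
    rw [exp_neg_gibbsEnergy hA.neg_kernel_le hA.potential_ne_bot hβ, mul_comm]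
    rfl
  · exact Finset.measurable_prod _ fun j _ => hw.comp (measurable_pi_apply j)
  · exact (measurable_boltzmann β).comp
      (measurable_pairSum hA.lowerSemicontinuous_pairKernel.measurable N)

theorem partitionFunction_eq [SigmaFinite ω] (hA : GasAssumptions n ω g V ϑ) {β : ℝ}
    (hβ : 0 ≤ β) (N : ℕ) :
    partitionFunction ω β g V N = pairGibbs (pairKernel g ϑ) β
        (ω.withDensity (boltzmannWeight V ϑ (β * ((N - 1 : ℕ) : ℝ)))) N Set.univ := by
  rw [← hA.withDensity_exp_neg_gibbsEnergy hβ N, withDensity_apply _ MeasurableSet.univ,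
    Measure.restrict_univ]
  rfl

theorem empiricalLaw_eq [SigmaFinite ω] (hA : GasAssumptions n ω g V ϑ) {β : ℝ}
    (hβ : 0 ≤ β) (N : ℕ) (A : Set (ProbabilityMeasure X)) :
    empiricalLaw ω β g V N A =
      (pairGibbs (pairKernel g ϑ) β
        (ω.withDensity (boltzmannWeight V ϑ (β * ((N - 1 : ℕ) : ℝ)))) N Set.univ)⁻¹ *
      pairGibbs (pairKernel g ϑ) β
        (ω.withDensity (boltzmannWeight V ϑ (β * ((N - 1 : ℕ) : ℝ)))) N (empiricalEvent N A) := by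
  rw [← hA.partitionFunction_eq hβ, ← hA.withDensity_exp_neg_gibbsEnergy hβ N]
  rfl

/-- After the transfer of ϑ the Boltzmann factor is at most 1 and the reference measure is finite.
-/
theorem partitionFunction_lt_top [SigmaFinite ω] (hA : GasAssumptions n ω g V ϑ) {β : ℝ}
    (hβ : 0 ≤ β) (N : ℕ) : partitionFunction ω β g V N < ⊤ := by
  have := hA.isFiniteMeasure_boltzmannWeight (κ := β * ((N - 1 : ℕ) : ℝ)) (by positivity)
  rw [hA.partitionFunction_eq hβ, pairGibbs, withDensity_apply _ MeasurableSet.univ,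
    Measure.restrict_univ]
  refine lt_of_le_of_lt (lintegral_mono fun x => boltzmann_le_one β _) ?_
  rw [lintegral_one]
  exact measure_lt_top _ _

/-- Tilting to a measure of finite free energy; the parameter 1 used for that free energy is an
arbitrary positive number. -/
theorem partitionFunction_pos [SigmaFinite ω] [ω.IsOpenPosMeasure] [WeaklyLocallyCompactSpace X]
    (hA : GasAssumptions n ω g V ϑ) {β : ℝ} (hβ : 0 ≤ β) (N : ℕ) :
    0 < partitionFunction ω β g V N := by
  have hfin := hA.isFiniteMeasure_boltzmannWeight (κ := β * ((N - 1 : ℕ) : ℝ)) (by positivity)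
  have hfin1 := hA.isFiniteMeasure_boltzmannWeight zero_le_one
  obtain ⟨μ, hμ⟩ := hA.exists_freeEnergy_lt_top zero_le_one
  obtain ⟨hE, hK⟩ := ENNReal.add_ne_top.1 hμ.ne
  have hE' : weightedEnergy g ϑ (μ : Measure X) ≠ ⊤ := fun h => by
    rw [h, ENNReal.mul_top (by simp)] at hE
    exact hE rfl
  have hZ : ω.withDensity (boltzmannWeight V ϑ 1) Set.univ =
      ENNReal.ofReal (Real.exp (Real.log (ω.withDensity (boltzmannWeight V ϑ 1) Set.univ).toReal)) := by
    rw [Real.exp_log (ENNReal.toReal_pos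
      (hA.withDensity_boltzmannWeight_univ_pos zero_le_one).ne' (measure_ne_top _ _)),
      ENNReal.ofReal_toReal (measure_ne_top _ _)]
  obtain ⟨q, hq, hμq, hql⟩ := hA.exists_eq_withDensity zero_le_one hZ
    (klDiv_ne_top_iff.1 hK).1 (β * ((N - 1 : ℕ) : ℝ))
  rw [hA.partitionFunction_eq hβ]
  exact pairGibbs_univ_pos hA.lowerSemicontinuous_pairKernel.measurable β hq
    (fun x => ne_top_of_le_ne_top ENNReal.ofReal_ne_top (hql x)) hμq hE' N

end GasAssumptions

end GasMeasures

/-! ### From exponential bounds at scale N to a normalized large deviation principle. -/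

section LargeDeviations

/-- A large deviation principle for normalized measures `A ↦ Q_N(A) / Z_N` from exponential bounds
on the unnormalized ones. -/
theorem satisfiesLDP_of_exponential_bounds {Y : Type*} [TopologicalSpace Y] {F : Y → ℝ≥0∞}
    (hlsc : LowerSemicontinuous F) (hcpt : ∀ r, r ≠ ⊤ → IsCompact {y | F y ≤ r})
    (hF : ⨅ y, F y ≠ ⊤) {γ : ℝ} (hγ : 0 < γ) {β : ℕ → ℝ} (hβ : ∀ N, 0 < β N)
    (hβγ : Tendsto (fun N : ℕ => (N : ℝ) * β N) atTop (𝓝 γ)) {p Q : ℕ → Set Y → ℝ≥0∞}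
    {Z : ℕ → ℝ≥0∞} (hp : ∀ N A, p N A = (Z N)⁻¹ * Q N A) (hQZ : ∀ N A, Q N A ≤ Z N)
    (hZ : ∀ᶠ N in atTop, Z N = Q N Set.univ) {ℓ : ℝ}
    (hupper : ∀ C, IsClosed C → ∀ c : ℝ, (∀ y ∈ C, ENNReal.ofReal c ≤ F y) → ∀ ε : ℝ, 0 < ε →
      ∀ᶠ N : ℕ in atTop, Q N C ≤ ENNReal.ofReal (Real.exp (N * (ℓ - c + ε))))
    (hlower : ∀ O, IsOpen O → ∀ y ∈ O, F y ≠ ⊤ → ∀ ε : ℝ, 0 < ε →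
      ∀ᶠ N : ℕ in atTop, ENNReal.ofReal (Real.exp (N * (ℓ - (F y).toReal - ε))) ≤ Q N O) :
    SatisfiesLDP p (fun N => β N * (N : ℝ) ^ 2)
      (fun y => ENNReal.ofReal γ⁻¹ * (F y - ⨅ y', F y')) := by
  set m := ⨅ y, F y with hm
  have hmF : ∀ y, m ≤ F y := fun y => iInf_le _ y
  have hγ0 : ENNReal.ofReal γ⁻¹ ≠ 0 := by simpa using hγ
  have hγi : (ENNReal.ofReal γ⁻¹)⁻¹ = ENNReal.ofReal γ := by
    rw [← ENNReal.ofReal_inv_of_pos (by positivity), inv_inv]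
  have hle : ∀ t y, ENNReal.ofReal γ⁻¹ * (F y - m) ≤ t ↔ F y ≤ ENNReal.ofReal γ * t + m := by
    intro t y
    rw [ENNReal.mul_le_iff_le_inv hγ0 ENNReal.ofReal_ne_top, hγi, tsub_le_iff_right]
  have hZlow : ∀ ε : ℝ, 0 < ε → ∀ᶠ N : ℕ in atTop,
      ENNReal.ofReal (Real.exp (N * (ℓ - m.toReal - ε))) ≤ Z N := by
    intro ε hε
    have hlt : ⨅ y, F y < m + ENNReal.ofReal (ε / 2) :=
      ENNReal.lt_add_right hF (by simpa using hε)
    obtain ⟨y, hy⟩ := iInf_lt_iff.1 hlt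
    filter_upwards [hlower Set.univ isOpen_univ y trivial hy.ne_top (ε / 2) (by positivity), hZ]
      with N hN hZN
    rw [hZN]
    refine le_trans (ENNReal.ofReal_le_ofReal (Real.exp_le_exp.2 ?_)) hN
    have h1 : (F y).toReal ≤ m.toReal + ε / 2 := by
      have := ENNReal.toReal_mono (by finiteness) hy.le
      rwa [ENNReal.toReal_add hF ENNReal.ofReal_ne_top,
        ENNReal.toReal_ofReal (by positivity)] at this
    gcongr _ * ?_
    linarith
  have hZup : ∀ ε : ℝ, 0 < ε → ∀ᶠ N : ℕ in atTop,
      Z N ≤ ENNReal.ofReal (Real.exp (N * (ℓ - m.toReal + ε))) := by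
    intro ε hε
    filter_upwards [hupper Set.univ isClosed_univ m.toReal
      (fun y _ => by rw [ENNReal.ofReal_toReal hF]; exact hmF y) ε hε, hZ] with N hN hZN
    rwa [hZN]
  have hspeed : Tendsto (fun N => β N * (N : ℝ) ^ 2) atTop atTop := by
    refine (tendsto_natCast_atTop_atTop.atTop_mul_pos hγ hβγ).congr fun N => ?_
    ring
  have ha : ∀ᶠ N : ℕ in atTop, 0 < β N * (N : ℝ) ^ 2 := hspeed.eventually_gt_atTop 0
  -- Passing from scale N to the speed β_N N² = N · (N β_N) produces the factor 1/γ.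
  have hratio : ∀ s : ℝ, Tendsto (fun N : ℕ => (β N * (N : ℝ) ^ 2)⁻¹ * (N * s)) atTop
      (𝓝 (γ⁻¹ * s)) := by
    intro s
    refine ((hβγ.inv₀ hγ.ne').mul_const s).congr' ?_
    filter_upwards [eventually_gt_atTop 0] with N hN
    have := hβ N
    field_simp
  have hlog : ∀ s : ℝ, ENNReal.log (ENNReal.ofReal (Real.exp s)) = (s : EReal) := by
    intro s
    rw [← EReal.exp_coe, EReal.log_exp]
  refine ⟨hspeed, ?_, fun r => ?_, fun C hC => ?_, fun O hO => ?_⟩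
  · have hc : Continuous fun t : ℝ≥0∞ => ENNReal.ofReal γ⁻¹ * (t - m) :=
      (ENNReal.continuous_const_mul ENNReal.ofReal_ne_top).comp (ENNReal.continuous_sub_right m)
    exact hc.comp_lowerSemicontinuous hlsc fun s t h => by
      dsimp only
      gcongr
  · simp only [hle]
    exact hcpt _ (by finiteness)
  · rw [EReal.le_neg]
    refine EReal.ge_of_forall_gt_iff_ge.1 fun t ht => ?_
    rw [EReal.le_neg]
    -- The room between t and t' absorbs the two errors ε, one from the numerator and one from Z_N.
    obtain ⟨t', htt', ht'⟩ := EReal.lt_iff_exists_real_btwn.1 ht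
    rw [EReal.coe_lt_coe_iff] at htt'
    refine limsup_le_of_le (by isBoundedDefault) ?_
    -- For t ≤ 0 the bound p ≤ 1 is enough.
    rcases le_or_gt t 0 with h0 | h0
    · filter_upwards [ha] with N hN
      have h1 : p N C ≤ 1 := by
        rw [hp]
        calc _ ≤ (Z N)⁻¹ * Z N := by gcongr; exact hQZ N C
          _ ≤ 1 := ENNReal.inv_mul_le_one _
      have h2 : ENNReal.log (p N C) ≤ 0 := by
        rw [← ENNReal.log_one]
        exact ENNReal.log_monotone h1
      have h3 : (((β N * (N : ℝ) ^ 2)⁻¹ : ℝ) : EReal) * ENNReal.log (p N C) ≤ 0 :=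
        EReal.mul_nonpos_iff.2 (Or.inl ⟨EReal.coe_nonneg.2 (by positivity), h2⟩)
      refine h3.trans ?_
      rw [← EReal.coe_neg]
      exact EReal.coe_nonneg.2 (by linarith)
    · have ht0 : 0 < t' := h0.trans htt'
      have hC' : ∀ y ∈ C, ENNReal.ofReal (γ * t' + m.toReal) ≤ F y := by
        intro y hy
        have h1 : ((ENNReal.ofReal t' : ℝ≥0∞) : EReal) <
            ((ENNReal.ofReal γ⁻¹ * (F y - m) : ℝ≥0∞) : EReal) := by
          rw [EReal.coe_ennreal_ofReal, max_eq_left ht0.le]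
          exact ht'.trans_le (iInf₂_le y hy)
        rw [EReal.coe_ennreal_lt_coe_ennreal_iff, ← not_le, hle, not_le] at h1
        rw [ENNReal.ofReal_add (by positivity) ENNReal.toReal_nonneg, ENNReal.ofReal_toReal hF,
          ENNReal.ofReal_mul hγ.le]
        exact h1.le
      set ε := γ * (t' - t) / 4 with hε
      have hε0 : 0 < ε := by have := sub_pos.2 htt'; positivity
      have hlim : γ⁻¹ * (-(γ * t') + 2 * ε) < -t := by
        have e : γ⁻¹ * (-(γ * t') + 2 * ε) = -t' + (t' - t) / 2 := by
          rw [hε]; field_simp; ring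
        rw [e]; linarith
      filter_upwards [hupper C hC _ hC' ε hε0, hZlow ε hε0, ha,
        (hratio (-(γ * t') + 2 * ε)).eventually_lt_const hlim] with N h1 h2 h3 h4
      have h5 : p N C ≤ ENNReal.ofReal (Real.exp (N * (-(γ * t') + 2 * ε))) := by
        rw [hp]
        calc _ ≤ (ENNReal.ofReal (Real.exp (N * (ℓ - m.toReal - ε))))⁻¹ *
              ENNReal.ofReal (Real.exp (N * (ℓ - (γ * t' + m.toReal) + ε))) := by
              gcongr
          _ = _ := by
              rw [← ENNReal.ofReal_inv_of_pos (Real.exp_pos _), ← Real.exp_neg,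
                ← ENNReal.ofReal_mul (Real.exp_pos _).le, ← Real.exp_add]
              congr 2
              ring
      calc _ ≤ (((β N * (N : ℝ) ^ 2)⁻¹ : ℝ) : EReal) *
            ((N * (-(γ * t') + 2 * ε) : ℝ) : EReal) := by
            rw [← hlog (N * (-(γ * t') + 2 * ε))]
            exact mul_le_mul_of_nonneg_left (ENNReal.log_monotone h5)
              (EReal.coe_nonneg.2 (by positivity))
        _ ≤ _ := by
            rw [← EReal.coe_mul, ← EReal.coe_neg, EReal.coe_le_coe_iff]
            exact h4.le
  · refine EReal.ge_of_forall_gt_iff_ge.1 fun z hz => ?_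
    rw [EReal.lt_neg_comm] at hz
    obtain ⟨y, hy⟩ := iInf_lt_iff.1 hz
    obtain ⟨hyO, hy⟩ := iInf_lt_iff.1 hy
    have hFy : F y ≠ ⊤ := by
      intro h
      rw [h, ENNReal.top_sub hF, ENNReal.mul_top hγ0] at hy
      exact not_top_lt hy
    have hy' : γ⁻¹ * ((F y).toReal - m.toReal) < -z := by
      have e : ENNReal.ofReal γ⁻¹ * (F y - m) =
          ENNReal.ofReal (γ⁻¹ * ((F y).toReal - m.toReal)) := by
        rw [ENNReal.ofReal_mul (by positivity), ENNReal.ofReal_sub _ ENNReal.toReal_nonneg,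
          ENNReal.ofReal_toReal hF, ENNReal.ofReal_toReal hFy]
      rw [e, EReal.coe_ennreal_ofReal, ← EReal.coe_neg, EReal.coe_lt_coe_iff] at hy
      exact (le_max_left _ _).trans_lt hy
    set s := (F y).toReal - m.toReal with hs
    -- The two errors ε together use half of the gap between z and -I(y).
    set ε := γ * (-z - γ⁻¹ * s) / 4 with hε
    have hε0 : 0 < ε := by have := sub_pos.2 hy'; positivity
    have hlim : z < γ⁻¹ * (-s - 2 * ε) := by
      have e : γ⁻¹ * (-s - 2 * ε) = -(γ⁻¹ * s) - (-z - γ⁻¹ * s) / 2 := by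
        rw [hε]; field_simp; ring
      rw [e]; linarith
    refine le_liminf_of_le (by isBoundedDefault) ?_
    filter_upwards [hlower O hO y hyO hFy ε hε0, hZup ε hε0, ha,
      (hratio (-s - 2 * ε)).eventually_const_lt hlim] with N h1 h2 h3 h4
    have h5 : ENNReal.ofReal (Real.exp (N * (-s - 2 * ε))) ≤ p N O := by
      rw [hp]
      calc _ = (ENNReal.ofReal (Real.exp (N * (ℓ - m.toReal + ε))))⁻¹ *
            ENNReal.ofReal (Real.exp (N * (ℓ - (F y).toReal - ε))) := by
            rw [← ENNReal.ofReal_inv_of_pos (Real.exp_pos _), ← Real.exp_neg,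
              ← ENNReal.ofReal_mul (Real.exp_pos _).le, ← Real.exp_add]
            congr 2
            rw [hs]
            ring
        _ ≤ _ := by gcongr
    calc (z : EReal) ≤ (((β N * (N : ℝ) ^ 2)⁻¹ : ℝ) : EReal) *
          ((N * (-s - 2 * ε) : ℝ) : EReal) := by
          rw [← EReal.coe_mul, EReal.coe_le_coe_iff]
          exact h4.le
      _ ≤ _ := by
          rw [← hlog (N * (-s - 2 * ε))]
          exact mul_le_mul_of_nonneg_left (ENNReal.log_monotone h5)
            (EReal.coe_nonneg.2 (by positivity))

end LargeDeviations

/-! ### The large deviation principle for the gas. -/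

section GasLargeDeviations

open InformationTheory
open scoped BoundedContinuousFunction

/-- Stated on a locally compact second countable metric space with a σ-finite measure charging open
sets, which is all that is retained of the manifold. -/
theorem GasAssumptions.satisfiesLDP {n : ℕ} {X : Type*} [MetricSpace X] [MeasurableSpace X]
    [BorelSpace X] [SecondCountableTopology X] [WeaklyLocallyCompactSpace X] {ω : Measure X}
    [SigmaFinite ω] [ω.IsOpenPosMeasure] {g : X → X → EReal} {V : X → EReal} {ϑ : X → ℝ}
    (hA : GasAssumptions n ω g V ϑ) {γ : ℝ} (hγ : 0 < γ) {β : ℕ → ℝ} (hβ : ∀ N, 0 < β N)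
    (hβγ : Tendsto (fun N : ℕ => (N : ℝ) * β N) atTop (𝓝 γ)) :
    SatisfiesLDP (fun N => empiricalLaw ω (β N) g V N) (fun N => β N * (N : ℝ) ^ 2)
      (fun μ : ProbabilityMeasure X => ENNReal.ofReal γ⁻¹ *
        (freeEnergy ω g V ϑ γ μ - ⨅ μ' : ProbabilityMeasure X, freeEnergy ω g V ϑ γ μ')) := by
  have hν := hA.isProbabilityMeasure_referenceMeasure hγ.le
  set ν := referenceMeasure ω V ϑ γ with hνd
  have hG := hA.lowerSemicontinuous_pairKernel
  set κ : ℕ → ℝ := fun N => β N * ((N - 1 : ℕ) : ℝ) with hκd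
  have hκ0 : ∀ N, 0 ≤ κ N := fun N => mul_nonneg (hβ N).le (Nat.cast_nonneg _)
  have hκ : Tendsto κ atTop (𝓝 γ) := by
    have h := hβγ.sub (tendsto_zero_of_tendsto_nat_mul hβγ)
    rw [sub_zero] at h
    refine h.congr' ?_
    filter_upwards [eventually_ge_atTop 1] with N hN
    simp only [hκd, Nat.cast_sub hN]
    push_cast
    ring
  set ρ : ℕ → Measure X := fun N => ω.withDensity (boltzmannWeight V ϑ (κ N)) with hρd
  have hρf : ∀ N, IsFiniteMeasure (ρ N) := fun N => hA.isFiniteMeasure_boltzmannWeight (hκ0 N)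
  have hfγ := hA.isFiniteMeasure_boltzmannWeight hγ.le
  have hf1 := hA.isFiniteMeasure_boltzmannWeight (κ := γ + 1) (by linarith)
  set Z := ω.withDensity (boltzmannWeight V ϑ γ) Set.univ with hZ
  set ℓ := Real.log Z.toReal with hℓd
  have hℓ : Z = ENNReal.ofReal (Real.exp ℓ) := by
    rw [hℓd, Real.exp_log (ENNReal.toReal_pos
      (hA.withDensity_boltzmannWeight_univ_pos hγ.le).ne' (measure_ne_top _ _)),
      ENNReal.ofReal_toReal (measure_ne_top _ _)]
  have hρ : ∀ f : X →ᵇ ℝ, Tendsto (fun N => ∫⁻ y, ENNReal.ofReal (Real.exp (f y)) ∂(ρ N)) atTop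
      (𝓝 (ENNReal.ofReal (Real.exp ℓ * ∫ y, Real.exp (f y) ∂ν))) := by
    intro f
    have h := hA.tendsto_lintegral_exp_withDensity hγ.le hκ f
    rw [← hA.smul_referenceMeasure hγ.le, lintegral_smul_measure, smul_eq_mul, ← hZ, hℓ,
      ← ofReal_integral_eq_lintegral_ofReal (integrable_exp_of_bounded ν f.continuous.measurable f.norm_coe_le_norm).2
        (Eventually.of_forall fun y => (Real.exp_pos _).le),
      ← ENNReal.ofReal_mul (Real.exp_pos _).le] at h
    exact h
  -- The weight at γ + 1 dominates the weights at γ and, eventually, at κ_N, so one h serves both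
  -- for compact sublevel sets and for exponential tightness.
  obtain ⟨h, hm, hK, hint⟩ :=
    exists_nat_lintegral_exp_ne_top (ω.withDensity (boltzmannWeight V ϑ (γ + 1)))
  have hmono : ∀ t ≤ γ + 1, ω.withDensity (boltzmannWeight V ϑ t) ≤
      ω.withDensity (boltzmannWeight V ϑ (γ + 1)) := fun t ht =>
    withDensity_mono (Eventually.of_forall
      (boltzmannWeight_mono hA.potential_ne_bot hA.theta_nonneg ht))
  obtain ⟨b, hb⟩ : ∃ b : ℝ, ∀ᶠ N in atTop,
      ∫⁻ y, ENNReal.ofReal (Real.exp (h y)) ∂(ρ N) ≤ ENNReal.ofReal (Real.exp b) := by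
    refine ⟨(∫⁻ y, ENNReal.ofReal (Real.exp (h y))
      ∂(ω.withDensity (boltzmannWeight V ϑ (γ + 1)))).toReal, ?_⟩
    filter_upwards [hκ.eventually_le_const (lt_add_one γ)] with N hN
    refine (lintegral_mono' (hmono _ hN) le_rfl).trans ?_
    refine (ENNReal.ofReal_toReal hint).ge.trans (ENNReal.ofReal_le_ofReal ?_)
    exact (le_add_of_nonneg_right zero_le_one).trans (Real.add_one_le_exp _)
  have hintν : ∫⁻ x, ENNReal.ofReal (Real.exp (h x)) ∂ν ≠ ⊤ := by
    rw [hνd, referenceMeasure_eq, lintegral_smul_measure, smul_eq_mul]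
    exact ENNReal.mul_ne_top
      (ENNReal.inv_ne_top.2 (hA.withDensity_boltzmannWeight_univ_pos hγ.le).ne')
      (ne_top_of_le_ne_top hint (lintegral_mono' (hmono γ (by linarith)) le_rfl))
  obtain ⟨μ₀, hμ₀⟩ := hA.exists_freeEnergy_lt_top hγ.le
  refine satisfiesLDP_of_exponential_bounds
    (Q := fun N A => pairGibbs (pairKernel g ϑ) (β N) (ρ N) N (empiricalEvent N A))
    (Z := fun N => pairGibbs (pairKernel g ϑ) (β N) (ρ N) N Set.univ) (ℓ := ℓ)
    (lowerSemicontinuous_meanFieldEnergy hG ν hγ)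
    (fun r hr => isCompact_meanFieldEnergy_le hG ν hγ hm hK hintν hr)
    (ne_top_of_le_ne_top hμ₀.ne (iInf_le _ μ₀)) hγ hβ hβγ
    (fun N A => hA.empiricalLaw_eq (hβ N).le N A)
    (fun N A => measure_mono (Set.subset_univ _)) ?_ ?_ ?_
  -- For N = 0 the empirical measure is zero, so the event is empty; the identity holds only from N
  -- = 1 on.
  · filter_upwards [eventually_gt_atTop 0] with N hN
    have huniv : empiricalEvent N (Set.univ : Set (ProbabilityMeasure X)) = Set.univ :=
      Set.eq_univ_of_forall fun x =>
        ⟨⟨empiricalMeasure x, isProbabilityMeasure_empiricalMeasure hN x⟩, trivial, rfl⟩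
    rw [huniv]
  · intro C hC c hc ε hε
    exact eventually_pairGibbs_closed_le hG hA.pairKernel_symm hγ hβ hβγ hρ hm hK hb hC hc hε
  · intro O hO μ hμ hF ε hε
    have hKL := (ENNReal.add_ne_top.1 hF).2
    choose q hq hqρ hql using fun N =>
      hA.exists_eq_withDensity hγ.le hℓ (klDiv_ne_top_iff.1 hKL).1 (κ N)
    -- The mismatch between κ_N and γ enters the density with a factor ϑ, whose μ-integral is
    -- finite.
    have ha : Tendsto (fun N => |κ N - γ|) atTop (𝓝 0) := by
      have := (hκ.sub_const γ).abs
      simpa using this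
    have h3 := eventually_le_pairGibbs_open hG.measurable hγ hβ hβγ μ hF
      hA.continuous_theta.measurable hA.theta_nonneg (hA.lintegral_theta_ne_top hγ.le hKL)
      (fun N => abs_nonneg _) ha hq hqρ hql (hO.mem_nhds hμ) (ε := ε / 3) (by positivity)
    filter_upwards [h3] with N hN
    rwa [mul_div_cancel₀ _ (three_ne_zero)] at hN

end GasLargeDeviations

theorem mainTheorem10 {n : ℕ} {X : Type*} [MetricSpace X]
    [ChartedSpace (EuclideanSpace ℝ (Fin n)) X] [IsManifold (𝓡 n) 1 X]
    [RiemannianBundle (fun x : X => TangentSpace (𝓡 n) x)]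
    [IsContinuousRiemannianBundle (EuclideanSpace ℝ (Fin n))
      (fun x : X => TangentSpace (𝓡 n) x)]
    [IsRiemannianManifold (𝓡 n) X] [ConnectedSpace X] [SecondCountableTopology X]
    [MeasurableSpace X] [BorelSpace X]
    (g : X → X → EReal) (V : X → EReal) (ϑ : X → ℝ)
    (hA : GasAssumptions n (riemannianVolume n X) g V ϑ)
    (γ : ℝ) (hγ : 0 < γ) (β : ℕ → ℝ) (hβ : ∀ N, 0 < β N)
    (hβγ : Tendsto (fun N : ℕ => (N : ℝ) * β N) atTop (𝓝 γ)) :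
    (∀ N, 0 < partitionFunction (riemannianVolume n X) (β N) g V N ∧
      partitionFunction (riemannianVolume n X) (β N) g V N < ⊤) ∧
    (∃ μ : ProbabilityMeasure X, freeEnergy (riemannianVolume n X) g V ϑ γ μ < ⊤) ∧
    SatisfiesLDP (fun N => empiricalLaw (riemannianVolume n X) (β N) g V N)
      (fun N => β N * (N : ℝ) ^ 2)
      (fun μ : ProbabilityMeasure X => ENNReal.ofReal γ⁻¹ *
        (freeEnergy (riemannianVolume n X) g V ϑ γ μ -
          ⨅ μ' : ProbabilityMeasure X, freeEnergy (riemannianVolume n X) g V ϑ γ μ')) := by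
  -- Local finiteness together with second countability supplies σ-finiteness of ω.
  have := isOpenPosMeasure_riemannianVolume (n := n) (X := X)
  have := isLocallyFiniteMeasure_riemannianVolume (n := n) (X := X)
  have : LocallyCompactSpace X := ChartedSpace.locallyCompactSpace (EuclideanSpace ℝ (Fin n)) X
  exact ⟨fun N => ⟨hA.partitionFunction_pos (hβ N).le N, hA.partitionFunction_lt_top (hβ N).le N⟩,
    hA.exists_freeEnergy_lt_top hγ.le, hA.satisfiesLDP hγ hβ hβγ⟩
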